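/- Let $\mathbb{C}_\infty$ be the Riemann sphere, $\mathbb{D}$ the open unit disk, $\mathbb{T}=\partial\mathbb{D}$ and $\mathbb{D}^*=\mathbb{C}_\infty\setminus\overline{\mathbb{D}}$. A Jordan domain is a domain $\Omega\subset\mathbb{C}_\infty$ whose boundary is a Jordan curve; put $\Omega^*=\mathbb{C}_\infty\setminus\overline{\Omega}$. A conformal welding for $\Omega$ is a homeomorphism $h=f^{-1}\circ g:\mathbb{T}\to\mathbb{T}$, where $f:\mathbb{D}\to\Omega$ and $g:\mathbb{D}^*\to\Omega^*$ are conformal maps onto, extended to homeomorphisms of the closures. Write $[\Omega]=\{T(\Omega): T \text{ a Möbius transformation}\}$, $[h]=\{\phi\circ h\circ\psi:\phi,\psi\in\operatorname{Aut}(\mathbb{D})\}$ (automorphisms of $\mathbb{D}$ acting on $\mathbb{T}$), and let $\mathcal{W}([\Omega])=[h]$ for any conformal welding $h$ for $\Omega$. For an open set $U\subset\mathbb{C}_\infty$ let $CH(U)$ be the set of homeomorphisms of $\mathbb{C}_\infty$ onto itself that are conformal on $U$. A compact set $E\subset\mathbb{C}_\infty$ is $CH$-removable if every element of $CH(\mathbb{C}_\infty\setminus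 E)$ is a Möbius transformation. Every Jordan domain has a conformal welding, and $\mathcal{W}$ is a well-defined map on the classes $[\Omega]$ of Jordan domains. Moreover: (1) Let $\Omega,\tilde\Omega\subset\mathbb{C}_\infty$ be Jordan domains. Then $\mathcal{W}([\Omega])=\mathcal{W}([\tilde\Omega])$ if and only if there exists $F\in CH(\mathbb{C}_\infty\setminus\partial\Omega)$ such that $F(\Omega)=\tilde\Omega$. (2) Let $\Omega$ be a Jordan domain such that $\partial\Omega$ is $CH$-removable. Then for every Jordan domain $\tilde\Omega$, $\mathcal{W}([\Omega])=\mathcal{W}([\tilde\Omega])$ if and only if $[\Omega]=[\tilde\Omega]$. -/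

import Mathlib

open scoped OnePoint

noncomputable section

namespace ConformalWelding

/-- The Riemann sphere `ℂ ∪ {∞}`, as a topological space. -/
abbrev Sphere : Type := OnePoint ℂ

/-- The inverse of the standard chart around `p`: the inclusion `w ↦ w` of the plane if `p` is
finite, and `w ↦ 1 / w` (with `0 ↦ ∞`) if `p = ∞`. -/
def param (p : Sphere) (w : ℂ) : Sphere :=
  open Classical in
  if p = ∞ then (if w = 0 then ∞ else ((w⁻¹ : ℂ) : Sphere)) else (w : Sphere)

/-- The standard chart around `p`: `z ↦ z` on the plane if `p` is finite, and `z ↦ 1 / z`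
(with `∞ ↦ 0`) on the sphere minus the origin if `p = ∞`. The values outside of these
neighbourhoods of `p` are irrelevant. -/
def coord (p : Sphere) (x : Sphere) : ℂ :=
  open Classical in
  if p = ∞ then x.elim 0 (fun z => z⁻¹) else x.elim 0 (fun z => z)

/-- `F`, as a map from the sphere to the sphere, is complex differentiable at `p`: it is
continuous at `p`, and its expression in the standard charts around `p` and `F p` is complex
differentiable at the coordinate of `p`. -/
def HolomorphicAt (F : Sphere → Sphere) (p : Sphere) : Prop :=
  ContinuousAt F p ∧
    DifferentiableAt ℂ (fun w : ℂ => coord (F p) (F (param p w))) (coord p p)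

/-- `F` is a conformal map of (the open set) `U` onto `V`. -/
def IsConformalOnto (F : Sphere → Sphere) (U V : Set Sphere) : Prop :=
  (∀ p ∈ U, HolomorphicAt F p) ∧ Set.BijOn F U V

/-- `F` is a conformal map of `U` onto `V`, together with its extension to a homeomorphism of the
closures (a continuous bijection, the closures being compact Hausdorff spaces). -/
def IsConformalOntoWithExtension (F : Sphere → Sphere) (U V : Set Sphere) : Prop :=
  IsConformalOnto F U V ∧ ContinuousOn F (closure U) ∧ Set.BijOn F (closure U) (closure V)

/-- The class `CH(U)`: homeomorphisms of the sphere onto itself that are conformal on `U`. -/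
def CH (U : Set Sphere) : Set (Sphere ≃ₜ Sphere) :=
  {F | ∀ p ∈ U, HolomorphicAt F p}

/-- `F` is a Möbius transformation `z ↦ (a z + b) / (c z + d)`, `a d - b c ≠ 0`. -/
def IsMoebius (F : Sphere → Sphere) : Prop :=
  ∃ T : GL (Fin 2) ℂ, ∀ x, F x = T • x

/-- The compact set `E` is `CH`-removable. -/
def IsCHRemovable (E : Set Sphere) : Prop :=
  IsCompact E ∧ ∀ F ∈ CH Eᶜ, IsMoebius F

/-- A Jordan domain: a domain in the sphere whose boundary is a Jordan curve. -/
def IsJordanDomain (Ω : Set Sphere) : Prop :=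
  IsOpen Ω ∧ IsConnected Ω ∧
    ∃ γ : Circle → Sphere, Continuous γ ∧ Function.Injective γ ∧ Set.range γ = frontier Ω

/-- The open unit disk `𝔻`, in the sphere. -/
def disk : Set Sphere := (fun z : ℂ => (z : Sphere)) '' Metric.ball 0 1

/-- The complement of the closure; `exterior Ω` is `Ω*` and `exterior disk` is `𝔻*`. -/
def exterior (Ω : Set Sphere) : Set Sphere := (closure Ω)ᶜ

/-- The inclusion of the unit circle in the sphere. -/
def circleIncl (z : Circle) : Sphere := ((z : ℂ) : Sphere)

/-- `h` is a conformal welding for `Ω`: `h = f⁻¹ ∘ g` on the unit circle, where `f : 𝔻 → Ω` and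
`g : 𝔻* → Ω*` are conformal maps, extended to the closures. -/
def IsConformalWelding (Ω : Set Sphere) (h : Circle ≃ₜ Circle) : Prop :=
  ∃ f g : Sphere → Sphere,
    IsConformalOntoWithExtension f disk Ω ∧
    IsConformalOntoWithExtension g (exterior disk) (exterior Ω) ∧
    ∀ z : Circle, f (circleIncl (h z)) = g (circleIncl z)

/-- The homeomorphisms of the unit circle induced by the elements of `Aut(𝔻)`, that is, by the
conformal maps of `𝔻` onto itself. -/
def diskAut : Set (Circle ≃ₜ Circle) :=
  {φ | ∃ Φ : Sphere → Sphere, IsConformalOntoWithExtension Φ disk disk ∧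
    ∀ z : Circle, Φ (circleIncl z) = circleIncl (φ z)}

/-- `[h] = {φ ∘ h ∘ ψ : φ, ψ ∈ Aut(𝔻)}`. -/
def homeoClass (h : Circle ≃ₜ Circle) : Set (Circle ≃ₜ Circle) :=
  {k | ∃ φ ∈ diskAut, ∃ ψ ∈ diskAut, k = (ψ.trans h).trans φ}

/-- `[Ω] = {T(Ω) : T a Möbius transformation}`. -/
def domainClass (Ω : Set Sphere) : Set (Set Sphere) :=
  {Ω' | ∃ T : Sphere → Sphere, IsMoebius T ∧ Ω' = T '' Ω}

/-- The map `𝒲 : [Ω] ↦ [h]`, where `h` is a conformal welding for `Ω`. It is given as the union of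
the classes `[h]` over all members of `[Ω]` and all of their conformal weldings `h`; that `𝒲` is
well defined means that all of these classes exist and coincide. -/
def weldingMap (C : Set (Set Sphere)) : Set (Circle ≃ₜ Circle) :=
  {k | ∃ Ω ∈ C, ∃ h, IsConformalWelding Ω h ∧ k ∈ homeoClass h}

end ConformalWelding

end

open scoped OnePoint

noncomputable section

namespace ConformalWelding

open Set Filter Topology Metric Complex

/-! ### Continuous logarithms -/

/-! A welding records how the boundary values of the two Riemann maps of Ω match, and a
homeomorphism F conformal off ∂Ω does not change the matching: F ∘ f and F ∘ g weld F(Ω) with the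
same h. Conversely, if f⁻¹ ∘ g = f'⁻¹ ∘ g' on the circle, then f' ∘ f⁻¹ on the closure of Ω and g' ∘
g⁻¹ on that of Ω* agree on ∂Ω and glue to a homeomorphism of the sphere that is conformal off ∂Ω
(`IsConformalWelding.exists_mem_CH`). When ∂Ω is removable, this homeomorphism is Möbius. The
freedom in f and g is an automorphism of 𝔻 and one of 𝔻*; reflection in the circle, which fixes the
circle pointwise, turns the latter into an automorphism of 𝔻, so the weldings of Ω form exactly one
class [h] (`IsConformalWelding.mem_homeoClass`, `IsConformalWelding.of_mem_homeoClass`).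

The weight lies in the existence of weldings: Ω* must be a Jordan domain with the same boundary, and
Riemann maps of Jordan domains must extend to homeomorphisms of the closures. The plane topology
rests on one tool, continuous logarithms. If a closed set K does not separate p from q, then (z -
p)/(z - q) has a logarithm on K; logarithms glue over closed sets with connected intersection; and z
- p has no logarithm on the boundary of a bounded open set containing p
(`not_hasLogOn_of_frontier_subset`). This yields the separation theorem
`not_isPreconnected_compl_union` and the part of the Jordan curve theorem that is needed.

Gluing local logarithms cell by cell (`hasLogOn_of_forall_sub`) gives logarithms on domains with
connected unbounded complement, hence the square roots in the extremal proof of the Riemann mapping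
theorem (`exists_bijOn_ball`). For Carathéodory's theorem, a length-area estimate produces
cross-cuts with short images, and logarithms show that these cut off small pieces of the domain,
which gives continuity up to the circle. Injectivity there holds because a chord with identified
endpoints would be mapped to a closed curve that fails to separate the plane (`injOn_sphere`). -/

/-- The function `u` has a continuous logarithm on the set `S`. -/
def HasLogOn {X : Type*} [TopologicalSpace X] (u : X → ℂ) (S : Set X) : Prop :=
  ∃ L : X → ℂ, ContinuousOn L S ∧ ∀ x ∈ S, exp (L x) = u x

section HasLogOn

variable {X Y : Type*} [TopologicalSpace X] [TopologicalSpace Y] {u v : X → ℂ} {S T : Set X}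

lemma HasLogOn.mono (h : HasLogOn u S) (hT : T ⊆ S) : HasLogOn u T :=
  let ⟨L, hc, he⟩ := h
  ⟨L, hc.mono hT, fun x hx => he x (hT hx)⟩

lemma HasLogOn.congr (h : HasLogOn u S) (huv : ∀ x ∈ S, v x = u x) : HasLogOn v S :=
  let ⟨L, hc, he⟩ := h
  ⟨L, hc, fun x hx => (he x hx).trans (huv x hx).symm⟩

lemma HasLogOn.mul (hu : HasLogOn u S) (hv : HasLogOn v S) :
    HasLogOn (fun x => u x * v x) S :=
  let ⟨L, hc, he⟩ := hu
  let ⟨M, hc', he'⟩ := hv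
  ⟨fun x => L x + M x, hc.add hc', fun x hx => by rw [exp_add, he x hx, he' x hx]⟩

lemma HasLogOn.inv (hu : HasLogOn u S) : HasLogOn (fun x => (u x)⁻¹) S :=
  let ⟨L, hc, he⟩ := hu
  ⟨fun x => -L x, hc.neg, fun x hx => by rw [exp_neg, he x hx]⟩

lemma HasLogOn.div (hu : HasLogOn u S) (hv : HasLogOn v S) :
    HasLogOn (fun x => u x / v x) S := by
  simpa only [div_eq_mul_inv] using hu.mul hv.inv

lemma HasLogOn.zpow (hu : HasLogOn u S) (k : ℤ) : HasLogOn (fun x => u x ^ k) S :=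
  let ⟨L, hc, he⟩ := hu
  ⟨fun x => k * L x, continuousOn_const.mul hc, fun x hx => by rw [exp_int_mul, he x hx]⟩

lemma HasLogOn.ne_zero (hu : HasLogOn u S) {x : X} (hx : x ∈ S) : u x ≠ 0 :=
  let ⟨_, _, he⟩ := hu
  he x hx ▸ exp_ne_zero _

lemma hasLogOn_const {c : ℂ} (hc : c ≠ 0) (S : Set X) : HasLogOn (fun _ => c) S :=
  ⟨fun _ => log c, continuousOn_const, fun _ _ => exp_log hc⟩

lemma hasLogOn_of_slitPlane (hu : ContinuousOn u S) (h : ∀ x ∈ S, u x ∈ slitPlane) :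
    HasLogOn u S :=
  ⟨fun x => log (u x), hu.clog h, fun x hx => exp_log (slitPlane_ne_zero (h x hx))⟩

lemma hasLogOn_of_norm_sub_one_lt (hu : ContinuousOn u S) (h : ∀ x ∈ S, ‖u x - 1‖ < 1) :
    HasLogOn u S :=
  hasLogOn_of_slitPlane hu fun x hx => by
    simpa using mem_slitPlane_of_norm_lt_one (h x hx)

/-- Two continuous logarithms on a preconnected set differ by a constant. -/
lemma eq_add_two_pi_of_exp_eq (hS : IsPreconnected S) {L M : X → ℂ} (hL : ContinuousOn L S)
    (hM : ContinuousOn M S) (h : ∀ x ∈ S, exp (L x) = exp (M x)) :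
    ∃ n : ℤ, ∀ x ∈ S, L x = M x + n * (2 * Real.pi * I) := by
  rcases S.eq_empty_or_nonempty with rfl | ⟨x₀, hx₀⟩
  · exact ⟨0, by simp⟩
  have hpi : (2 * Real.pi * I : ℂ) ≠ 0 := two_pi_I_ne_zero
  -- The quotient (L - M) / 2πi is continuous with values in the integers, a discrete set, so it is
  -- constant on a preconnected set.
  have key : ∀ x ∈ S, (L x - M x) / (2 * Real.pi * I) ∈ range ((↑) : ℤ → ℂ) := by
    intro x hx
    obtain ⟨n, hn⟩ := exp_eq_exp_iff_exists_int.1 (h x hx)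
    exact ⟨n, by rw [hn]; field_simp; ring⟩
  have hd : IsDiscrete (range ((↑) : ℤ → ℂ)) :=
    ⟨(Complex.isClosedEmbedding_intCast.toIsEmbedding.toHomeomorph).symm.isEmbedding.discreteTopology⟩
  obtain ⟨n, hn⟩ := key x₀ hx₀
  refine ⟨n, fun x hx => ?_⟩
  have := hS.constant_of_mapsTo hd (f := fun x => (L x - M x) / (2 * Real.pi * I))
    ((hL.sub hM).div_const _) key hx hx₀
  simp only [← hn] at this
  field_simp at this
  linear_combination this

/-- On the connected intersection the two logarithms differ by a constant multiple of 2πi; after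
subtracting it they can be pasted along the closed sets. -/
lemma HasLogOn.union (hS : IsClosed S) (hT : IsClosed T) (hST : IsPreconnected (S ∩ T))
    (h : HasLogOn u S) (h' : HasLogOn u T) : HasLogOn u (S ∪ T) := by
  classical
  obtain ⟨L, hc, he⟩ := h
  obtain ⟨M, hc', he'⟩ := h'
  obtain ⟨n, hn⟩ := eq_add_two_pi_of_exp_eq hST (hc.mono inter_subset_left)
    (hc'.mono inter_subset_right) fun x hx => (he x hx.1).trans (he' x hx.2).symm
  set N : X → ℂ := fun x => if x ∈ S then L x else M x + n * (2 * Real.pi * I) with hN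
  have hNS : EqOn N L S := fun x hx => by simp [hN, hx]
  have hNT : EqOn N (fun x => M x + n * (2 * Real.pi * I)) T := fun x hx => by
    by_cases hxS : x ∈ S
    · simp [hN, hxS, hn x ⟨hxS, hx⟩]
    · simp [hN, hxS]
  refine ⟨N, ContinuousOn.union_of_isClosed (hc.congr hNS)
    ((hc'.add continuousOn_const).congr hNT) hS hT, ?_⟩
  rintro x (hx | hx)
  · rw [hNS hx, he x hx]
  · rw [hNT hx]
    simp only [exp_add, he' x hx, exp_int_mul_two_pi_mul_I, mul_one]

end HasLogOn

/-- A nonvanishing continuous function on a contractible space has a continuous logarithm. -/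
lemma hasLogOn_univ {X : Type*} [TopologicalSpace X] [LocallyPathConnectedSpace X]
    [SimplyConnectedSpace X] {u : X → ℂ} (hu : Continuous u) (h0 : ∀ x, u x ≠ 0) :
    HasLogOn u univ := by
  have hs : IsSimplyConnected (univ : Set X) :=
    (Homeomorph.Set.univ X).toHomotopyEquiv.simplyConnectedSpace
  obtain ⟨L, hc, he⟩ := exists_continuousOn_eqOn_exp_comp hs isOpen_univ hu.continuousOn
    (by rintro ⟨x, -, hx⟩; exact h0 x hx)
  exact ⟨L, hc, fun x hx => he hx⟩

/-- `z ^ k` has no continuous logarithm on a circle around the origin. -/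
lemma not_hasLogOn_zpow_sphere {a : ℂ} {r : ℝ} (hr : 0 < r) {k : ℤ} (hk : k ≠ 0) :
    ¬ HasLogOn (fun z => (z - a) ^ k) (sphere a r) := by
  intro h
  obtain ⟨L, hc, he⟩ := h
  -- Along the circle the logarithm must be k (log r + i t) plus a constant, and this changes by
  -- 2πik over one turn.
  have hcont : ContinuousOn (fun t : ℝ => L (circleMap a r t)) univ :=
    hc.comp (continuous_circleMap a r).continuousOn
      fun t _ => circleMap_mem_sphere a hr.le t
  obtain ⟨n, hn⟩ := eq_add_two_pi_of_exp_eq (S := (univ : Set ℝ)) isPreconnected_univ hcont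
    (M := fun t : ℝ => k * (Real.log r + t * I)) (by fun_prop) (by
      intro t _
      rw [he _ (circleMap_mem_sphere a hr.le t), exp_int_mul, exp_add, ← ofReal_exp,
        Real.exp_log hr]
      simp [circleMap])
  have e1 := hn 0 trivial
  have e2 := hn (2 * Real.pi) trivial
  have hper : circleMap a r (2 * Real.pi) = circleMap a r 0 := by
    simpa using periodic_circleMap a r 0
  rw [hper, e1] at e2
  have hpi : (2 * Real.pi * I : ℂ) ≠ 0 := two_pi_I_ne_zero
  have : (k : ℂ) * (2 * Real.pi * I) = 0 := by
    push_cast at e2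
    linear_combination -e2
  rcases mul_eq_zero.1 this with h | h
  · exact hk (by exact_mod_cast h)
  · exact hpi h

/-! ### Logarithms and separation of the plane -/

lemma isPreconnected_compl_closedBall (c : ℂ) (r : ℝ) : IsPreconnected (closedBall c r)ᶜ := by
  rcases lt_or_ge r 0 with hr | hr
  · rw [closedBall_eq_empty.2 hr, compl_empty]; exact isPreconnected_univ
  have : (closedBall c r)ᶜ = (fun p : ℝ × ℝ => circleMap c p.1 p.2) '' (Ioi r ×ˢ univ) := by
    ext z
    simp only [mem_compl_iff, mem_closedBall, not_le, mem_image, mem_prod, mem_Ioi, mem_univ,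
      and_true, Prod.exists]
    constructor
    · intro hz
      refine ⟨‖z - c‖, arg (z - c), by rwa [← dist_eq_norm], ?_⟩
      simp [circleMap, norm_mul_exp_arg_mul_I]
    · rintro ⟨t, θ, ht, rfl⟩
      rw [dist_eq_norm, circleMap_sub_center, norm_circleMap_zero]
      exact ht.trans_le (le_abs_self t)
  rw [this]
  refine (isPreconnected_Ioi.prod isPreconnected_univ).image _ (Continuous.continuousOn ?_)
  simp only [circleMap]
  fun_prop

/-- The quotient is 1 + (q - p)/(z - q), which stays in the disk of radius 1 around 1, where the
principal branch is continuous. -/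
lemma hasLogOn_div_of_norm_lt {K : Set ℂ} {p q : ℂ} (h : ∀ z ∈ K, ‖q - p‖ < ‖z - q‖) :
    HasLogOn (fun z => (z - p) / (z - q)) K := by
  have h0 : ∀ z ∈ K, z - q ≠ 0 := fun z hz hzq => by
    have := h z hz
    rw [hzq, norm_zero] at this
    exact absurd (norm_nonneg _) (not_le.2 this)
  refine hasLogOn_of_norm_sub_one_lt (by fun_prop (disch := assumption)) fun z hz => ?_
  have e : (z - p) / (z - q) - 1 = (q - p) / (z - q) := by
    have := h0 z hz
    field_simp
    ring
  rw [e, norm_div, div_lt_one (norm_pos_iff.2 (h0 z hz))]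
  exact h z hz

/-- If `p` and `q` are not separated by the closed set `K`, then `(z - p) / (z - q)` has a
continuous logarithm on `K`. -/
lemma hasLogOn_div_of_isPreconnected {K S : Set ℂ} (hK : IsClosed K) (hS : IsPreconnected S)
    (hSK : Disjoint S K) {p q : ℂ} (hp : p ∈ S) (hq : q ∈ S) :
    HasLogOn (fun z => (z - p) / (z - q)) K := by
  have ne : ∀ x ∈ S, ∀ z ∈ K, z - x ≠ 0 := fun x hx z hz h =>
    (Set.disjoint_left.1 hSK hx) (sub_eq_zero.1 h ▸ hz)
  have loc : ∀ x ∈ S, ∀ᶠ y in 𝓝 x, HasLogOn (fun z => (z - y) / (z - x)) K := by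
    intro x hx
    obtain ⟨ε, hε, hb⟩ := Metric.isOpen_iff.1 hK.isOpen_compl x (Set.disjoint_left.1 hSK hx)
    filter_upwards [ball_mem_nhds x hε] with y hy
    refine hasLogOn_div_of_norm_lt fun z hz => ?_
    have h1 : ε ≤ ‖z - x‖ := by
      by_contra hlt
      exact hb (mem_ball_iff_norm.2 (not_le.1 hlt)) hz
    rw [mem_ball_comm, mem_ball_iff_norm] at hy
    exact hy.trans_le h1
  refine hS.induction₂ (fun x y => HasLogOn (fun z => (z - x) / (z - y)) K) ?_ ?_ ?_ hp hq
  · intro x hx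
    filter_upwards [nhdsWithin_le_nhds (loc x hx)] with y hy
    refine hy.inv.congr fun z _ => by rw [inv_div]
  · intro x y w hx hy hw h1 h2
    refine (h1.mul h2).congr fun z hz => ?_
    have := ne y hy z hz
    field_simp
  · intro x y hx hy h
    exact h.inv.congr fun z _ => by rw [inv_div]

/-- If `p` lies in an unbounded connected set disjoint from the compact set `K`, then `z - p` has
a continuous logarithm on `K`. -/
lemma hasLogOn_sub_of_not_isBounded {K S : Set ℂ} (hK : IsCompact K) (hS : IsPreconnected S)
    (hSK : Disjoint S K) {p : ℂ} (hp : p ∈ S) (hub : ¬ Bornology.IsBounded S) :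
    HasLogOn (fun z => z - p) K := by
  obtain ⟨R, hR⟩ := hK.isBounded.subset_closedBall 0
  -- The point p is moved inside S to some q beyond a ball containing K; there z - q = -q (1 - z/q)
  -- with |z/q| < 1.
  obtain ⟨q, hq, hqR⟩ : ∃ q ∈ S, q ∉ closedBall (0 : ℂ) R := by
    by_contra! h
    exact hub (isBounded_closedBall.subset h)
  have hq0 : q ∉ K := Set.disjoint_left.1 hSK hq
  have h1 := hasLogOn_div_of_isPreconnected hK.isClosed hS hSK hp hq
  have h2 : HasLogOn (fun z => z - q) K := by
    have hqR' : R < ‖q‖ := by simpa using hqR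
    rcases K.eq_empty_or_nonempty with rfl | ⟨z₀, hz₀⟩
    · exact ⟨0, by simp, by simp⟩
    have hqn : q ≠ 0 := by
      rintro rfl
      have := hR hz₀
      rw [mem_closedBall_zero_iff] at this
      rw [norm_zero] at hqR'
      linarith [norm_nonneg z₀]
    have h3 : HasLogOn (fun z => 1 - z / q) K := by
      refine hasLogOn_of_norm_sub_one_lt (by fun_prop) fun z hz => ?_
      have := hR hz
      rw [mem_closedBall_zero_iff] at this
      rw [sub_sub_cancel_left, norm_neg, norm_div, div_lt_one (norm_pos_iff.2 hqn)]
      linarith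
    refine ((hasLogOn_const (neg_ne_zero.2 hqn) K).mul h3).congr fun z _ => ?_
    field_simp
    ring
  refine (h1.mul h2).congr fun z hz => ?_
  have : z - q ≠ 0 := fun h => hq0 (sub_eq_zero.1 h ▸ hz)
  field_simp

lemma exists_continuous_eqOn {K : Set ℂ} (hK : IsClosed K) {L : ℂ → ℂ} (hL : ContinuousOn L K) :
    ∃ M : ℂ → ℂ, Continuous M ∧ EqOn M L K := by
  obtain ⟨g, hg⟩ := ContinuousMap.exists_restrict_eq hK ⟨K.domRestrict L, hL.domRestrict⟩
  exact ⟨g, g.continuous, fun x hx => congrArg (fun f => f ⟨x, hx⟩) hg⟩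

/-- A function with a zero of nonzero multiplicity in a bounded open set `W` and nonvanishing
elsewhere in `W` has no continuous logarithm on the boundary of `W`. -/
lemma not_hasLogOn_of_frontier_subset {K W : Set ℂ} (hK : IsClosed K) (hW : IsOpen W)
    (hWb : Bornology.IsBounded W) (hfr : frontier W ⊆ K) {p : ℂ} (hp : p ∈ W) {v : ℂ → ℂ}
    (hv : ContinuousOn v (closure W)) (hv0 : ∀ z ∈ closure W, v z ≠ 0) {k : ℤ} (hk : k ≠ 0) :
    ¬ HasLogOn (fun z => (z - p) ^ k * v z) K := by
  classical
  rintro ⟨L, hc, he⟩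
  obtain ⟨M, hM, hML⟩ := exists_continuous_eqOn hK hc
  -- `ψ` is `v * exp (-M)` on the closure of `W`, and `(z - p) ^ (-k)` elsewhere
  set ψ : ℂ → ℂ := fun z => if z ∈ W then v z * exp (-M z) else (z - p) ^ (-k) with hψ
  have hne : ∀ z ∈ Wᶜ, z - p ≠ 0 := fun z hz h => hz (sub_eq_zero.1 h ▸ hp)
  have hcl : closure W = W ∪ frontier W := by
    rw [closure_eq_self_union_frontier]
  have e1 : EqOn ψ (fun z => v z * exp (-M z)) (closure W) := by
    intro z hz
    by_cases hzW : z ∈ W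
    · simp [hψ, hzW]
    · have hzf : z ∈ K := hfr ⟨hz, by rwa [hW.interior_eq]⟩
      have h1 := he z hzf
      have h2 := zpow_ne_zero k (hne z hzW)
      simp only [hψ, hzW, if_false]
      rw [hML hzf, exp_neg, h1, zpow_neg]
      have := hv0 z hz
      field_simp
  have e2 : EqOn ψ (fun z => (z - p) ^ (-k)) Wᶜ := fun z hz => by
    simp only [hψ, if_neg (show z ∉ W from hz)]
  have hψc : Continuous ψ := by
    rw [← continuousOn_univ]
    have : (univ : Set ℂ) = closure W ∪ Wᶜ :=
      (univ_subset_iff.1 fun z _ => (em (z ∈ W)).imp (fun h => subset_closure h) id).symm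
    rw [this]
    refine ContinuousOn.union_of_isClosed (ContinuousOn.congr ?_ e1) (ContinuousOn.congr ?_ e2)
      isClosed_closure hW.isClosed_compl
    · exact hv.mul (hM.neg.cexp).continuousOn
    · exact ContinuousOn.zpow₀ (by fun_prop) _ fun z hz => Or.inl (hne z hz)
  have hψ0 : ∀ z, ψ z ≠ 0 := by
    intro z
    by_cases hz : z ∈ W
    · rw [e1 (subset_closure hz)]
      exact mul_ne_zero (hv0 z (subset_closure hz)) (exp_ne_zero _)
    · rw [e2 hz]
      exact zpow_ne_zero _ (hne z hz)
  -- A zero-free continuous function on the whole plane has a logarithm; but on a circle around p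
  -- enclosing W, ψ is (z - p)^(-k), which has none.
  obtain ⟨R, hR0, hR⟩ := hWb.subset_ball_lt 0 p
  refine not_hasLogOn_zpow_sphere (a := p) hR0 (neg_ne_zero.2 hk)
    (((hasLogOn_univ hψc hψ0).mono (subset_univ _)).congr fun z hz => (e2 ?_).symm)
  intro hzW
  have := hR hzW
  rw [mem_ball, mem_sphere.1 hz] at this
  exact lt_irrefl _ this

/-! ### The Jordan curve theorem -/

/-- Finitely many closed disks in O cover K, and each is tied to x₀ by a path in O. -/
lemma exists_isCompact_isPreconnected_between {O K : Set ℂ} (hO : IsOpen O) (hc : IsConnected O)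
    (hK : IsCompact K) (hKO : K ⊆ O) {x₀ : ℂ} (hx₀ : x₀ ∈ O) :
    ∃ K', IsCompact K' ∧ IsPreconnected K' ∧ K ⊆ K' ∧ K' ⊆ O ∧ x₀ ∈ K' := by
  refine hK.induction_on (p := fun s => ∃ K', IsCompact K' ∧ IsPreconnected K' ∧ s ⊆ K' ∧
    K' ⊆ O ∧ x₀ ∈ K') ?_ ?_ ?_ ?_
  · exact ⟨{x₀}, isCompact_singleton, isPreconnected_singleton, by simp, by simpa, rfl⟩
  · rintro s t hst ⟨K', h1, h2, h3, h4⟩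
    exact ⟨K', h1, h2, hst.trans h3, h4⟩
  · rintro s t ⟨K₁, h1, h2, h3, h4, h5⟩ ⟨K₂, h1', h2', h3', h4', h5'⟩
    exact ⟨K₁ ∪ K₂, h1.union h1', h2.union x₀ h5 h5' h2', union_subset_union h3 h3',
      union_subset h4 h4', Or.inl h5⟩
  · intro x hx
    obtain ⟨ε, hε, hb⟩ := Metric.nhds_basis_closedBall.mem_iff.1 (hO.mem_nhds (hKO hx))
    obtain ⟨γ, hγ⟩ := (hO.isConnected_iff_isPathConnected.1 hc).joinedIn x₀ hx₀ x (hKO hx)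
    refine ⟨closedBall x ε, nhdsWithin_le_nhds (closedBall_mem_nhds x hε),
      closedBall x ε ∪ range γ, (isCompact_closedBall x ε).union (isCompact_range γ.continuous),
      (convex_closedBall x ε).isPreconnected.union x (mem_closedBall_self hε.le)
        ⟨1, γ.target⟩ (isPreconnected_range γ.continuous),
      subset_union_left, union_subset hb (range_subset_iff.2 hγ), Or.inr ⟨0, γ.source⟩⟩

/-- The union of two continua in the plane that meet in exactly two points separates the plane. -/
lemma not_isPreconnected_compl_union {A B : Set ℂ} (hA : IsCompact A) (hB : IsCompact B)
    (hA' : IsPreconnected A) (hB' : IsPreconnected B) {a b : ℂ} (hab : a ≠ b)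
    (hAB : A ∩ B = {a, b}) : ¬ IsPreconnected (A ∪ B)ᶜ := by
  intro hpre
  have haA : a ∈ A ∩ B := hAB ▸ mem_insert a {b}
  have hbA : b ∈ A ∩ B := hAB ▸ mem_insert_of_mem a rfl
  have hd : 0 < ‖b - a‖ := norm_pos_iff.2 (sub_ne_zero.2 hab.symm)
  -- This circle has a inside and b outside, so it meets A ∩ B nowhere. It is cut into the part K₁
  -- nearer to B, which avoids A, and the part K₂ nearer to A, which avoids B.
  set r := ‖b - a‖ / 2 with hr
  have hr0 : 0 < r := by positivity
  set S := sphere a r with hSdef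
  have hSab : ∀ z ∈ S, ¬ (z ∈ A ∧ z ∈ B) := by
    rintro z hz h
    have hz' : ‖z - a‖ = r := by rw [← dist_eq_norm]; exact hz
    have hzab : z ∈ ({a, b} : Set ℂ) := hAB ▸ h
    rcases hzab with rfl | rfl
    · simp at hz'; linarith
    · linarith
  set K₁ := S ∩ {z | infDist z B ≤ infDist z A} with hK₁
  set K₂ := S ∩ {z | infDist z A ≤ infDist z B} with hK₂
  have hKS : K₁ ∪ K₂ = S := by
    rw [← inter_union_distrib_left, inter_eq_left]
    exact fun z _ => le_total (infDist z B) (infDist z A)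
  have hS : IsCompact S := isCompact_sphere a r
  have hK₁c : IsCompact K₁ := hS.inter_right
    (isClosed_le (continuous_infDist_pt B) (continuous_infDist_pt A))
  have hK₂c : IsCompact K₂ := hS.inter_right
    (isClosed_le (continuous_infDist_pt A) (continuous_infDist_pt B))
  have hA1 : Disjoint A K₁ := by
    refine Set.disjoint_left.2 fun z hz hz1 => hSab z hz1.1 ⟨hz, ?_⟩
    rw [hB.isClosed.mem_iff_infDist_zero ⟨a, haA.2⟩]
    refine le_antisymm (hz1.2.trans ?_) infDist_nonneg
    rw [infDist_zero_of_mem hz]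
  have hB2 : Disjoint B K₂ := by
    refine Set.disjoint_left.2 fun z hz hz1 => hSab z hz1.1 ⟨?_, hz⟩
    rw [hA.isClosed.mem_iff_infDist_zero ⟨a, haA.1⟩]
    refine le_antisymm (hz1.2.trans ?_) infDist_nonneg
    rw [infDist_zero_of_mem hz]
  have hO : IsOpen (A ∪ B)ᶜ := (hA.union hB).isClosed.isOpen_compl
  obtain ⟨x₀, hx₀⟩ : ((A ∪ B)ᶜ : Set ℂ).Nonempty := by
    rw [nonempty_compl]
    intro h
    have := (hA.union hB).isBounded
    rw [h] at this
    exact NormedSpace.unbounded_univ ℝ ℂ this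
  -- A connected K₃ off A ∪ B ties K₁ ∩ K₂ together. A joins a to b off K₁ ∪ K₃ and B does so off K₂
  -- ∪ K₃; these two sets meet exactly in K₃, so the two logarithms of (z - a)/(z - b) glue to one
  -- on the whole circle. As b is outside, z - a would have one as well.
  obtain ⟨K₃, h1, h2, h3, h4, -⟩ := exists_isCompact_isPreconnected_between hO ⟨⟨x₀, hx₀⟩, hpre⟩
    (hK₁c.inter_right hK₂c.isClosed)
    (fun z hz h => h.elim (fun h => Set.disjoint_left.1 hA1 h hz.1)
      (fun h => Set.disjoint_left.1 hB2 h hz.2)) hx₀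
  have l1 : HasLogOn (fun z => (z - a) / (z - b)) (K₁ ∪ K₃) :=
    hasLogOn_div_of_isPreconnected (hK₁c.union h1).isClosed hA' (disjoint_union_right.2
      ⟨hA1, Set.disjoint_left.2 fun z hz hz3 => h4 hz3 (Or.inl hz)⟩) haA.1 hbA.1
  have l2 : HasLogOn (fun z => (z - a) / (z - b)) (K₂ ∪ K₃) :=
    hasLogOn_div_of_isPreconnected (hK₂c.union h1).isClosed hB' (disjoint_union_right.2
      ⟨hB2, Set.disjoint_left.2 fun z hz hz3 => h4 hz3 (Or.inr hz)⟩) haA.2 hbA.2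
  have l3 : HasLogOn (fun z => (z - a) / (z - b)) S := by
    refine (l1.union (hK₁c.union h1).isClosed (hK₂c.union h1).isClosed ?_ l2).mono ?_
    · rw [← inter_union_distrib_right, union_eq_self_of_subset_left h3]
      exact h2
    · rw [← hKS]
      exact union_subset_union subset_union_left subset_union_left
  have l4 : HasLogOn (fun z => z - b) S := by
    have : HasLogOn (fun z => (z - b) / (a - b)) S := by
      refine hasLogOn_of_norm_sub_one_lt (by fun_prop) fun z hz => ?_
      have e : (z - b) / (a - b) - 1 = (z - a) / (a - b) := by
        have := sub_ne_zero.2 hab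
        field_simp
        ring
      have hz' : ‖z - a‖ = r := by rw [← dist_eq_norm]; exact hz
      rw [e, norm_div, hz', norm_sub_rev a b, div_lt_one hd]
      linarith
    refine (this.mul (hasLogOn_const (sub_ne_zero.2 hab) S)).congr fun z _ => ?_
    have := sub_ne_zero.2 hab
    field_simp
  refine not_hasLogOn_zpow_sphere (a := a) hr0 one_ne_zero ((l3.mul l4).congr fun z hz => ?_)
  have : z - b ≠ 0 := l4.ne_zero hz
  rw [zpow_one]
  field_simp

/-- The exponent m is the winding number: a logarithm of u(e^{it}) grows by 2πim over a period, and
after subtracting imt it is periodic and descends to the circle. -/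
lemma exists_hasLogOn_div_zpow (u : Circle → ℂ) (hu : Continuous u) (h0 : ∀ z, u z ≠ 0) :
    ∃ m : ℤ, HasLogOn (fun z : Circle => u z / (z : ℂ) ^ m) univ := by
  obtain ⟨L, hc, he⟩ := hasLogOn_univ (u := fun t : ℝ => u (Circle.exp t))
    (hu.comp Circle.exp.continuous) fun t => h0 _
  rw [continuousOn_univ] at hc
  obtain ⟨m, hm⟩ := eq_add_two_pi_of_exp_eq (S := (univ : Set ℝ)) isPreconnected_univ
    (L := fun t => L (t + 2 * Real.pi)) (M := L) (by fun_prop) (by fun_prop) fun t _ => by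
      rw [he _ trivial, he _ trivial]; simp only [Circle.exp_add_two_pi]
  set N : ℝ → ℂ := fun t => L t - m * (t * I) with hN
  have hNc : Continuous N := by fun_prop
  have hper : ∀ s t : ℝ, Circle.exp s = Circle.exp t → N s = N t := by
    have hp : Function.Periodic N (2 * Real.pi) := fun t => by
      simp only [hN, hm t trivial]
      push_cast
      ring
    intro s t hst
    obtain ⟨n, rfl⟩ := Circle.exp_eq_exp.1 hst
    exact hp.int_mul n t
  have hq : IsQuotientMap (Circle.exp : ℝ → Circle) :=
    (isLocalHomeomorph_circleExp.isOpenMap).isQuotientMap Circle.exp.continuous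
      Circle.exp_surjective
  refine ⟨m, fun z => N (arg z), ?_, fun z _ => ?_⟩
  · rw [continuousOn_univ, hq.continuous_iff]
    convert! hNc using 1
    ext t
    exact hper _ _ (Circle.exp_arg _)
  · have h1 := he (arg z) trivial
    simp only [Circle.exp_arg] at h1
    have h2 : exp (arg z * I) = z := by
      conv_rhs => rw [← Circle.exp_arg z, Circle.coe_exp]
    simp only [hN]
    rw [exp_sub, h1, exp_int_mul, h2]

/-- A rotation takes an omitted point w to -1, which puts the rest of the circle into the slit
plane. -/
lemma hasLogOn_circle_coe {C : Set Circle} (hC : C ≠ univ) :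
    HasLogOn (fun z : Circle => (z : ℂ)) C := by
  obtain ⟨w, hw⟩ := (ne_univ_iff_exists_notMem C).1 hC
  have h1 : HasLogOn (fun z : Circle => -((z / w : Circle) : ℂ)) C := by
    refine hasLogOn_of_slitPlane (by fun_prop) fun z hz => ?_
    rw [mem_slitPlane_iff_arg]
    refine ⟨fun h => hw ?_, by simp⟩
    have h2 : -((z / w : Circle) : ℂ) = -1 := by
      have h3 := norm_mul_exp_arg_mul_I (-((z / w : Circle) : ℂ))
      rw [h, norm_neg, Circle.norm_coe] at h3
      simpa using h3.symm
    have h4 : (z / w : Circle) = 1 := by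
      ext
      simpa using h2
    rwa [← div_eq_one.1 h4]
  refine (h1.mul (hasLogOn_const (c := -(w : ℂ)) (by simp) C)).congr fun z _ => ?_
  have : (w : ℂ) ≠ 0 := by simp
  simp only [Circle.coe_div]
  field_simp

section Jordan

variable {γ : Circle → ℂ}

lemma HasLogOn.image_circle (hγ : Continuous γ) (hi : Function.Injective γ) {u : ℂ → ℂ}
    {C : Set Circle} (h : HasLogOn (fun z => u (γ z)) C) : HasLogOn u (γ '' C) := by
  have hemb := (hγ.isClosedEmbedding hi).isEmbedding
  obtain ⟨L, hc, he⟩ := h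
  refine ⟨fun w => L (Function.invFun γ w), ?_, ?_⟩
  · refine hc.comp ?_ ?_
    · rintro _ ⟨z, hz, rfl⟩
      rw [ContinuousWithinAt, ← hemb.map_nhdsWithin_eq, tendsto_map'_iff,
        Function.leftInverse_invFun hi z]
      simp only [Function.comp_def, Function.leftInverse_invFun hi _]
      exact tendsto_id.mono_left nhdsWithin_le_nhds
    · rintro _ ⟨z, hz, rfl⟩
      rwa [Function.leftInverse_invFun hi z]
  · rintro _ ⟨z, hz, rfl⟩
    simp only [Function.leftInverse_invFun hi z]
    exact he z hz

/-- A proper closed subset of a Jordan curve does not bound a bounded open set. -/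
lemma not_frontier_subset_image (hγ : Continuous γ) (hi : Function.Injective γ)
    {C : Set Circle} (hC : IsClosed C) (hCu : C ≠ univ) {W : Set ℂ} (hW : IsOpen W)
    (hWb : Bornology.IsBounded W) (hne : W.Nonempty) (hd : Disjoint W (range γ)) :
    ¬ frontier W ⊆ γ '' C := by
  intro hfr
  obtain ⟨p, hp⟩ := hne
  have hp0 : ∀ z, γ z - p ≠ 0 := fun z hz =>
    Set.disjoint_left.1 hd hp ⟨z, sub_eq_zero.1 hz⟩
  obtain ⟨m, hm⟩ := exists_hasLogOn_div_zpow (fun z => γ z - p) (by fun_prop) hp0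
  -- Whatever the winding number m around p, the factor z^m has a logarithm on a proper part of the
  -- circle.
  have h1 : HasLogOn (fun z => γ z - p) C := by
    refine ((hm.mono (subset_univ C)).mul ((hasLogOn_circle_coe hCu).zpow m)).congr fun z _ => ?_
    have : (z : ℂ) ^ m ≠ 0 := zpow_ne_zero _ (by simp)
    field_simp
  refine not_hasLogOn_of_frontier_subset (hC.isCompact.image hγ).isClosed hW hWb hfr hp
    (v := fun _ => 1) continuousOn_const (by simp) one_ne_zero
    ((HasLogOn.image_circle hγ hi (u := fun w => w - p) h1).congr fun z _ => by simp)

/-- A Jordan curve does not bound two disjoint bounded open sets. -/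
lemma not_disjoint_of_frontier_subset_range (hγ : Continuous γ) (hi : Function.Injective γ)
    {W₁ W₂ : Set ℂ} (hW₁ : IsOpen W₁) (hW₂ : IsOpen W₂) (hb₁ : Bornology.IsBounded W₁)
    (hb₂ : Bornology.IsBounded W₂) (hne₁ : W₁.Nonempty) (hne₂ : W₂.Nonempty)
    (hd₁ : Disjoint W₁ (range γ)) (hd₂ : Disjoint W₂ (range γ))
    (hf₁ : frontier W₁ ⊆ range γ) (hf₂ : frontier W₂ ⊆ range γ) : ¬ Disjoint W₁ W₂ := by
  intro hd
  obtain ⟨p, hp⟩ := hne₁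
  obtain ⟨q, hq⟩ := hne₂
  have hp0 : ∀ z, γ z - p ≠ 0 := fun z hz =>
    Set.disjoint_left.1 hd₁ hp ⟨z, sub_eq_zero.1 hz⟩
  have hq0 : ∀ z, γ z - q ≠ 0 := fun z hz =>
    Set.disjoint_left.1 hd₂ hq ⟨z, sub_eq_zero.1 hz⟩
  obtain ⟨m, hm⟩ := exists_hasLogOn_div_zpow (fun z => γ z - p) (by fun_prop) hp0
  obtain ⟨n, hn⟩ := exists_hasLogOn_div_zpow (fun z => γ z - q) (by fun_prop) hq0
  have hcl : IsClosed (range γ) := (isCompact_range hγ).isClosed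
  -- With winding numbers m around p and n around q, this combination has winding number mn - nm =
  -- 0. Its zero at p inside W₁ forces n = 0; then w - q itself has a logarithm on the curve,
  -- against W₂.
  have key : HasLogOn (fun w => (w - p) ^ n * (w - q) ^ (-m)) (range γ) := by
    rw [← image_univ]
    refine HasLogOn.image_circle hγ hi (((hm.zpow n).div (hn.zpow m)).congr fun z _ => ?_)
    have hz : (z : ℂ) ≠ 0 := by simp
    have := hp0 z
    have := hq0 z
    simp only [div_zpow, zpow_neg, ← zpow_mul, mul_comm n m]
    field_simp
  have hclos : ∀ {U V : Set ℂ} {x : ℂ}, IsOpen V → Disjoint U V → x ∈ V → ∀ z ∈ closure U,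
      z - x ≠ 0 := fun hV hUV hx z hz h =>
    Set.disjoint_left.1 (hUV.closure_left hV) hz (sub_eq_zero.1 h ▸ hx)
  have hn0 : n = 0 := by
    by_contra hn0
    refine not_hasLogOn_of_frontier_subset hcl hW₁ hb₁ hf₁ hp (v := fun w => (w - q) ^ (-m))
      (ContinuousOn.zpow₀ (by fun_prop) _ fun z hz => Or.inl (hclos hW₂ hd hq z hz))
      (fun z hz => zpow_ne_zero _ (hclos hW₂ hd hq z hz)) hn0 key
  refine not_hasLogOn_of_frontier_subset hcl hW₂ hb₂ hf₂ hq
    (v := fun _ => 1) continuousOn_const (by simp) one_ne_zero ?_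
  rw [← image_univ]
  refine (HasLogOn.image_circle hγ hi (u := fun w => w - q) (hn.congr fun z _ => ?_)).congr
    fun z _ => by simp
  simp [hn0]

end Jordan

/-! ### Logarithms on compact sets that do not separate the plane -/

/-- A continuous integer-valued function on a compact set of reals is a sum of step functions. -/
lemma exists_eqOn_of_step {T : Set ℝ} (hT : IsCompact T) {P : (ℝ → ℤ) → Prop}
    (hadd : ∀ m m', P m → P m' → P (m + m'))
    (hstep : ∀ p ∉ T, ∀ k : ℤ, P (fun t => if p < t then k else 0))
    {n : ℝ → ℤ} (hn : ContinuousOn n T) : ∃ m, P m ∧ EqOn n m T := by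
  obtain ⟨δ, hδ, hδn⟩ : ∃ δ > 0, ∀ x ∈ T, ∀ y ∈ T, dist x y < δ → n x = n y := by
    obtain ⟨δ, hδ, h⟩ := Metric.uniformContinuousOn_iff.1
      (hT.uniformContinuousOn_of_continuous hn) 1 one_pos
    refine ⟨δ, hδ, fun x hx y hy hxy => ?_⟩
    have h1 := h x hx y hy hxy
    rw [Int.dist_eq] at h1
    have h2 : |n x - n y| < 1 := by exact_mod_cast h1
    exact sub_eq_zero.1 (Int.abs_lt_one_iff.1 h2)
  obtain ⟨R, hR⟩ := hT.isBounded.subset_ball 0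
  -- The real line is swept from left to right in windows of length δ/2, on each of which n is
  -- constant on T. Keeping m constant beyond the swept part allows a single jump to correct the
  -- next window.
  have key : ∀ N : ℕ, ∃ m, P m ∧ (∀ t ∈ T, t ≤ -R + N * (δ / 2) → n t = m t) ∧
      ∀ s t, -R + N * (δ / 2) ≤ s → -R + N * (δ / 2) ≤ t → m s = m t := by
    intro N
    induction N with
    | zero =>
      refine ⟨_, hstep (-R) (fun h => ?_) 0, fun t ht htR => ?_, by simp⟩
      · have h1 := hR h
        simp only [mem_ball, Real.dist_eq, sub_zero, abs_neg] at h1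
        linarith [le_abs_self R]
      · have h1 := hR ht
        simp only [mem_ball, Real.dist_eq, sub_zero] at h1
        have h2 := neg_abs_le t
        simp at htR
        linarith
    | succ N ih =>
      obtain ⟨m, hm, h1, h2⟩ := ih
      set t₀ := -R + N * (δ / 2) with ht₀
      have e : -R + ((N + 1 : ℕ) : ℝ) * (δ / 2) = t₀ + δ / 2 := by push_cast; rw [ht₀]; ring
      rw [e]
      by_cases hemp : (T ∩ Icc t₀ (t₀ + δ / 2)).Nonempty
      · obtain ⟨x, hxT, hx⟩ := hemp
        obtain ⟨x₀, ⟨hx₀T, hx₀⟩, hmin⟩ :=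
          (hT.inter_right (isClosed_Ici (a := t₀))).exists_isLeast ⟨x, hxT, hx.1⟩
        have hx₀x : x₀ ≤ t₀ + δ / 2 := (hmin ⟨hxT, hx.1⟩).trans hx.2
        have hnear : ∀ t ∈ T, t₀ ≤ t → t ≤ t₀ + δ / 2 → n t = n x₀ := by
          intro t ht h3 h4
          refine hδn t ht x₀ hx₀T ?_
          rw [Real.dist_eq, abs_lt]
          have := hmin ⟨ht, h3⟩
          simp only [mem_Ici] at hx₀
          constructor <;> linarith
        rcases (mem_Ici.1 hx₀).eq_or_lt with heq | hlt
        · refine ⟨m, hm, fun t ht htle => ?_, fun s t hs ht => h2 s t (by linarith) (by linarith)⟩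
          rcases le_or_gt t t₀ with h3 | h3
          · exact h1 t ht h3
          · rw [hnear t ht h3.le htle, h1 x₀ hx₀T heq.ge, h2 x₀ t heq.le h3.le]
        -- The jump is placed halfway between the end of the swept part and the first point x₀ of T
        -- after it, hence off T.
        · set p := (t₀ + x₀) / 2 with hp
          have hpT : p ∉ T := fun h => by
            have := hmin ⟨h, show t₀ ≤ p by rw [hp]; linarith⟩
            rw [hp] at this
            linarith
          refine ⟨_, hadd _ _ hm (hstep p hpT (n x₀ - m x₀)), fun t ht htle => ?_,
            fun s t hs ht => ?_⟩
          · rcases le_or_gt t t₀ with h3 | h3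
            · rw [Pi.add_apply, if_neg (by rw [hp]; linarith), add_zero, h1 t ht h3]
            · have := hmin ⟨ht, h3.le⟩
              rw [Pi.add_apply, if_pos (by rw [hp]; linarith), hnear t ht h3.le htle,
                h2 t x₀ h3.le hx₀]
              ring
          · rw [Pi.add_apply, Pi.add_apply, if_pos (by rw [hp]; linarith),
              if_pos (by rw [hp]; linarith), h2 s t (by linarith) (by linarith)]
      · refine ⟨m, hm, fun t ht htle => ?_, fun s t hs ht => h2 s t (by linarith) (by linarith)⟩
        rcases le_or_gt t t₀ with h3 | h3
        · exact h1 t ht h3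
        · exact absurd ⟨t, ht, h3.le, htle⟩ hemp
  obtain ⟨N, hN⟩ := exists_nat_gt ((2 * R) / (δ / 2))
  obtain ⟨m, hm, h1, -⟩ := key N
  refine ⟨m, hm, fun t ht => h1 t ht ?_⟩
  have h2 := hR ht
  simp only [mem_ball, Real.dist_eq, sub_zero] at h2
  have h3 := le_abs_self t
  rw [div_lt_iff₀ (by positivity)] at hN
  linarith

lemma exists_continuousOn_union {X Y : Type*} [TopologicalSpace X] [TopologicalSpace Y]
    {A B : Set X} (hA : IsClosed A) (hB : IsClosed B) {f g : X → Y} (hf : ContinuousOn f A)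
    (hg : ContinuousOn g B) (h : ∀ x ∈ A, x ∈ B → f x = g x) :
    ∃ k : X → Y, ContinuousOn k (A ∪ B) ∧ EqOn k f A ∧ EqOn k g B := by
  classical
  have h1 : EqOn (A.piecewise f g) f A := fun x hx => by simp [hx]
  have h2 : EqOn (A.piecewise f g) g B := fun x hx => by
    by_cases hxA : x ∈ A
    · simp [hxA, h x hxA hx]
    · simp [hxA]
  exact ⟨_, ContinuousOn.union_of_isClosed (hf.congr h1) (hg.congr h2) hA hB, h1, h2⟩

/-- The principal branch and the branch cut along the positive reals agree on the upper half of the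
imaginary axis and differ by 2πi on the lower half. This is the unit jump used for gluing along a
line. -/
lemma log_I_mul_sub_log_neg (s : ℝ) (hs : s ≠ 0) :
    log (I * s) - (log (-(I * s)) + Real.pi * I) =
      (if 0 < s then (0 : ℂ) else -(2 * Real.pi * I)) := by
  rcases hs.lt_or_gt with h | h
  · have e1 : I * (s : ℂ) = ((-s : ℝ) : ℂ) * (-I) := by push_cast; ring
    have e2 : -(I * (s : ℂ)) = ((-s : ℝ) : ℂ) * I := by push_cast; ring
    rw [if_neg h.not_gt, e2, e1, log_ofReal_mul (neg_pos.2 h) (by simp),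
      log_ofReal_mul (neg_pos.2 h) (by simp), log_I, log_neg_I]
    ring
  · have e1 : I * (s : ℂ) = (s : ℂ) * I := by ring
    have e2 : -(I * (s : ℂ)) = (s : ℂ) * (-I) := by ring
    rw [if_pos h, e2, e1, log_ofReal_mul h (by simp),
      log_ofReal_mul h (by simp), log_I, log_neg_I]
    ring

/-- Gluing logarithms along a line. -/
lemma HasLogOn.union_of_line {F : ℂ → ℂ} {K₁ K₂ : Set ℂ} (hK₁ : IsCompact K₁) (hK₂ : IsCompact K₂)
    {ω : ℂ} (hω : ω ≠ 0) {c : ℝ} (h₁ : ∀ z ∈ K₁, (ω * z).re ≤ c) (h₂ : ∀ z ∈ K₂, c ≤ (ω * z).re)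
    (hgap : ∀ p : ℂ, (ω * p).re = c → p ∉ K₁ ∩ K₂ →
      (∃ a ∈ K₁ ∩ K₂, (ω * a).im ≤ (ω * p).im) → (∃ b ∈ K₁ ∩ K₂, (ω * p).im ≤ (ω * b).im) →
      HasLogOn (fun z => z - p) (K₁ ∪ K₂))
    (hF₁ : HasLogOn F K₁) (hF₂ : HasLogOn F K₂) : HasLogOn F (K₁ ∪ K₂) := by
  obtain ⟨L₁, hL₁, he₁⟩ := hF₁
  obtain ⟨L₂, hL₂, he₂⟩ := hF₂
  set ζ : ℝ → ℂ := fun t => ω⁻¹ * (c + t * I) with hζ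
  have hωζ : ∀ t, ω * ζ t = c + t * I := fun t => by simp [hζ, hω]
  have hζc : Continuous ζ := by fun_prop
  set T : Set ℝ := (fun z => (ω * z).im) '' (K₁ ∩ K₂) with hTdef
  have hT : IsCompact T := (hK₁.inter hK₂).image (by fun_prop)
  have hline : ∀ z ∈ K₁ ∩ K₂, ζ ((ω * z).im) = z := fun z hz => by
    have hre : (ω * z).re = c := le_antisymm (h₁ z hz.1) (h₂ z hz.2)
    refine mul_left_cancel₀ hω ?_
    rw [hωζ, ← hre, re_add_im]
  have hζT : ∀ t ∈ T, ζ t ∈ K₁ ∩ K₂ := by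
    rintro _ ⟨z, hz, rfl⟩
    simp only [hline z hz, hz]
  have hTζ : ∀ t, ζ t ∈ K₁ ∩ K₂ → t ∈ T := fun t ht => ⟨ζ t, ht, by simp [hωζ]⟩
  have hpi : (2 * Real.pi * I : ℂ) ≠ 0 := two_pi_I_ne_zero
  -- the difference of the two logarithms
  have hint : ∀ t ∈ T, ∃ n : ℤ, L₂ (ζ t) - L₁ (ζ t) = n * (2 * Real.pi * I) := fun t ht => by
    obtain ⟨n, hn⟩ := exp_eq_exp_iff_exists_int.1
      ((he₂ _ (hζT t ht).2).trans (he₁ _ (hζT t ht).1).symm)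
    exact ⟨n, by rw [hn]; ring⟩
  choose! n hn using hint
  have hnc : ContinuousOn n T := by
    rw [Complex.isClosedEmbedding_intCast.isInducing.continuousOn_iff]
    have : ContinuousOn (fun t => (L₂ (ζ t) - L₁ (ζ t)) / (2 * Real.pi * I)) T :=
      ((hL₂.comp hζc.continuousOn fun t ht => (hζT t ht).2).sub
        (hL₁.comp hζc.continuousOn fun t ht => (hζT t ht).1)).div_const _
    refine this.congr fun t ht => ?_
    simp only [Function.comp_apply, hn t ht]
    field_simp
  -- The logarithms glue once n, in units of 2πi, is a difference M₂ - M₁ of logarithms of 1 on the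
  -- two sides. The functions with this property are closed under addition, so step functions with a
  -- jump off T are enough.
  obtain ⟨m, ⟨M₁, M₂, hM₁, hM₂, hE₁, hE₂, hM⟩, hnm⟩ := exists_eqOn_of_step hT
    (P := fun m => ∃ M₁ M₂ : ℂ → ℂ, ContinuousOn M₁ K₁ ∧ ContinuousOn M₂ K₂ ∧
      (∀ z ∈ K₁, exp (M₁ z) = 1) ∧ (∀ z ∈ K₂, exp (M₂ z) = 1) ∧
      ∀ t ∈ T, M₂ (ζ t) - M₁ (ζ t) = m t * (2 * Real.pi * I))
    (by
      rintro m m' ⟨M₁, M₂, a1, a2, a3, a4, a5⟩ ⟨M₁', M₂', b1, b2, b3, b4, b5⟩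
      refine ⟨fun z => M₁ z + M₁' z, fun z => M₂ z + M₂' z, a1.add b1, a2.add b2, fun z hz => ?_, fun z hz => ?_, fun t ht => ?_⟩
      · simp only [exp_add, a3 z hz, b3 z hz, mul_one]
      · simp only [exp_add, a4 z hz, b4 z hz, mul_one]
      · simp only [Pi.add_apply]
        push_cast
        linear_combination a5 t ht + b5 t ht)
    (by
      intro p hp k
      -- If p lies below or above all of T, the step is constant on T and constants do; the gap
      -- hypothesis is needed only for p between two points of T.
      by_cases hlo : ∃ a ∈ T, a ≤ p
      swap
      · push Not at hlo
        refine ⟨fun _ => 0, fun _ => k * (2 * Real.pi * I), continuousOn_const,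
          continuousOn_const, by simp, fun _ _ => exp_int_mul_two_pi_mul_I k, fun t ht => ?_⟩
        simp [hlo t ht]
      by_cases hhi : ∃ b ∈ T, p ≤ b
      swap
      · push Not at hhi
        refine ⟨fun _ => 0, fun _ => 0, continuousOn_const,
          continuousOn_const, by simp, by simp, fun t ht => ?_⟩
        simp [(hhi t ht).not_gt]
      obtain ⟨a, ha, hap⟩ := hlo
      obtain ⟨b, hb, hpb⟩ := hhi
      have hB := hgap (ζ p) (by simp [hωζ]) (fun h => hp (hTζ p h))
        ⟨ζ a, hζT a ha, by simpa [hωζ] using hap⟩ ⟨ζ b, hζT b hb, by simpa [hωζ] using hpb⟩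
      have hB0 : ∀ z ∈ K₁ ∪ K₂, z - ζ p ≠ 0 := fun z hz => hB.ne_zero hz
      obtain ⟨B, hBc, hBe⟩ := hB
      have him : ∀ z ∈ K₁ ∪ K₂, (ω * (z - ζ p)).re = 0 → (ω * (z - ζ p)).im ≠ 0 :=
        fun z hz h h' => (mul_ne_zero hω (hB0 z hz)) (Complex.ext h h')
      have hre : ∀ z, (ω * (z - ζ p)).re = (ω * z).re - c := fun z => by
        rw [mul_sub, hωζ]; simp
      have hs₁ : ∀ z ∈ K₁, -(ω * (z - ζ p)) ∈ slitPlane := fun z hz => by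
        rw [mem_slitPlane_iff]
        rcases (h₁ z hz).lt_or_eq with h | h
        · left; rw [neg_re, hre]; linarith
        · right
          rw [neg_im, neg_ne_zero]
          exact him z (Or.inl hz) (by rw [hre, h, sub_self])
      have hs₂ : ∀ z ∈ K₂, ω * (z - ζ p) ∈ slitPlane := fun z hz => by
        rw [mem_slitPlane_iff]
        rcases (h₂ z hz).lt_or_eq with h | h
        · left; rw [hre]; linarith
        · right
          exact him z (Or.inr hz) (by rw [hre, h, sub_self])
      -- On each side a branch of log(z - ζ p) minus the common logarithm B is a logarithm of 1. The
      -- two branches agree on the line beyond p and differ by 2πi before it; the added constant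
      -- 2πik turns this into jump k beyond p and 0 before.
      refine ⟨fun z => k * (log (-(ω * (z - ζ p))) + Real.pi * I - log ω - B z),
        fun z => k * (log (ω * (z - ζ p)) - log ω - B z) + k * (2 * Real.pi * I),
        ?_, ?_, fun z hz => ?_, fun z hz => ?_, fun t ht => ?_⟩
      · refine continuousOn_const.mul ((((ContinuousOn.clog (by fun_prop) hs₁).add
          continuousOn_const).sub continuousOn_const).sub (hBc.mono subset_union_left))
      · refine (continuousOn_const.mul (((ContinuousOn.clog (by fun_prop) hs₂).sub
          continuousOn_const).sub (hBc.mono subset_union_right))).add continuousOn_const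
      · have h0 := hB0 z (Or.inl hz)
        rw [exp_int_mul, exp_sub, exp_sub, exp_add, exp_log (slitPlane_ne_zero (hs₁ z hz)),
          exp_log hω, exp_pi_mul_I, hBe z (Or.inl hz)]
        have : -(ω * (z - ζ p)) * -1 / ω / (z - ζ p) = 1 := by field_simp
        rw [this, one_zpow]
      · have h0 := hB0 z (Or.inr hz)
        rw [exp_add, exp_int_mul_two_pi_mul_I, mul_one,
          exp_int_mul, exp_sub, exp_sub, exp_log (slitPlane_ne_zero (hs₂ z hz)),
          exp_log hω, hBe z (Or.inr hz)]
        have : ω * (z - ζ p) / ω / (z - ζ p) = 1 := by field_simp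
        rw [this, one_zpow]
      · have e : ω * (ζ t - ζ p) = I * ((t - p : ℝ) : ℂ) := by
          rw [mul_sub, hωζ, hωζ]; push_cast; ring
        have hne : t - p ≠ 0 := fun h => hp (sub_eq_zero.1 h ▸ ht)
        have h3 := log_I_mul_sub_log_neg (t - p) hne
        simp only [e]
        have h4 : (0 < t - p) ↔ p < t := sub_pos
        by_cases h5 : p < t
        · rw [if_pos (h4.2 h5)] at h3
          rw [if_pos h5]
          linear_combination (k : ℂ) * h3
        · rw [if_neg (h4.not.2 h5)] at h3
          rw [if_neg h5]
          rw [Int.cast_zero]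
          linear_combination (k : ℂ) * h3)
    hnc
  obtain ⟨N, hNc, hN1, hN2⟩ := exists_continuousOn_union hK₁.isClosed hK₂.isClosed
    (hL₁.sub hM₁) (hL₂.sub hM₂) fun z hz₁ hz₂ => by
      have ht : (ω * z).im ∈ T := ⟨z, ⟨hz₁, hz₂⟩, rfl⟩
      have h3 := hn _ ht
      have h4 := hM _ ht
      rw [hline z ⟨hz₁, hz₂⟩] at h3 h4
      rw [hnm ht] at h3
      simp only [Pi.sub_apply]
      linear_combination h4 - h3
  refine ⟨N, hNc, ?_⟩
  rintro z (hz | hz)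
  · rw [hN1 hz, Pi.sub_apply, exp_sub, he₁ z hz, hE₁ z hz, div_one]
  · rw [hN2 hz, Pi.sub_apply, exp_sub, he₂ z hz, hE₂ z hz, div_one]

/-- If `z - p` has a logarithm on the compact set `K` for every `p` outside of `K`, then so does
every nonvanishing continuous function. -/
lemma hasLogOn_of_forall_sub {K : Set ℂ} (hK : IsCompact K)
    (hp : ∀ p ∉ K, HasLogOn (fun z => z - p) K) {F : ℂ → ℂ} (hF : ContinuousOn F K)
    (hF0 : ∀ z ∈ K, F z ≠ 0) : HasLogOn F K := by
  rcases K.eq_empty_or_nonempty with rfl | hne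
  · exact ⟨0, by simp, by simp⟩
  obtain ⟨z₀, hz₀, hmin⟩ := hK.exists_isMinOn hne hF.norm
  have hm0 : 0 < ‖F z₀‖ := norm_pos_iff.2 (hF0 z₀ hz₀)
  -- On pieces of diameter below δ, F varies by less than its minimum modulus, so F / F(w) stays
  -- within distance 1 of 1.
  obtain ⟨δ, hδ, hδF⟩ := Metric.uniformContinuousOn_iff.1
    (hK.uniformContinuousOn_of_continuous hF) _ hm0
  have hsmall : ∀ S ⊆ K, (∀ z ∈ S, ∀ w ∈ S, dist z w < δ) → HasLogOn F S := by
    intro S hS hd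
    rcases S.eq_empty_or_nonempty with rfl | ⟨w, hw⟩
    · exact ⟨0, by simp, by simp⟩
    have hw0 := hF0 w (hS hw)
    have : HasLogOn (fun z => F z / F w) S := by
      refine hasLogOn_of_norm_sub_one_lt ((hF.mono hS).div_const _) fun z hz => ?_
      have e : F z / F w - 1 = (F z - F w) / F w := by field_simp
      rw [e, norm_div, div_lt_one (norm_pos_iff.2 hw0), ← dist_eq_norm]
      exact (hδF z (hS hz) w (hS hw) (hd z hz w hw)).trans_le (hmin (hS hw))
    refine (this.mul (hasLogOn_const hw0 S)).congr fun z _ => ?_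
    field_simp
  obtain ⟨R, hR⟩ := hK.isBounded.subset_ball 0
  have hre : ∀ z ∈ K, |z.re| < R := fun z hz =>
    (abs_re_le_norm z).trans_lt (by simpa using hR hz)
  have him : ∀ z ∈ K, |z.im| < R := fun z hz =>
    (abs_im_le_norm z).trans_lt (by simpa using hR hz)
  -- Square cells of side η have diameter at most 2η < δ. Cells are glued into rows along vertical
  -- lines, then rows along horizontal ones.
  set η := δ / 3 with hη
  have hη0 : 0 < η := by positivity
  have hrow : ∀ b : ℝ, ∀ N : ℕ,
      HasLogOn F (K ∩ {z | b ≤ z.im ∧ z.im ≤ b + η} ∩ {z | z.re ≤ -R + N * η}) := by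
    intro b N
    have hcb : IsClosed {z : ℂ | b ≤ z.im ∧ z.im ≤ b + η} :=
      (isClosed_le continuous_const continuous_im).inter
        (isClosed_le continuous_im continuous_const)
    induction N with
    | zero =>
      refine hsmall _ (fun z hz => hz.1.1) fun z hz => ?_
      have h1 := (abs_lt.1 (hre z hz.1.1)).1
      have h2 := hz.2
      simp at h2
      linarith
    | succ N ih =>
      set c := -R + N * η with hc
      have e : -R + ((N + 1 : ℕ) : ℝ) * η = c + η := by push_cast; rw [hc]; ring
      rw [e]
      have hcell : HasLogOn F (K ∩ {z | b ≤ z.im ∧ z.im ≤ b + η} ∩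
          {z | c ≤ z.re ∧ z.re ≤ c + η}) := by
        refine hsmall _ (fun z hz => hz.1.1) fun z hz w hw => ?_
        rw [dist_eq_norm]
        refine (norm_le_abs_re_add_abs_im _).trans_lt ?_
        obtain ⟨⟨-, h1, h2⟩, h3, h4⟩ := hz
        obtain ⟨⟨-, h1', h2'⟩, h3', h4'⟩ := hw
        have a1 : |(z - w).re| ≤ η := by rw [sub_re, abs_le]; constructor <;> linarith
        have a2 : |(z - w).im| ≤ η := by rw [sub_im, abs_le]; constructor <;> linarith
        linarith
      have hu : K ∩ {z | b ≤ z.im ∧ z.im ≤ b + η} ∩ {z | z.re ≤ c + η} ⊆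
          (K ∩ {z | b ≤ z.im ∧ z.im ≤ b + η} ∩ {z | z.re ≤ c}) ∪
          (K ∩ {z | b ≤ z.im ∧ z.im ≤ b + η} ∩ {z | c ≤ z.re ∧ z.re ≤ c + η}) := by
        rintro z ⟨h1, h2⟩
        rcases le_total z.re c with h | h
        · exact Or.inl ⟨h1, h⟩
        · exact Or.inr ⟨h1, h, h2⟩
      refine (HasLogOn.union_of_line (ω := 1) (c := c) ((hK.inter_right hcb).inter_right
        (isClosed_le continuous_re continuous_const)) ((hK.inter_right hcb).inter_right
        ((isClosed_le continuous_const continuous_re).inter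
        (isClosed_le continuous_re continuous_const))) one_ne_zero
        (fun z hz => by simpa using hz.2) (fun z hz => by simpa using hz.2.1) ?_ ih hcell).mono hu
      -- Lying between two points of the common segment, p is in the row; so p ∈ K would make it a
      -- common point of both pieces.
      rintro p hpc hpn ⟨a, ha, hap⟩ ⟨a', ha', hap'⟩
      simp only [one_mul] at hpc hap hap'
      refine (hp p fun hpK => hpn ?_).mono
        (union_subset (fun z hz => hz.1.1) fun z hz => hz.1.1)
      have hb : b ≤ p.im ∧ p.im ≤ b + η := ⟨ha.1.1.2.1.trans hap, hap'.trans ha'.1.1.2.2⟩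
      exact ⟨⟨⟨hpK, hb⟩, hpc.le⟩, ⟨hpK, hb⟩, hpc.ge, show p.re ≤ c + η by rw [hpc]; linarith⟩
  have hrow' : ∀ b : ℝ, HasLogOn F (K ∩ {z | b ≤ z.im ∧ z.im ≤ b + η}) := by
    intro b
    obtain ⟨N, hN⟩ := exists_nat_gt ((2 * R) / η)
    rw [div_lt_iff₀ hη0] at hN
    refine (hrow b N).mono fun z hz => ⟨hz, ?_⟩
    have := (abs_lt.1 (hre z hz.1)).2
    simp only [mem_ofPred_eq]
    linarith
  have hall : ∀ N : ℕ, HasLogOn F (K ∩ {z | z.im ≤ -R + N * η}) := by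
    intro N
    induction N with
    | zero =>
      refine hsmall _ (fun z hz => hz.1) fun z hz => ?_
      have h1 := (abs_lt.1 (him z hz.1)).1
      have h2 := hz.2
      simp at h2
      linarith
    | succ N ih =>
      set c := -R + N * η with hc
      have e : -R + ((N + 1 : ℕ) : ℝ) * η = c + η := by push_cast; rw [hc]; ring
      rw [e]
      have hu : K ∩ {z | z.im ≤ c + η} ⊆
          (K ∩ {z | z.im ≤ c}) ∪ (K ∩ {z | c ≤ z.im ∧ z.im ≤ c + η}) := by
        rintro z ⟨h1, h2⟩
        rcases le_total z.im c with h | h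
        · exact Or.inl ⟨h1, h⟩
        · exact Or.inr ⟨h1, h, h2⟩
      refine (HasLogOn.union_of_line (ω := -I) (c := c) (hK.inter_right
        (isClosed_le continuous_im continuous_const)) (hK.inter_right
        ((isClosed_le continuous_const continuous_im).inter
        (isClosed_le continuous_im continuous_const))) (neg_ne_zero.2 I_ne_zero)
        (fun z hz => by simpa using hz.2) (fun z hz => by simpa using hz.2.1) ?_ ih
        (hrow' c)).mono hu
      rintro p hpc hpn ⟨a, ha, -⟩ -
      have hpc' : p.im = c := by simpa using hpc
      refine (hp p fun hpK => hpn ?_).mono (union_subset (fun z hz => hz.1) fun z hz => hz.1)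
      exact ⟨⟨hpK, hpc'.le⟩, hpK, hpc'.ge, show p.im ≤ c + η by rw [hpc']; linarith⟩
  obtain ⟨N, hN⟩ := exists_nat_gt ((2 * R) / η)
  rw [div_lt_iff₀ hη0] at hN
  refine (hall N).mono fun z hz => ⟨hz, ?_⟩
  have := (abs_lt.1 (him z hz)).2
  simp only [mem_ofPred_eq]
  linarith

/-- A nonvanishing continuous function on a plane domain with connected unbounded complement has
a continuous logarithm. -/
lemma hasLogOn_of_isPreconnected_compl {G : Set ℂ} (hG : IsOpen G) (hGc : IsConnected G)
    (hc : IsPreconnected Gᶜ) (hub : ¬ Bornology.IsBounded Gᶜ) {F : ℂ → ℂ} (hF : ContinuousOn F G)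
    (hF0 : ∀ z ∈ G, F z ≠ 0) : HasLogOn F G := by
  have hcpt : ∀ K ⊆ G, IsCompact K → HasLogOn F K := by
    intro K hKG hK
    obtain ⟨R, hR⟩ := hK.isBounded.subset_closedBall 0
    obtain ⟨c, hcG, hcR⟩ : ∃ c ∈ Gᶜ, c ∉ closedBall (0 : ℂ) R := by
      by_contra! h
      exact hub (isBounded_closedBall.subset h)
    have hKc : IsOpen Kᶜ := hK.isClosed.isOpen_compl
    -- Filling the holes: Z contains the unbounded connected set Gᶜ, so Zᶜ is a compact subset of G
    -- containing K whose complement is connected and unbounded.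
    set Z := connectedComponentIn Kᶜ c with hZ
    have hGZ : Gᶜ ⊆ Z := hc.subset_connectedComponentIn hcG (compl_subset_compl.2 hKG)
    have hRZ : (closedBall (0 : ℂ) R)ᶜ ⊆ Z :=
      (isPreconnected_compl_closedBall 0 R).subset_connectedComponentIn hcR
        (compl_subset_compl.2 hR)
    have hZc : IsCompact Zᶜ := (isCompact_closedBall (0 : ℂ) R).of_isClosed_subset
      hKc.connectedComponentIn.isClosed_compl (compl_subset_comm.1 hRZ)
    have hZG : Zᶜ ⊆ G := compl_subset_comm.1 hGZ
    have hKZ : K ⊆ Zᶜ := fun z hz hzZ => connectedComponentIn_subset _ _ hzZ hz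
    refine (hasLogOn_of_forall_sub hZc (fun p hpZ => ?_) (hF.mono hZG)
      fun z hz => hF0 z (hZG hz)).mono hKZ
    rw [notMem_compl_iff] at hpZ
    exact hasLogOn_sub_of_not_isBounded hZc isPreconnected_connectedComponentIn
      disjoint_compl_right hpZ fun h => hub (h.subset hGZ)
  obtain ⟨x₀, hx₀⟩ := hGc.nonempty
  -- Fixing the value at x₀ makes logarithms on connected compact sets through x₀ unique, so those
  -- on different sets agree where they meet.
  have hnorm : ∀ K ⊆ G, IsCompact K → x₀ ∈ K →
      ∃ L : ℂ → ℂ, ContinuousOn L K ∧ (∀ z ∈ K, exp (L z) = F z) ∧ L x₀ = log (F x₀) := by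
    intro K hKG hK hxK
    obtain ⟨L, hLc, hLe⟩ := hcpt K hKG hK
    refine ⟨fun z => L z + (log (F x₀) - L x₀), hLc.add continuousOn_const, fun z hz => ?_,
      by ring⟩
    rw [exp_add, exp_sub, exp_log (hF0 x₀ hx₀), hLe z hz, hLe x₀ hxK, div_self (hF0 x₀ hx₀),
      mul_one]
  have hagree : ∀ K : Set ℂ, IsPreconnected K → x₀ ∈ K → ∀ L M : ℂ → ℂ, ContinuousOn L K →
      ContinuousOn M K → (∀ z ∈ K, exp (L z) = F z) → (∀ z ∈ K, exp (M z) = F z) →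
      L x₀ = log (F x₀) → M x₀ = log (F x₀) → EqOn L M K := by
    intro K hK hxK L M hL hM hLe hMe hL0 hM0 z hz
    obtain ⟨n, hn⟩ := eq_add_two_pi_of_exp_eq hK hL hM fun z hz => (hLe z hz).trans (hMe z hz).symm
    have h1 := hn x₀ hxK
    rw [hL0, hM0] at h1
    rw [hn z hz]
    linear_combination -h1
  have hex : ∀ x ∈ G, ∃ K, IsCompact K ∧ IsPreconnected K ∧ K ⊆ G ∧ x₀ ∈ K ∧ x ∈ K := by
    intro x hx
    obtain ⟨K, h1, h2, h3, h4, h5⟩ := exists_isCompact_isPreconnected_between hG hGc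
      (isCompact_singleton (x := x)) (by simpa using hx) hx₀
    exact ⟨K, h1, h2, h4, h5, h3 rfl⟩
  choose! κ hκ₁ hκ₂ hκ₃ hκ₄ hκ₅ using hex
  choose! Λ hΛ₁ hΛ₂ hΛ₃ using hnorm
  have heq : ∀ K ⊆ G, IsCompact K → IsPreconnected K → x₀ ∈ K → ∀ y ∈ K,
      Λ (κ y) y = Λ K y := by
    intro K hKG hK hKp hxK y hy
    have hyG := hKG hy
    have hU : K ∪ κ y ⊆ G := union_subset hKG (hκ₃ y hyG)
    have hUc := hK.union (hκ₁ y hyG)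
    have hUx : x₀ ∈ K ∪ κ y := Or.inl hxK
    have e1 := hagree K hKp hxK _ _ (hΛ₁ K hKG hK hxK)
      ((hΛ₁ _ hU hUc hUx).mono subset_union_left) (hΛ₂ K hKG hK hxK)
      (fun z hz => hΛ₂ _ hU hUc hUx z (Or.inl hz)) (hΛ₃ K hKG hK hxK) (hΛ₃ _ hU hUc hUx) hy
    have e2 := hagree (κ y) (hκ₂ y hyG) (hκ₄ y hyG) _ _
      (hΛ₁ _ (hκ₃ y hyG) (hκ₁ y hyG) (hκ₄ y hyG))
      ((hΛ₁ _ hU hUc hUx).mono subset_union_right)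
      (hΛ₂ _ (hκ₃ y hyG) (hκ₁ y hyG) (hκ₄ y hyG))
      (fun z hz => hΛ₂ _ hU hUc hUx z (Or.inr hz))
      (hΛ₃ _ (hκ₃ y hyG) (hκ₁ y hyG) (hκ₄ y hyG)) (hΛ₃ _ hU hUc hUx) (hκ₅ y hyG)
    rw [e1, e2]
  refine ⟨fun y => Λ (κ y) y, fun x hx => ?_, fun x hx =>
    hΛ₂ _ (hκ₃ x hx) (hκ₁ x hx) (hκ₄ x hx) x (hκ₅ x hx)⟩
  obtain ⟨ε, hε, hb⟩ := Metric.nhds_basis_closedBall.mem_iff.1 (hG.mem_nhds hx)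
  -- Near x all the chosen values coincide with one logarithm, that of a connected compact set
  -- containing a disk around x.
  set K := κ x ∪ closedBall x ε with hKdef
  have hK : IsCompact K := (hκ₁ x hx).union (isCompact_closedBall x ε)
  have hKp : IsPreconnected K := (hκ₂ x hx).union x (hκ₅ x hx) (mem_closedBall_self hε.le)
    (convex_closedBall x ε).isPreconnected
  have hKG : K ⊆ G := union_subset (hκ₃ x hx) hb
  have hxK : x₀ ∈ K := Or.inl (hκ₄ x hx)
  have hnhds : K ∈ 𝓝 x := mem_of_superset (closedBall_mem_nhds x hε) subset_union_right
  refine ContinuousAt.continuousWithinAt ?_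
  refine ((hΛ₁ K hKG hK hxK).continuousAt hnhds).congr ?_
  filter_upwards [hnhds] with y hy using (heq K hKG hK hKp hxK y hy).symm

/-! ### The Riemann mapping theorem for bounded domains -/

/-- An injective holomorphic function is open, and its inverse is holomorphic. -/
lemma isOpen_image_of_injOn {U : Set ℂ} (hU : IsOpen U) {f : ℂ → ℂ}
    (hf : DifferentiableOn ℂ f U) (hi : InjOn f U) {z : ℂ} (hz : z ∈ U) {V : Set ℂ}
    (hV : V ∈ 𝓝 z) : f '' V ∈ 𝓝 (f z) := by
  have han : AnalyticAt ℂ f z := hf.analyticAt (hU.mem_nhds hz)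
  refine (han.eventually_constant_or_nhds_le_map_nhds.resolve_left fun h => ?_)
    (mem_map.2 (mem_of_superset hV (subset_preimage_image f V)))
  obtain ⟨ε, hε, hb⟩ := Metric.eventually_nhds_iff_ball.1
    (h.and (hU.mem_nhds hz))
  have hw : z + (ε / 2 : ℝ) ∈ ball z ε := by
    rw [mem_ball, dist_eq_norm, add_sub_cancel_left, norm_real, Real.norm_eq_abs,
      abs_of_pos (by positivity)]
    linarith
  have h1 := hi (hb _ hw).2 hz (hb _ hw).1
  rw [add_eq_left, ofReal_eq_zero] at h1
  linarith

/-- The inverse is continuous because f is open, and differentiable where f' ≠ 0. Zeros of f' are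
isolated, since otherwise f would be locally constant, so the remaining points are removable
singularities of k; that f' never vanishes need not be shown. -/
lemma differentiableAt_of_leftInvOn {U : Set ℂ} (hU : IsOpen U) {f k : ℂ → ℂ}
    (hf : DifferentiableOn ℂ f U) (hk : LeftInvOn k f U) {z : ℂ} (hz : z ∈ U) :
    DifferentiableAt ℂ k (f z) := by
  have hi : InjOn f U := hk.injOn
  have hcont : ∀ w ∈ U, ContinuousAt k (f w) := by
    intro w hw
    rw [ContinuousAt, hk hw]
    intro V hV
    rw [mem_map]
    refine mem_of_superset
      (isOpen_image_of_injOn hU hf hi hw (inter_mem hV (hU.mem_nhds hw))) ?_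
    rintro _ ⟨x, ⟨hx, hxU⟩, rfl⟩
    rwa [mem_preimage, hk hxU]
  have hreg : ∀ w ∈ U, deriv f w ≠ 0 → DifferentiableAt ℂ k (f w) := by
    intro w hw hd
    have h1 : HasDerivAt f (deriv f w) (k (f w)) := by
      rw [hk hw]; exact (hf.differentiableAt (hU.mem_nhds hw)).hasDerivAt
    refine (h1.of_local_left_inverse (hcont w hw) hd ?_).differentiableAt
    filter_upwards [isOpen_image_of_injOn hU hf hi hw (hU.mem_nhds hw)]
    rintro _ ⟨x, hx, rfl⟩
    rw [hk hx]
  refine (analyticAt_of_differentiable_on_punctured_nhds_of_continuousAt ?_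
    (hcont z hz)).differentiableAt
  have hd : AnalyticAt ℂ (deriv f) z := (hf.analyticAt (hU.mem_nhds hz)).deriv
  rcases hd.eventually_eq_zero_or_eventually_ne_zero with h | h
  · exfalso
    obtain ⟨ε, hε, hb⟩ := Metric.eventually_nhds_iff_ball.1 (h.and (hU.mem_nhds hz))
    have hw : z + (ε / 2 : ℝ) ∈ ball z ε := by
      rw [mem_ball, dist_eq_norm, add_sub_cancel_left, norm_real, Real.norm_eq_abs,
        abs_of_pos (by positivity)]
      linarith
    have h1 := (convex_ball z ε).norm_image_sub_le_of_norm_deriv_le (f := f) (C := 0)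
      (fun x hx => hf.differentiableAt (hU.mem_nhds (hb x hx).2))
      (fun x hx => by rw [(hb x hx).1, norm_zero]) (mem_ball_self hε) hw
    rw [zero_mul] at h1
    have h2 := hi (hb _ hw).2 hz (sub_eq_zero.1 (norm_le_zero_iff.1 h1))
    rw [add_eq_left, ofReal_eq_zero] at h2
    linarith
  · rw [eventually_nhdsWithin_iff] at h
    obtain ⟨V, hV⟩ := (h.and (hU.mem_nhds hz)).exists_mem
    rw [eventually_nhdsWithin_iff]
    filter_upwards [isOpen_image_of_injOn hU hf hi hz hV.1]
    rintro _ ⟨x, hx, rfl⟩ hne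
    exact hreg x (hV.2 x hx).2 ((hV.2 x hx).1 fun h => hne (congrArg f h))

/-- A locally uniform limit of injective holomorphic functions is injective unless constant. -/
lemma injOn_of_tendstoLocallyUniformlyOn {ι : Type*} {φ : Filter ι} [φ.NeBot] {U : Set ℂ}
    (hU : IsOpen U) (hUc : IsPreconnected U) {F : ι → ℂ → ℂ} {f : ℂ → ℂ}
    (hF : ∀ n, DifferentiableOn ℂ (F n) U) (hFi : ∀ n, InjOn (F n) U)
    (hlim : TendstoLocallyUniformlyOn F f φ U) {z₀ : ℂ} (hz₀ : z₀ ∈ U) (hd : deriv f z₀ ≠ 0) :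
    InjOn f U := by
  have hf : DifferentiableOn ℂ f U := hlim.differentiableOn (.of_forall hF) hU
  intro z₁ h₁ z₂ h₂ heq
  by_contra hne
  have hg : AnalyticOnNhd ℂ (fun z => f z - f z₂) U :=
    (hf.sub_const _).analyticOnNhd hU
  rcases (hg z₁ h₁).eventually_eq_zero_or_eventually_ne_zero with h | h
  · have h3 := hg.eqOn_zero_of_preconnected_of_eventuallyEq_zero hUc h₁ h
    apply hd
    have h4 : f =ᶠ[𝓝 z₀] fun _ => f z₂ := by
      filter_upwards [hU.mem_nhds hz₀] with z hz using sub_eq_zero.1 (h3 hz)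
    rw [h4.deriv_eq, deriv_const]
  rw [eventually_nhdsWithin_iff] at h
  obtain ⟨r, hr, hb⟩ := Metric.nhds_basis_closedBall.mem_iff.1
    ((h.and (hU.mem_nhds h₁)).and (isOpen_ne.mem_nhds hne))
  have hbU : closedBall z₁ r ⊆ U := fun z hz => (hb hz).1.2
  have hsph : ∀ z ∈ sphere z₁ r, f z - f z₂ ≠ 0 := fun z hz =>
    (hb (sphere_subset_closedBall hz)).1.1 fun h => by
      rw [mem_singleton_iff.1 h, mem_sphere, dist_self] at hz
      exact hr.ne hz
  obtain ⟨w, hw, hmin⟩ := (isCompact_sphere z₁ r).exists_isMinOn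
    (NormedSpace.sphere_nonempty.2 hr.le) (f := fun z => ‖f z - f z₂‖)
    ((hf.continuousOn.mono (sphere_subset_closedBall.trans hbU)).sub continuousOn_const).norm
  set m := ‖f w - f z₂‖ with hm
  have hm0 : 0 < m := norm_pos_iff.2 (hsph w hw)
  have hK : TendstoUniformlyOn F f φ (closedBall z₁ r) :=
    (tendstoLocallyUniformlyOn_iff_tendstoUniformlyOn_of_compact (isCompact_closedBall z₁ r)).1
      (hlim.mono hbU)
  have ev := (Metric.tendstoUniformlyOn_iff.1 hK (m / 4) (by positivity)).and
    (Metric.tendsto_nhds.1 (hlim.tendsto_at h₂) (m / 4) (by positivity))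
  obtain ⟨n, hn₁, hn₂⟩ := ev.exists
  -- By injectivity g has no zero on the disk around z₁, which excludes z₂. So 1/g obeys the maximum
  -- principle: it is at most 2/m on the circle, while |g z₁| < m/2 because f z₁ = f z₂.
  set g : ℂ → ℂ := fun z => F n z - F n z₂ with hgdef
  have hclose : ∀ z ∈ closedBall z₁ r, ‖g z - (f z - f z₂)‖ < m / 2 := by
    intro z hz
    have e : g z - (f z - f z₂) = -(f z - F n z) - (F n z₂ - f z₂) := by simp only [hgdef]; ring
    rw [e]
    refine (norm_sub_le _ _).trans_lt ?_
    rw [norm_neg, ← dist_eq_norm, ← dist_eq_norm]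
    linarith [hn₁ z hz]
  have hg0 : ∀ z ∈ closedBall z₁ r, g z ≠ 0 := fun z hz h =>
    (hb hz).2 (hFi n (hbU hz) h₂ (sub_eq_zero.1 h))
  have hgd : DifferentiableOn ℂ (fun z => (g z)⁻¹) (closedBall z₁ r) :=
    (((hF n).mono hbU).sub_const _).fun_inv hg0
  have hbound := norm_le_of_forall_mem_frontier_norm_le (U := ball z₁ r) isBounded_ball
    (f := fun z => (g z)⁻¹) (C := (m / 2)⁻¹) (z := z₁)
    (DifferentiableOn.diffContOnCl (by rwa [closure_ball z₁ hr.ne'])) (fun z hz => by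
      rw [frontier_ball z₁ hr.ne'] at hz
      rw [norm_inv]
      refine inv_anti₀ (by positivity) ?_
      have h5 := hclose z (sphere_subset_closedBall hz)
      have h6 : m ≤ ‖f z - f z₂‖ := hmin hz
      have h7 := norm_sub_norm_le (f z - f z₂) (g z)
      rw [norm_sub_rev (f z - f z₂)] at h7
      linarith) (subset_closure (mem_ball_self hr))
  have h8 := hclose z₁ (mem_closedBall_self hr.le)
  rw [heq, sub_self, sub_zero] at h8
  rw [norm_inv] at hbound
  have h9 := (inv_le_inv₀ (norm_pos_iff.2 (hg0 z₁ (mem_closedBall_self hr.le)))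
    (by positivity)).1 hbound
  linarith

/-- Montel's theorem, for limits along an ultrafilter. -/
lemma exists_tendstoLocallyUniformlyOn {ι : Type*} (φ : Ultrafilter ι) {U : Set ℂ}
    (hU : IsOpen U) {F : ι → ℂ → ℂ} (hF : ∀ n, DifferentiableOn ℂ (F n) U) {M : ℝ}
    (hM : ∀ n, ∀ z ∈ U, ‖F n z‖ ≤ M) :
    ∃ f, TendstoLocallyUniformlyOn F f φ U := by
  -- Along an ultrafilter bounded values always converge, so no diagonal subsequence is needed.
  have hpt : ∀ z ∈ U, ∃ y, Tendsto (fun n => F n z) φ (𝓝 y) := by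
    intro z hz
    obtain ⟨y, -, hy⟩ := (isCompact_closedBall (0 : ℂ) M).ultrafilter_le_nhds
      (φ.map fun n => F n z) (by
        rw [le_principal_iff]
        exact mem_map.2 (univ_mem' fun n => by simpa using hM n z hz))
    exact ⟨y, hy⟩
  choose! f hf using hpt
  refine ⟨f, Metric.tendstoLocallyUniformlyOn_iff.2 fun ε hε z hz => ?_⟩
  obtain ⟨r, hr, hb⟩ := Metric.isOpen_iff.1 hU z hz
  have hM0 : 0 ≤ M := by
    obtain ⟨n⟩ : Nonempty ι := (φ : Filter ι).nonempty_of_neBot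
    exact (norm_nonneg _).trans (hM n z hz)
  set C := M / (r / 3) with hC
  have hC0 : 0 ≤ C := by positivity
  -- Cauchy's estimate on disks of radius r/3 gives a Lipschitz constant common to all n, which
  -- upgrades pointwise to locally uniform convergence.
  have hLip : ∀ n, ∀ w ∈ ball z (r / 3), ‖F n w - F n z‖ ≤ C * ‖w - z‖ := by
    intro n w hw
    refine (convex_ball z (r / 3)).norm_image_sub_le_of_norm_deriv_le
      (fun x hx => (hF n).differentiableAt (hU.mem_nhds (hb (ball_subset_ball (by linarith) hx))))
      (fun x hx => ?_) (mem_ball_self (by positivity)) hw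
    have hsub : closedBall x (r / 3) ⊆ U := fun y hy => hb (by
      rw [mem_ball] at hx ⊢
      rw [mem_closedBall] at hy
      linarith [dist_triangle y x z])
    refine norm_deriv_le_of_forall_mem_sphere_norm_le (by positivity)
      (DifferentiableOn.diffContOnCl ?_) fun y hy => hM n y (hsub (sphere_subset_closedBall hy))
    rw [closure_ball x (by positivity)]
    exact (hF n).mono hsub
  have hLip' : ∀ w ∈ ball z (r / 3), ‖f w - f z‖ ≤ C * ‖w - z‖ := by
    intro w hw
    have hwU : w ∈ U := hb (ball_subset_ball (by linarith) hw)
    exact le_of_tendsto ((hf w hwU).sub (hf z hz)).norm (.of_forall fun n => hLip n w hw)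
  set s := min (r / 3) (ε / (3 * (C + 1))) with hs
  have hs0 : 0 < s := lt_min (by positivity) (by positivity)
  refine ⟨ball z s, mem_nhdsWithin_of_mem_nhds (ball_mem_nhds z hs0), ?_⟩
  filter_upwards [Metric.tendsto_nhds.1 (hf z hz) (ε / 3) (by positivity)] with n hn w hw
  have hw3 : w ∈ ball z (r / 3) := ball_subset_ball (min_le_left _ _) hw
  have hsmall : C * ‖w - z‖ ≤ ε / 3 := by
    have h1 : ‖w - z‖ ≤ ε / (3 * (C + 1)) := by
      rw [← dist_eq_norm]
      exact (mem_ball.1 hw).le.trans (min_le_right _ _)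
    have h2 : (C + 1) * ‖w - z‖ ≤ ε / 3 := by
      calc (C + 1) * ‖w - z‖ ≤ (C + 1) * (ε / (3 * (C + 1))) := by gcongr
        _ = ε / 3 := by field_simp
    nlinarith [norm_nonneg (w - z)]
  rw [dist_eq_norm] at hn ⊢
  have e : f w - F n w = (f w - f z) - (F n z - f z) - (F n w - F n z) := by ring
  rw [e]
  have h3 := hLip n w hw3
  have h4 := hLip' w hw3
  have h5 := norm_sub_le ((f w - f z) - (F n z - f z)) (F n w - F n z)
  have h6 := norm_sub_le (f w - f z) (F n z - f z)
  linarith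

/-- The automorphism of the unit disk that maps `a` to the origin. -/
def diskShift (a z : ℂ) : ℂ := (z - a) / (1 - (starRingEnd ℂ) a * z)

section diskShift

variable {a z : ℂ}

lemma one_sub_conj_mul_ne_zero (ha : ‖a‖ < 1) (hz : ‖z‖ ≤ 1) :
    1 - (starRingEnd ℂ) a * z ≠ 0 := by
  intro h
  have h1 : ‖(starRingEnd ℂ) a * z‖ = 1 := by rw [← sub_eq_zero.1 h, norm_one]
  rw [norm_mul, RCLike.norm_conj] at h1
  nlinarith [norm_nonneg a, norm_nonneg z]

lemma norm_diskShift_lt_one (ha : ‖a‖ < 1) (hz : ‖z‖ < 1) : ‖diskShift a z‖ < 1 := by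
  have h0 := one_sub_conj_mul_ne_zero ha hz.le
  rw [diskShift, norm_div, div_lt_one (norm_pos_iff.2 h0)]
  refine lt_of_pow_lt_pow_left₀ 2 (norm_nonneg _) ?_
  have key : ‖1 - (starRingEnd ℂ) a * z‖ ^ 2 - ‖z - a‖ ^ 2 = (1 - ‖a‖ ^ 2) * (1 - ‖z‖ ^ 2) := by
    simp only [← normSq_eq_norm_sq, normSq_apply, sub_re, sub_im, mul_re, mul_im, conj_re, conj_im,
      one_re, one_im]
    ring
  have h1 : 0 < 1 - ‖a‖ ^ 2 := by nlinarith [norm_nonneg a]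
  have h2 : 0 < 1 - ‖z‖ ^ 2 := by nlinarith [norm_nonneg z]
  nlinarith [mul_pos h1 h2]

lemma hasDerivAt_diskShift (ha : ‖a‖ < 1) (hz : ‖z‖ ≤ 1) :
    HasDerivAt (diskShift a) ((1 - ‖a‖ ^ 2 : ℝ) / (1 - (starRingEnd ℂ) a * z) ^ 2) z := by
  have h0 := one_sub_conj_mul_ne_zero ha hz
  have h1 := ((hasDerivAt_id z).sub_const a).div
    (((hasDerivAt_id z).const_mul ((starRingEnd ℂ) a)).const_sub 1) h0
  refine h1.congr_deriv ?_
  congr 1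
  have h2 : (starRingEnd ℂ) a * a = ((‖a‖ ^ 2 : ℝ) : ℂ) := by
    rw [← normSq_eq_norm_sq, normSq_eq_conj_mul_self]
  push_cast at h2 ⊢
  simp only [id]
  linear_combination -h2

lemma injOn_diskShift (ha : ‖a‖ < 1) : InjOn (diskShift a) (closedBall 0 1) := by
  intro z hz w hw h
  rw [mem_closedBall_zero_iff] at hz hw
  have hz0 := one_sub_conj_mul_ne_zero ha hz
  have hw0 := one_sub_conj_mul_ne_zero ha hw
  have h1 : (1 - (starRingEnd ℂ) a * a) ≠ 0 := one_sub_conj_mul_ne_zero ha ha.le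
  rw [diskShift, diskShift, div_eq_div_iff hz0 hw0] at h
  refine sub_eq_zero.1 ((mul_eq_zero.1 (?_ : (1 - (starRingEnd ℂ) a * a) * (z - w) = 0)
    ).resolve_left h1)
  linear_combination h

lemma diskShift_eq_zero (ha : ‖a‖ < 1) (hz : ‖z‖ ≤ 1) : diskShift a z = 0 ↔ z = a := by
  rw [diskShift, div_eq_zero_iff, or_iff_left (one_sub_conj_mul_ne_zero ha hz), sub_eq_zero]

end diskShift

/-- A continuous logarithm of a holomorphic function is holomorphic. -/
lemma differentiableOn_of_exp_eq {U : Set ℂ} (hU : IsOpen U) {u L : ℂ → ℂ}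
    (hu : DifferentiableOn ℂ u U) (hL : ContinuousOn L U) (he : ∀ z ∈ U, exp (L z) = u z) :
    DifferentiableOn ℂ L U := by
  intro z₀ hz₀
  have hc : ContinuousAt L z₀ := hL.continuousAt (hU.mem_nhds hz₀)
  -- Near z₀ the imaginary part of L - L z₀ stays in (-π, π), so L is a shifted principal logarithm
  -- there.
  have hev : L =ᶠ[𝓝 z₀] fun z => log (u z * exp (-L z₀)) + L z₀ := by
    have h1 : Tendsto (fun z => (L z - L z₀).im) (𝓝 z₀) (𝓝 0) := by
      have : Tendsto (fun z => (L z - L z₀).im) (𝓝 z₀) (𝓝 (L z₀ - L z₀).im) :=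
        (continuous_im.tendsto _).comp (hc.sub_const _)
      simpa using this
    filter_upwards [h1.eventually_mem (Ioo_mem_nhds (neg_lt_zero.2 Real.pi_pos) Real.pi_pos),
      hU.mem_nhds hz₀] with z h2 hz
    rw [← he z hz, ← exp_add, ← sub_eq_add_neg, log_exp h2.1 h2.2.le]
    ring
  refine (DifferentiableAt.congr_of_eventuallyEq ?_ hev).differentiableWithinAt
  refine (DifferentiableAt.clog ((hu.differentiableAt (hU.mem_nhds hz₀)).mul_const _) ?_).add_const _
  rw [← he z₀ hz₀, ← exp_add, add_neg_cancel, exp_zero]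
  exact one_mem_slitPlane

/-- The Riemann mapping theorem, for bounded domains with connected complement. -/
theorem exists_bijOn_ball {G : Set ℂ} (hG : IsOpen G) (hGc : IsConnected G)
    (hGb : Bornology.IsBounded G) (hc : IsPreconnected Gᶜ) :
    ∃ f : ℂ → ℂ, DifferentiableOn ℂ f (ball 0 1) ∧ BijOn f (ball 0 1) G := by
  obtain ⟨z₀, hz₀⟩ := hGc.nonempty
  have hub : ¬ Bornology.IsBounded Gᶜ := fun h => by
    have := hGb.union h
    rw [union_compl_self] at this
    exact NormedSpace.unbounded_univ ℝ ℂ this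
  -- A normalised injective map into the disk with largest |f'(z₀)| will turn out to be onto. A
  -- dilation belongs to this family, so the supremum is positive and the extremal limit is not
  -- constant.
  set 𝓕 : Set (ℂ → ℂ) := {f | DifferentiableOn ℂ f G ∧ MapsTo f G (ball 0 1) ∧ InjOn f G ∧
    f z₀ = 0} with h𝓕
  set S : Set ℝ := (fun f => ‖deriv f z₀‖) '' 𝓕 with hS
  have hbdd : BddAbove S := by
    obtain ⟨ρ, hρ, hb⟩ := Metric.nhds_basis_closedBall.mem_iff.1 (hG.mem_nhds hz₀)
    refine ⟨1 / ρ, ?_⟩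
    rintro _ ⟨f, ⟨hf, hm, -⟩, rfl⟩
    refine norm_deriv_le_of_forall_mem_sphere_norm_le hρ (DifferentiableOn.diffContOnCl ?_)
      fun z hz => (mem_ball_zero_iff.1 (hm (hb (sphere_subset_closedBall hz)))).le
    rw [closure_ball z₀ hρ.ne']
    exact hf.mono hb
  obtain ⟨R, hR0, hR⟩ := hGb.subset_ball_lt 0 z₀
  have hpos : R⁻¹ ∈ S := by
    have hR' : (R : ℂ) ≠ 0 := by exact_mod_cast hR0.ne'
    refine ⟨fun z => (z - z₀) / R, ⟨by fun_prop, fun z hz => ?_, fun z _ w _ h => ?_, by simp⟩, ?_⟩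
    · rw [mem_ball_zero_iff, norm_div, norm_real, Real.norm_of_nonneg hR0.le, div_lt_one hR0,
        ← dist_eq_norm]
      exact hR hz
    · simpa [div_left_inj' hR'] using h
    · have : deriv (fun z : ℂ => (z - z₀) / R) z₀ = 1 / R := by
        simp [deriv_div_const]
      simp only [this]
      rw [norm_div, norm_one, norm_real, Real.norm_of_nonneg hR0.le, one_div]
  obtain ⟨u, -, hu, huS⟩ := exists_seq_tendsto_sSup ⟨_, hpos⟩ hbdd
  choose F hF hFu using huS
  obtain ⟨f, hf⟩ := exists_tendstoLocallyUniformlyOn (hyperfilter ℕ) hG (fun n => (hF n).1)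
    (M := 1) fun n z hz => (mem_ball_zero_iff.1 ((hF n).2.1 hz)).le
  have hfd : DifferentiableOn ℂ f G := hf.differentiableOn (.of_forall fun n => (hF n).1) hG
  have hder : ‖deriv f z₀‖ = sSup S := by
    have h1 : Tendsto (fun n => ‖deriv (F n) z₀‖) (hyperfilter ℕ) (𝓝 ‖deriv f z₀‖) :=
      ((hf.deriv (.of_forall fun n => (hF n).1) hG).tendsto_at hz₀).norm
    refine tendsto_nhds_unique h1 ?_
    simp only [fun n => hFu n]
    exact hu.mono_left Nat.hyperfilter_le_atTop
  have hM0 : 0 < sSup S := (inv_pos.2 hR0).trans_le (le_csSup hbdd hpos)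
  have hd0 : deriv f z₀ ≠ 0 := norm_pos_iff.1 (hder ▸ hM0)
  have hinj : InjOn f G := injOn_of_tendstoLocallyUniformlyOn hG hGc.isPreconnected
    (fun n => (hF n).1) (fun n => (hF n).2.2.1) hf hz₀ hd0
  have hfz₀ : f z₀ = 0 := by
    refine tendsto_nhds_unique (hf.tendsto_at hz₀) ?_
    simp only [fun n => (hF n).2.2.2]
    exact tendsto_const_nhds
  have hle : ∀ z ∈ G, ‖f z‖ ≤ 1 := fun z hz =>
    le_of_tendsto (hf.tendsto_at hz).norm
      (.of_forall fun n => (mem_ball_zero_iff.1 ((hF n).2.1 hz)).le)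
  have hmaps : MapsTo f G (ball 0 1) := by
    intro z hz
    rw [mem_ball_zero_iff]
    refine (hle z hz).lt_of_ne fun h => ?_
    have h1 := eqOn_of_isPreconnected_of_isMaxOn_norm hGc.isPreconnected hG hfd hz
      (fun w hw => by simpa [h] using hle w hw) hz₀
    rw [hfz₀] at h1
    simp only [Function.const_apply] at h1
    rw [← h1, norm_zero] at h
    exact zero_ne_one h
  have hsurj : ball 0 1 ⊆ f '' G := by
    intro w hw
    rw [mem_ball_zero_iff] at hw
    by_contra hwf
    have hf1 : ∀ z ∈ G, ‖f z‖ < 1 := fun z hz => mem_ball_zero_iff.1 (hmaps hz)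
    set v : ℂ → ℂ := fun z => diskShift w (f z) with hv
    have hvd : DifferentiableOn ℂ v G := fun z hz =>
      ((hasDerivAt_diskShift hw (hf1 z hz).le).differentiableAt.comp z
        (hfd.differentiableAt (hG.mem_nhds hz))).differentiableWithinAt
    have hv0 : ∀ z ∈ G, v z ≠ 0 := fun z hz h =>
      hwf ⟨z, hz, (diskShift_eq_zero hw (hf1 z hz).le).1 h⟩
    obtain ⟨L, hLc, hLe⟩ := hasLogOn_of_isPreconnected_compl hG hGc hc hub hvd.continuousOn hv0
    have hLd := differentiableOn_of_exp_eq hG hvd hLc hLe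
    -- Squaring contracts the hyperbolic metric, so passing to a square root of the zero-free v and
    -- moving g z₀ back to 0 enlarges the derivative at z₀.
    set g : ℂ → ℂ := fun z => exp (L z / 2) with hg
    have hgd : DifferentiableOn ℂ g G := (hLd.div_const 2).cexp
    have hg2 : ∀ z ∈ G, g z ^ 2 = v z := fun z hz => by
      rw [hg, ← hLe z hz, sq, ← exp_add, add_halves]
    have hg1 : ∀ z ∈ G, ‖g z‖ < 1 := fun z hz => by
      have h1 := norm_diskShift_lt_one hw (hf1 z hz)
      rw [show diskShift w (f z) = g z ^ 2 from (hg2 z hz).symm, norm_pow] at h1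
      exact (sq_lt_one_iff₀ (norm_nonneg _)).1 h1
    have hgi : InjOn g G := fun x hx y hy h => by
      have h1 : v x = v y := by rw [← hg2 x hx, ← hg2 y hy, h]
      exact hinj hx hy (injOn_diskShift hw (mem_closedBall_zero_iff.2 (hf1 x hx).le)
        (mem_closedBall_zero_iff.2 (hf1 y hy).le) h1)
    set b := g z₀ with hb
    have hb1 : ‖b‖ < 1 := hg1 z₀ hz₀
    set Φ : ℂ → ℂ := fun z => diskShift b (g z) with hΦ
    have hΦ𝓕 : Φ ∈ 𝓕 := by
      refine ⟨fun z hz => ((hasDerivAt_diskShift hb1 (hg1 z hz).le).differentiableAt.comp z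
        (hgd.differentiableAt (hG.mem_nhds hz))).differentiableWithinAt, fun z hz =>
        mem_ball_zero_iff.2 (norm_diskShift_lt_one hb1 (hg1 z hz)), fun x hx y hy h => ?_, ?_⟩
      · exact hgi hx hy (injOn_diskShift hb1 (mem_closedBall_zero_iff.2 (hg1 x hx).le)
          (mem_closedBall_zero_iff.2 (hg1 y hy).le) h)
      · exact (diskShift_eq_zero hb1 hb1.le).2 rfl
    have hΦle : ‖deriv Φ z₀‖ ≤ ‖deriv f z₀‖ := hder ▸ le_csSup hbdd ⟨Φ, hΦ𝓕, rfl⟩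
    have hgz := (hgd.differentiableAt (hG.mem_nhds hz₀)).hasDerivAt
    have hfz := (hfd.differentiableAt (hG.mem_nhds hz₀)).hasDerivAt
    have d1 : deriv Φ z₀ = ((1 - ‖b‖ ^ 2 : ℝ) / (1 - (starRingEnd ℂ) b * b) ^ 2) * deriv g z₀ :=
      (HasDerivAt.comp (h₂ := diskShift b) z₀ (hasDerivAt_diskShift hb1 hb1.le) hgz).deriv
    have hbb : (starRingEnd ℂ) b * b = ((‖b‖ ^ 2 : ℝ) : ℂ) := by
      rw [← normSq_eq_norm_sq, normSq_eq_conj_mul_self]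
    have d2 : 2 * b * deriv g z₀ = (1 - ‖w‖ ^ 2 : ℝ) * deriv f z₀ := by
      have e1 := (hgz.pow 2).deriv
      have e2 := ((hasDerivAt_diskShift hw (hf1 z₀ hz₀).le).comp z₀ hfz).deriv
      have e3 : (g ^ 2) =ᶠ[𝓝 z₀] (diskShift w ∘ f) := by
        filter_upwards [hG.mem_nhds hz₀] with z hz using hg2 z hz
      rw [e3.deriv_eq, e2, hfz₀] at e1
      simp only [mul_zero, sub_zero, one_pow, div_one] at e1
      rw [e1]
      simp [hb]
    have hbw : ‖b‖ ^ 2 = ‖w‖ := by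
      rw [← norm_pow, hg2 z₀ hz₀]
      simp only [hv, hfz₀, diskShift]
      simp
    have hpos' : 0 < 1 - ‖b‖ ^ 2 := by nlinarith [norm_nonneg b]
    have n1 : ‖deriv Φ z₀‖ * (1 - ‖b‖ ^ 2) = ‖deriv g z₀‖ := by
      rw [d1, hbb, ← ofReal_one, ← ofReal_sub, norm_mul, norm_div, norm_pow, norm_real,
        Real.norm_of_nonneg hpos'.le]
      field_simp
    have n2 : 2 * ‖b‖ * ‖deriv g z₀‖ = (1 - ‖w‖ ^ 2) * ‖deriv f z₀‖ := by
      have h1 := congrArg norm d2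
      have h2 : 0 ≤ 1 - ‖w‖ ^ 2 := by nlinarith [norm_nonneg w]
      rw [norm_mul, norm_mul, norm_mul, norm_real, Real.norm_of_nonneg h2] at h1
      simpa using h1
    rw [← hbw, ← n1] at n2
    set s := ‖b‖
    have hs0 : 0 ≤ s := norm_nonneg b
    have hDf : 0 < ‖deriv f z₀‖ := hder ▸ hM0
    -- Here s² = |w|, and 1 + s² > 2s since s < 1; this contradicts |Φ'(z₀)| ≤ |f'(z₀)|. The
    -- relation is kept free of division by s.
    have n3 : 2 * s * ‖deriv Φ z₀‖ = (1 + s ^ 2) * ‖deriv f z₀‖ := by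
      have : (1 - s ^ 2) * (2 * s * ‖deriv Φ z₀‖) = (1 - s ^ 2) * ((1 + s ^ 2) * ‖deriv f z₀‖) := by
        linear_combination n2
      exact mul_left_cancel₀ hpos'.ne' this
    have n4 : 2 * s * ‖deriv Φ z₀‖ ≤ 2 * s * ‖deriv f z₀‖ := by gcongr
    have n5 : 0 < (1 - s) ^ 2 * ‖deriv f z₀‖ := mul_pos (pow_pos (by linarith) 2) hDf
    nlinarith
  have hbij : BijOn f G (ball 0 1) := ⟨hmaps, hinj, hsurj⟩
  have hinv : InvOn (Function.invFunOn f G) f G (ball 0 1) := hbij.invOn_invFunOn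
  refine ⟨Function.invFunOn f G, fun w hw => ?_, hinv.symm.bijOn ?_ hmaps⟩
  · obtain ⟨z, hz, rfl⟩ := hsurj hw
    exact (differentiableAt_of_leftInvOn hG hfd hinv.1 hz).differentiableWithinAt
  · intro w hw
    exact Function.invFunOn_mem (hsurj hw)

/-! ### Carathéodory's theorem -/

open MeasureTheory in
-- The real Jacobian of a holomorphic map is |F'|², so this is the change of variables formula.
lemma lintegral_enorm_deriv_sq {S : Set ℂ} (hS : IsOpen S) {F : ℂ → ℂ}
    (hF : DifferentiableOn ℂ F S) (hi : InjOn F S) :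
    ∫⁻ w in S, ‖deriv F w‖ₑ ^ 2 = volume (F '' S) := by
  rw [← lintegral_abs_det_fderiv_eq_addHaar_image volume hS.measurableSet
    (f' := fun w => deriv F w • (1 : ℂ →L[ℝ] ℂ)) (fun w hw =>
    ((hF.differentiableAt (hS.mem_nhds hw)).hasDerivAt.complexToReal_fderiv).hasFDerivWithinAt) hi]
  congr 1 with w
  have e : ((deriv F w • (1 : ℂ →L[ℝ] ℂ) : ℂ →L[ℝ] ℂ) : ℂ →ₗ[ℝ] ℂ) = Algebra.lmul ℝ ℂ (deriv F w) := by
    ext; simp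
  rw [ContinuousLinearMap.det, e, ← Algebra.norm_apply, Algebra.norm_complex_apply,
    normSq_eq_norm_sq, abs_of_nonneg (by positivity), ENNReal.ofReal_pow (norm_nonneg _),
    ofReal_norm]

open MeasureTheory in
lemma exists_lt_of_lintegral_lt_top {I : ℝ → ENNReal} (hI : ∫⁻ x in Ioi 0, I x < ⊤)
    {c : ENNReal} (hc : 0 < c) : ∃ x > 0, I x < c := by
  by_contra! h
  refine hI.ne (top_unique ?_)
  calc (⊤ : ENNReal) = ∫⁻ _ in Ioi (0 : ℝ), c := by
        rw [setLIntegral_const, Real.volume_Ioi, ENNReal.mul_top hc.ne']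
    _ ≤ _ := setLIntegral_mono' measurableSet_Ioi fun x hx => h x hx

open MeasureTheory in
/-- An injective holomorphic function with bounded image on a strip maps some cross-section to
a curve of small diameter. -/
lemma exists_short_segment {a : ℝ} (ha : 0 < a) {F : ℂ → ℂ}
    (hF : DifferentiableOn ℂ F {w | |w.im| < a}) (hi : InjOn F {w | |w.im| < a})
    (hb : Bornology.IsBounded (F '' {w | |w.im| < a})) {ε : ℝ} (hε : 0 < ε) :
    ∃ x > 0, ∀ w w' : ℂ, w.re = x → w'.re = x → |w.im| < a → |w'.im| < a →
      ‖F w - F w'‖ ≤ ε := by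
  set S : Set ℂ := {w | |w.im| < a} with hSdef
  have hS : IsOpen S := isOpen_lt (by fun_prop) continuous_const
  set g : ℂ → ENNReal := S.indicator fun w => ‖deriv F w‖ₑ ^ 2 with hg
  have hdc : ContinuousOn (deriv F) S := (hF.deriv hS).continuousOn
  have hgm : Measurable g := by
    have : Measurable (S.indicator (deriv F)) :=
      (hdc.measurable_piecewise (g := 0) continuousOn_const hS.measurableSet)
    have h2 : g = fun w => ‖S.indicator (deriv F) w‖ₑ ^ 2 := by
      ext w
      by_cases hw : w ∈ S <;> simp [hg, hw]
    rw [h2]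
    exact this.enorm.pow_const 2
  have hfin : ∫⁻ w, g w < ⊤ := by
    rw [hg, lintegral_indicator hS.measurableSet, lintegral_enorm_deriv_sq hS hF hi]
    exact hb.measure_lt_top
  have hfub : ∫⁻ w, g w = ∫⁻ x : ℝ, ∫⁻ y : ℝ, g ⟨x, y⟩ := by
    rw [← volume_preserving_equiv_real_prod.symm.lintegral_comp_emb
      measurableEquivRealProd.symm.measurableEmbedding, Measure.volume_eq_prod, lintegral_prod]
    · rfl
    · exact (hgm.comp measurableEquivRealProd.symm.measurable).aemeasurable
  -- The length-area argument: the total energy is finite and the half-strip infinitely long, so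
  -- some cross-section has energy below sε/2. In b ≤ s + b²/s the first term then contributes at
  -- most 2as = ε/2, and the second at most ε/2.
  set s : ℝ := ε / (4 * a) with hs
  have hs0 : 0 < s := by positivity
  obtain ⟨x, hx0, hx⟩ := exists_lt_of_lintegral_lt_top (I := fun x => ∫⁻ y : ℝ, g ⟨x, y⟩)
    (((setLIntegral_le_lintegral _ _).trans hfub.ge).trans_lt hfin)
    (c := ENNReal.ofReal (s * (ε / 2))) (by rw [ENNReal.ofReal_pos]; positivity)
  refine ⟨x, hx0, ?_⟩
  have main : ∀ y₁ y₂ : ℝ, |y₁| < a → |y₂| < a → y₁ ≤ y₂ →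
      ‖F ⟨x, y₂⟩ - F ⟨x, y₁⟩‖ ≤ ε := by
    intro y₁ y₂ h₁ h₂ h12
    have hseg : ∀ y ∈ Icc y₁ y₂, (⟨x, y⟩ : ℂ) ∈ S := fun y hy =>
      abs_lt.2 ⟨(abs_lt.1 h₁).1.trans_le hy.1, hy.2.trans_lt (abs_lt.1 h₂).2⟩
    have hline : ∀ y : ℝ, HasDerivAt (fun y : ℝ => (⟨x, y⟩ : ℂ)) I y := by
      intro y
      have h3 : HasDerivAt (fun y : ℝ => (x : ℂ) + (y : ℂ) * I) (1 * I) y :=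
        (((hasDerivAt_id y).ofReal_comp).mul_const I).const_add (x : ℂ)
      rw [one_mul] at h3
      refine h3.congr_of_eventuallyEq (.of_forall fun y => ?_)
      apply Complex.ext <;> simp
    have hcl : Continuous fun y : ℝ => (⟨x, y⟩ : ℂ) :=
      continuous_iff_continuousAt.2 fun y => (hline y).continuousAt
    have hder : ∀ y ∈ uIcc y₁ y₂,
        HasDerivAt (fun y : ℝ => F ⟨x, y⟩) (deriv F ⟨x, y⟩ * I) y := by
      intro y hy
      rw [uIcc_of_le h12] at hy
      exact HasDerivAt.comp (h₂ := F) y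
        (hF.differentiableAt (hS.mem_nhds (hseg y hy))).hasDerivAt (hline y)
    have hint : IntervalIntegrable (fun y : ℝ => deriv F ⟨x, y⟩ * I) volume y₁ y₂ := by
      refine ContinuousOn.intervalIntegrable ?_
      rw [uIcc_of_le h12]
      exact (hdc.comp hcl.continuousOn hseg).mul continuousOn_const
    have hftc := intervalIntegral.integral_eq_sub_of_hasDerivAt hder hint
    rw [← hftc, intervalIntegral.integral_of_le h12]
    have hs' : ENNReal.ofReal s ≠ 0 := (ENNReal.ofReal_pos.2 hs0).ne'
    have hpt : ∀ b : ENNReal, b ≤ ENNReal.ofReal s + (ENNReal.ofReal s)⁻¹ * b ^ 2 := by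
      intro b
      rcases le_total b (ENNReal.ofReal s) with h | h
      · exact h.trans le_self_add
      · refine le_trans ?_ le_add_self
        calc b = (ENNReal.ofReal s)⁻¹ * (ENNReal.ofReal s * b) := by
              rw [← mul_assoc, ENNReal.inv_mul_cancel hs' ENNReal.ofReal_ne_top, one_mul]
          _ ≤ (ENNReal.ofReal s)⁻¹ * b ^ 2 := by rw [sq]; gcongr
    have hbd : ‖∫ y in Ioc y₁ y₂, deriv F ⟨x, y⟩ * I‖ₑ ≤ ENNReal.ofReal ε := by
      calc ‖∫ y in Ioc y₁ y₂, deriv F ⟨x, y⟩ * I‖ₑ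
          ≤ ∫⁻ y in Ioc y₁ y₂, ‖deriv F ⟨x, y⟩ * I‖ₑ := enorm_integral_le_lintegral_enorm _
        _ ≤ ∫⁻ y in Ioc y₁ y₂, (ENNReal.ofReal s + (ENNReal.ofReal s)⁻¹ * g ⟨x, y⟩) := by
            refine setLIntegral_mono' measurableSet_Ioc fun y hy => ?_
            have h3 : g ⟨x, y⟩ = ‖deriv F ⟨x, y⟩ * I‖ₑ ^ 2 := by
              rw [hg, indicator_of_mem (hseg y (Ioc_subset_Icc_self hy)), enorm_mul,
                ← ofReal_norm I, norm_I, ENNReal.ofReal_one, mul_one]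
            rw [h3]
            exact hpt _
        _ = ENNReal.ofReal s * volume (Ioc y₁ y₂) +
            (ENNReal.ofReal s)⁻¹ * ∫⁻ y in Ioc y₁ y₂, g ⟨x, y⟩ := by
            rw [lintegral_add_left measurable_const, setLIntegral_const,
              lintegral_const_mul _ (show Measurable fun y : ℝ => g ⟨x, y⟩ from
                hgm.comp hcl.measurable)]
        _ ≤ ENNReal.ofReal s * ENNReal.ofReal (2 * a) +
            (ENNReal.ofReal s)⁻¹ * ENNReal.ofReal (s * (ε / 2)) := by
            gcongr
            · rw [Real.volume_Ioc]
              exact ENNReal.ofReal_le_ofReal (by linarith [(abs_lt.1 h₁).1, (abs_lt.1 h₂).2])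
            · exact (setLIntegral_le_lintegral _ _).trans hx.le
        _ = ENNReal.ofReal ε := by
            rw [ENNReal.ofReal_mul hs0.le, ← mul_assoc,
              ENNReal.inv_mul_cancel hs' ENNReal.ofReal_ne_top, one_mul,
              ← ENNReal.ofReal_mul hs0.le, ← ENNReal.ofReal_add (by positivity) (by positivity)]
            congr 1
            rw [hs]
            field_simp
            ring
    rw [← ofReal_norm] at hbd
    exact (ENNReal.ofReal_le_ofReal_iff hε.le).1 hbd
  intro w w' hw hw' h h'
  have e : w = ⟨x, w.im⟩ := Complex.ext hw rfl
  have e' : w' = ⟨x, w'.im⟩ := Complex.ext hw' rfl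
  rw [e, e']
  rcases le_total w.im w'.im with hle | hle
  · rw [norm_sub_rev]
    exact main _ _ h h' hle
  · exact main _ _ h' h hle

/-- The exponential maps this strip into the right half-plane, whose points are nearer to 1 than to
-1. -/
lemma norm_exp_sub_one_lt {w : ℂ} (hw : |w.im| < Real.pi / 2) : ‖exp w - 1‖ < ‖exp w + 1‖ := by
  have hre : 0 < (exp w).re := by
    rw [exp_re]
    exact mul_pos (Real.exp_pos _) (Real.cos_pos_of_mem_Ioo (abs_lt.1 hw))
  refine lt_of_pow_lt_pow_left₀ 2 (norm_nonneg _) ?_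
  simp only [← normSq_eq_norm_sq, normSq_apply, sub_re, sub_im, add_re, add_im, one_re, one_im]
  nlinarith

/-- Every boundary point of the disk is cut off by a cross-cut whose image is small. -/
lemma exists_crosscut {f : ℂ → ℂ} (hf : DifferentiableOn ℂ f (ball 0 1)) (hi : InjOn f (ball 0 1))
    (hb : Bornology.IsBounded (f '' ball 0 1)) {ζ : ℂ} (hζ : ‖ζ‖ = 1) {ε : ℝ} (hε : 0 < ε) :
    ∃ t : ℂ → ℝ, Continuous t ∧ t 0 < 0 ∧ 0 < t ζ ∧
      (∀ z ∈ ball 0 1, ∀ w ∈ ball 0 1, t z = 0 → t w = 0 → ‖f z - f w‖ ≤ ε) ∧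
      ¬ IsCompact (ball 0 1 ∩ t ⁻¹' {0}) := by
  have hζ0 : ζ ≠ 0 := norm_pos_iff.1 (hζ ▸ one_pos)
  set S : Set ℂ := {w | |w.im| < Real.pi / 2} with hS
  have hlt : ∀ w ∈ S, ‖exp w - 1‖ < ‖exp w + 1‖ := fun w hw => norm_exp_sub_one_lt hw
  have hne : ∀ w ∈ S, exp w + 1 ≠ 0 := fun w hw =>
    norm_pos_iff.1 ((norm_nonneg _).trans_lt (hlt w hw))
  -- τ maps the strip onto the disk, with the end Re w = +∞ going to ζ. The cross-section Re w = x
  -- becomes the circular arc |ζ + z| = e^x |ζ - z|, which is the zero set of the function t chosen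
  -- below.
  set τ : ℂ → ℂ := fun w => ζ * ((exp w - 1) / (exp w + 1)) with hτ
  have hτm : MapsTo τ S (ball 0 1) := fun w hw => by
    rw [mem_ball_zero_iff, hτ]
    simp only
    rw [norm_mul, hζ, one_mul, norm_div, div_lt_one (norm_pos_iff.2 (hne w hw))]
    exact hlt w hw
  have hτd : DifferentiableOn ℂ τ S :=
    ((differentiableOn_id.cexp.sub_const 1).div
      (differentiableOn_id.cexp.add_const 1) hne).const_mul ζ
  have hτi : InjOn τ S := by
    intro w hw w' hw' h
    have h1 := mul_left_cancel₀ hζ0 h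
    have h2 := hne w hw
    have h3 := hne w' hw'
    rw [div_eq_div_iff h2 h3] at h1
    have h4 : exp w = exp w' := by linear_combination h1 / 2
    have hb1 := abs_lt.1 (show |w.im| < Real.pi / 2 from hw)
    have hb2 := abs_lt.1 (show |w'.im| < Real.pi / 2 from hw')
    have := Real.pi_pos
    rw [← log_exp (x := w) (by linarith) (by linarith), h4,
      log_exp (x := w') (by linarith) (by linarith)]
  obtain ⟨x, hx0, hx⟩ := exists_short_segment (F := f ∘ τ) (a := Real.pi / 2)
    (by positivity) (hf.comp hτd hτm) (hi.comp hτi hτm)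
    (hb.subset (by rw [image_comp]; exact image_mono hτm.image_subset)) hε
  refine ⟨fun z => ‖ζ + z‖ - Real.exp x * ‖ζ - z‖, by fun_prop, ?_, ?_, ?_, ?_⟩
  · simp only [add_zero, sub_zero, hζ, mul_one]
    linarith [Real.add_one_lt_exp hx0.ne']
  · show 0 < ‖ζ + ζ‖ - Real.exp x * ‖ζ - ζ‖
    rw [← two_mul, sub_self, norm_zero, mul_zero, sub_zero, norm_mul, hζ]
    norm_num
  · have hpre : ∀ z ∈ ball (0 : ℂ) 1, ‖ζ + z‖ - Real.exp x * ‖ζ - z‖ = 0 →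
        ∃ w ∈ S, w.re = x ∧ τ w = z := by
      intro z hz h0
      have hz1 : ‖z‖ < 1 := mem_ball_zero_iff.1 hz
      have hd : ζ - z ≠ 0 := fun h => by
        rw [sub_eq_zero.1 h] at hζ
        exact hz1.ne hζ
      have hu : 0 < ((ζ + z) / (ζ - z)).re := by
        have h1 : ((ζ + z) / (ζ - z)).re = (1 - ‖z‖ ^ 2) / normSq (ζ - z) := by
          have h2 : ‖ζ‖ ^ 2 = 1 := by rw [hζ, one_pow]
          rw [div_re, ← add_div, ← h2]
          congr 1
          simp only [← normSq_eq_norm_sq, normSq_apply, sub_re, sub_im, add_re, add_im]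
          ring
        rw [h1]
        refine div_pos ?_ (normSq_pos.2 hd)
        nlinarith [norm_nonneg z]
      have hu0 : (ζ + z) / (ζ - z) ≠ 0 := fun h => by rw [h, zero_re] at hu; exact lt_irrefl _ hu
      refine ⟨log ((ζ + z) / (ζ - z)), ?_, ?_, ?_⟩
      · rw [hS, mem_ofPred_eq, log_im]
        exact abs_arg_lt_pi_div_two_iff.2 (Or.inl hu)
      · have hdn : ‖ζ - z‖ ≠ 0 := norm_ne_zero_iff.2 hd
        rw [log_re, norm_div, sub_eq_zero.1 h0, mul_div_cancel_right₀ _ hdn, Real.log_exp]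
      · rw [hτ]
        simp only [exp_log hu0]
        have h3 : (ζ + z) / (ζ - z) - 1 = 2 * z / (ζ - z) := by field_simp; ring
        have h4 : (ζ + z) / (ζ - z) + 1 = 2 * ζ / (ζ - z) := by field_simp; ring
        rw [h3, h4]
        field_simp
    intro z hz w hw hz0 hw0
    obtain ⟨z', hz', hzx, rfl⟩ := hpre z hz hz0
    obtain ⟨w', hw', hwx, rfl⟩ := hpre w hw hw0
    exact hx z' w' hzx hwx hz' hw'
  -- The arc is not closed in the plane: its end, at height π/2 in the strip, lies on the unit
  -- circle.
  · intro hK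
    set u : ℝ → ℂ := fun y => τ (x + y * I) with hu
    have hmem : ∀ y ∈ Ioo 0 (Real.pi / 2),
        u y ∈ ball 0 1 ∩ (fun z => ‖ζ + z‖ - Real.exp x * ‖ζ - z‖) ⁻¹' {0} := by
      intro y hy
      have hyS : (x + y * I : ℂ) ∈ S := by
        rw [hS, mem_ofPred_eq]
        simp only [add_im, ofReal_im, mul_im, ofReal_re, I_im, mul_one, I_re, mul_zero, add_zero,
          zero_add]
        rw [abs_of_pos hy.1]
        exact hy.2
      refine ⟨hτm hyS, ?_⟩
      have h1 := hne _ hyS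
      have h3 : ζ + u y = 2 * ζ * exp (x + y * I) / (exp (x + y * I) + 1) := by
        rw [hu, hτ]; field_simp; ring
      have h4 : ζ - u y = 2 * ζ / (exp (x + y * I) + 1) := by
        rw [hu, hτ]; field_simp; ring
      rw [mem_preimage, mem_singleton_iff, h3, h4]
      simp only [norm_div, norm_mul, norm_exp]
      simp
      ring
    have hden : exp (x + (Real.pi / 2 : ℝ) * I) + 1 ≠ 0 := by
      intro h
      have := congrArg Complex.im h
      simp [exp_im] at this
    have hcont : ContinuousAt u (Real.pi / 2) := by
      rw [hu, hτ]
      refine continuousAt_const.mul (ContinuousAt.div (by fun_prop) (by fun_prop) hden)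
    have hlim : u (Real.pi / 2) ∈ ball (0 : ℂ) 1 := by
      refine (hK.isClosed.mem_of_tendsto (b := 𝓝[<] (Real.pi / 2))
        (hcont.tendsto.mono_left nhdsWithin_le_nhds) ?_).1
      filter_upwards [Ioo_mem_nhdsLT (show (0 : ℝ) < Real.pi / 2 by positivity)] with y hy
        using hmem y hy
    have e : exp (x + (Real.pi / 2 : ℝ) * I) = (Real.exp x : ℝ) * I := by
      push_cast
      rw [exp_add, exp_pi_div_two_mul_I]
    have hnorm : ‖u (Real.pi / 2)‖ = 1 := by
      have h5 : ‖exp (x + (Real.pi / 2 : ℝ) * I) - 1‖ = ‖exp (x + (Real.pi / 2 : ℝ) * I) + 1‖ := by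
        rw [e, ← sq_eq_sq₀ (norm_nonneg _) (norm_nonneg _)]
        simp [← normSq_eq_norm_sq, normSq_apply]
      rw [hu, hτ]
      simp only
      rw [norm_mul, hζ, one_mul, norm_div, h5, div_self (norm_ne_zero_iff.2 hden)]
    rw [mem_ball_zero_iff, hnorm] at hlim
    exact lt_irrefl _ hlim

/-- Small subsets of a Jordan curve are contained in small subarcs. -/
lemma exists_small_arc {γ : Circle → ℂ} (hγ : Continuous γ) (hi : Function.Injective γ) {ε : ℝ}
    (hε : 0 < ε) : ∃ δ > 0, ∀ D ⊆ range γ, D.Nonempty → (∀ x ∈ D, ∀ y ∈ D, dist x y < δ) →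
      ∃ J ⊆ range γ, IsCompact J ∧ IsPreconnected J ∧ D ⊆ J ∧
        ∀ x ∈ J, ∀ y ∈ J, dist x y ≤ ε := by
  have hemb := (hγ.isClosedEmbedding hi).isEmbedding
  -- Each point of the curve has a neighbourhood O that the curve meets only inside one short arc; δ
  -- is a Lebesgue number of this cover.
  have hloc : ∀ t : Circle, ∃ N O, IsCompact N ∧ IsPreconnected N ∧ IsOpen O ∧ γ t ∈ O ∧
      (∀ s, γ s ∈ O → s ∈ N) ∧ ∀ s ∈ N, dist (γ s) (γ t) ≤ ε / 2 := by
    intro t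
    obtain ⟨θ, rfl⟩ := Circle.exp_surjective t
    have hc : Continuous fun s : ℝ => γ (Circle.exp s) := hγ.comp Circle.exp.continuous
    obtain ⟨r, hr, hball⟩ := Metric.nhds_basis_closedBall.mem_iff.1
      (hc.continuousAt.preimage_mem_nhds (closedBall_mem_nhds (γ (Circle.exp θ)) (half_pos hε)))
    have hnh : Circle.exp '' closedBall θ r ∈ 𝓝 (Circle.exp θ) :=
      isLocalHomeomorph_circleExp.isOpenMap.image_mem_nhds (closedBall_mem_nhds θ hr)
    rw [hemb.nhds_eq_comap, mem_comap] at hnh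
    obtain ⟨V, hV, hVN⟩ := hnh
    obtain ⟨O, hOV, hO, hmem⟩ := _root_.mem_nhds_iff.1 hV
    refine ⟨_, O, (isCompact_closedBall θ r).image Circle.exp.continuous,
      (convex_closedBall θ r).isPreconnected.image _ Circle.exp.continuous.continuousOn, hO, hmem,
      fun s hs => hVN (hOV hs), ?_⟩
    rintro _ ⟨s, hs, rfl⟩
    exact hball hs
  choose N O hNc hNp hO hmem hON hNd using hloc
  obtain ⟨δ, hδ, hleb⟩ := lebesgue_number_lemma_of_metric (isCompact_range hγ) hO (by
    rintro _ ⟨t, rfl⟩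
    exact mem_iUnion.2 ⟨t, hmem t⟩)
  refine ⟨δ, hδ, fun D hD ⟨x, hx⟩ hDd => ?_⟩
  obtain ⟨t, ht⟩ := hleb x (hD hx)
  refine ⟨γ '' N t, image_subset_range _ _, (hNc t).image hγ,
    (hNp t).image _ hγ.continuousOn, fun y hy => ?_, ?_⟩
  · obtain ⟨s, rfl⟩ := hD hy
    exact ⟨s, hON t s (ht (hDd _ hy x hx)), rfl⟩
  · rintro _ ⟨s, hs, rfl⟩ _ ⟨s', hs', rfl⟩
    have := dist_triangle_right (γ s) (γ s') (γ t)
    linarith [hNd t s hs, hNd t s' hs']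

lemma frontier_connectedComponentIn_subset {U : Set ℂ} (hU : IsOpen U) (w : ℂ) :
    frontier (connectedComponentIn U w) ⊆ Uᶜ := by
  intro x hx hxU
  have ho := hU.connectedComponentIn (x := w)
  rw [ho.frontier_eq] at hx
  obtain ⟨y, hy, hyw⟩ := mem_closure_iff.1 hx.1 _ hU.connectedComponentIn
    (mem_connectedComponentIn hxU)
  apply hx.2
  rw [connectedComponentIn_eq hyw, ← connectedComponentIn_eq hy]
  exact mem_connectedComponentIn hxU

lemma IsPreconnected.subset_of_disjoint_frontier {X : Type*} [TopologicalSpace X] {W G : Set X}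
    (hW : IsPreconnected W) (hd : Disjoint W (frontier G)) (hne : (W ∩ G).Nonempty) : W ⊆ G := by
  refine (hW.subset_left_of_subset_union isOpen_interior isClosed_closure.isOpen_compl
    (disjoint_compl_right.mono_left (interior_subset.trans subset_closure)) ?_ ?_).trans
    interior_subset
  · intro x hx
    by_cases h : x ∈ closure G
    · left
      by_contra h'
      exact Set.disjoint_left.1 hd hx ⟨h, h'⟩
    · exact Or.inr h
  · obtain ⟨x, hx, hxG⟩ := hne
    refine ⟨x, hx, ?_⟩
    by_contra h'
    exact Set.disjoint_left.1 hd hx ⟨subset_closure hxG, h'⟩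

/-- N₁ and N₂ are the sides of the cross-cut C₀, and J is a boundary arc joining its ends. Suppose w
∈ N₂ is outside the ball. The set C₀ ∪ J does not separate w from w₀, as both lie outside a ball
containing it; ∂G does not either, as both lie in G. The intersection J is connected, so the
logarithms glue over the union. But the component of w off the union stays in N₂, away from w₀, and
there a zero at w excludes a logarithm on the boundary. -/
lemma subset_closedBall_of_crosscut {G N₁ N₂ C₀ J : Set ℂ} (hGc : IsPreconnected G)
    (hGo : IsOpen G) (hGb : Bornology.IsBounded G) (hN₁ : IsOpen N₁) (hN₂ : IsOpen N₂)
    (hd : Disjoint N₁ N₂) (hN₁G : N₁ ⊆ G) (hN₂G : N₂ ⊆ G) (hGN : G ⊆ N₁ ∪ N₂ ∪ C₀)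
    (hC₀ : IsCompact C₀) (hJ : IsCompact J) (hJ' : IsPreconnected J) (hJG : J ⊆ frontier G)
    (hCJ : C₀ ∩ frontier G ⊆ J) {a : ℂ} {ε : ℝ} (hCa : C₀ ∪ J ⊆ closedBall a ε) {w₀ : ℂ}
    (hw₀ : w₀ ∈ N₁) (hw₀a : w₀ ∉ closedBall a ε) : N₂ ⊆ closedBall a ε := by
  intro w hw
  by_contra hwa
  have hfr : Disjoint G (frontier G) := (disjoint_frontier_iff_isOpen.2 hGo).symm
  set K := C₀ ∪ J ∪ frontier G with hK
  have hCJc : IsClosed (C₀ ∪ J) := (hC₀.union hJ).isClosed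
  have hKc : IsClosed K := hCJc.union isClosed_frontier
  have hlog : HasLogOn (fun z => (z - w) / (z - w₀)) K := by
    refine HasLogOn.union hCJc isClosed_frontier ?_ ?_ ?_
    · have : (C₀ ∪ J) ∩ frontier G = J := by
        rw [union_inter_distrib_right, inter_eq_left.2 hJG, union_eq_right.2 hCJ]
      rwa [this]
    · exact hasLogOn_div_of_isPreconnected hCJc (isPreconnected_compl_closedBall a ε)
        (disjoint_compl_left.mono_right hCa) hwa hw₀a
    · exact hasLogOn_div_of_isPreconnected isClosed_frontier hGc hfr (hN₂G hw) (hN₁G hw₀)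
  have hwK : w ∈ Kᶜ := by
    rintro (h | h)
    · exact hwa (hCa h)
    · exact Set.disjoint_left.1 hfr (hN₂G hw) h
  set W := connectedComponentIn Kᶜ w with hWdef
  have hWpre : IsPreconnected W := isPreconnected_connectedComponentIn
  have hWK : W ⊆ Kᶜ := connectedComponentIn_subset _ _
  have hwW : w ∈ W := mem_connectedComponentIn hwK
  have hWo : IsOpen W := hKc.isOpen_compl.connectedComponentIn
  have hWG : W ⊆ G := IsPreconnected.subset_of_disjoint_frontier hWpre
    (disjoint_left.2 fun x hx hxG => hWK hx (Or.inr hxG)) ⟨w, hwW, hN₂G hw⟩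
  have hWN : W ⊆ N₂ := by
    refine hWpre.subset_left_of_subset_union hN₂ hN₁ hd.symm (fun x hx => ?_) ⟨w, hwW, hw⟩
    rcases hGN (hWG hx) with (h | h) | h
    · exact Or.inr h
    · exact Or.inl h
    · exact absurd (Or.inl (Or.inl h)) (hWK hx)
  have hw₀W : w₀ ∉ closure W := fun h => by
    obtain ⟨y, hy, hyW⟩ := mem_closure_iff.1 h _ hN₁ hw₀
    exact Set.disjoint_left.1 hd hy (hWN hyW)
  have hne : ∀ z ∈ closure W, z - w₀ ≠ 0 := fun z hz h => hw₀W (sub_eq_zero.1 h ▸ hz)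
  refine not_hasLogOn_of_frontier_subset hKc hWo (hGb.subset hWG)
    (by simpa using frontier_connectedComponentIn_subset hKc.isOpen_compl w) hwW
    (v := fun z => (z - w₀)⁻¹) (ContinuousOn.inv₀ (by fun_prop) hne)
    (fun z hz => inv_ne_zero (hne z hz)) one_ne_zero (hlog.congr fun z _ => ?_)
  simp [div_eq_mul_inv]

/-- Near a boundary point of the disk, a Riemann map onto a Jordan domain takes values in a small
ball. -/
lemma exists_image_subset_closedBall {G : Set ℂ} (hGo : IsOpen G) (hGb : Bornology.IsBounded G)
    {γ : Circle → ℂ} (hγ : Continuous γ) (hγi : Function.Injective γ) (hγG : range γ = frontier G)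
    {f : ℂ → ℂ} (hf : DifferentiableOn ℂ f (ball 0 1)) (hfG : BijOn f (ball 0 1) G) {ζ : ℂ}
    (hζ : ‖ζ‖ = 1) {ε : ℝ} (hε : 0 < ε) :
    ∃ N ∈ 𝓝 ζ, ∃ a, f '' (ball 0 1 ∩ N) ⊆ closedBall a ε := by
  have h0 : (0 : ℂ) ∈ ball (0 : ℂ) 1 := by simp
  have hfr : Disjoint G (frontier G) := (disjoint_frontier_iff_isOpen.2 hGo).symm
  have hGc : IsPreconnected G := by
    rw [← hfG.image_eq]
    exact (convex_ball (0 : ℂ) 1).isPreconnected.image _ hf.continuousOn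
  have hFne : (frontier G).Nonempty := hγG ▸ range_nonempty γ
  have hd0 : 0 < infDist (f 0) (frontier G) :=
    (isClosed_frontier.notMem_iff_infDist_pos hFne).1
      (Set.disjoint_left.1 hfr (hfG.mapsTo h0))
  -- With ε₁ below the distance from f 0 to ∂G, the point f 0 stays outside the ball and marks the
  -- large side; with ε₂ < δ, the ends of the cross-cut fit into one short boundary arc.
  obtain ⟨ε₁, hε₁, hε₁'⟩ := exists_between (lt_min hε hd0)
  obtain ⟨δ, hδ, harc⟩ := exists_small_arc hγ hγi hε₁
  obtain ⟨ε₂, hε₂, hε₂'⟩ := exists_between (lt_min hε₁ hδ)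
  obtain ⟨t, ht, ht0, htζ, htQ, hQ⟩ := exists_crosscut hf hfG.injOn (hfG.image_eq ▸ hGb) hζ hε₂
  have hopen : ∀ s, IsOpen s → IsOpen (f '' (ball 0 1 ∩ s)) := by
    intro s hs
    rw [isOpen_iff_mem_nhds]
    rintro _ ⟨z, hz, rfl⟩
    exact isOpen_image_of_injOn isOpen_ball hf hfG.injOn hz.1 ((isOpen_ball.inter hs).mem_nhds hz)
  set Q := ball (0 : ℂ) 1 ∩ t ⁻¹' {0} with hQdef
  set N₁ := f '' (ball 0 1 ∩ t ⁻¹' Iio 0) with hN₁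
  set N₂ := f '' (ball 0 1 ∩ t ⁻¹' Ioi 0) with hN₂
  have hN₁o : IsOpen N₁ := hopen _ (isOpen_Iio.preimage ht)
  have hN₂o : IsOpen N₂ := hopen _ (isOpen_Ioi.preimage ht)
  have hdisj : ∀ s s' : Set ℝ, Disjoint s s' →
      Disjoint (f '' (ball 0 1 ∩ t ⁻¹' s)) (f '' (ball 0 1 ∩ t ⁻¹' s')) := by
    intro s s' h
    rw [Set.disjoint_left]
    rintro _ ⟨z, hz, rfl⟩ ⟨w, hw, he⟩
    rw [hfG.injOn hw.1 hz.1 he] at hw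
    exact Set.disjoint_left.1 h hz.2 hw.2
  have hsub : ∀ s : Set ℂ, f '' (ball 0 1 ∩ s) ⊆ G := fun s =>
    hfG.image_eq ▸ image_mono inter_subset_left
  set C₀ := closure (f '' Q) with hC₀
  have hC₀b : ∀ x ∈ C₀, ∀ y ∈ C₀, dist x y ≤ ε₂ := by
    have hQb : ∀ x ∈ f '' Q, ∀ y ∈ f '' Q, dist x y ≤ ε₂ := by
      rintro _ ⟨z, hz, rfl⟩ _ ⟨w, hw, rfl⟩
      rw [dist_eq_norm]
      exact htQ z hz.1 w hw.1 hz.2 hw.2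
    intro x hx y hy
    have h1 : C₀ ×ˢ C₀ ⊆ {p : ℂ × ℂ | dist p.1 p.2 ≤ ε₂} := by
      rw [hC₀, ← closure_prod_eq]
      exact closure_minimal (fun p hp => hQb _ hp.1 _ hp.2)
        (isClosed_le (by fun_prop) continuous_const)
    exact h1 (mk_mem_prod hx hy)
  have hC₀c : IsCompact C₀ := (hGb.subset (hsub _)).isCompact_closure
  have hC₀G : C₀ ⊆ closure G := closure_mono (hsub _)
  have hC₀Q : C₀ ∩ G ⊆ f '' Q := by
    rintro _ ⟨hx, hxG⟩
    obtain ⟨z, hz, rfl⟩ := hfG.surjOn hxG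
    rcases lt_trichotomy (t z) 0 with h | h | h
    · exact absurd hx (((hdisj {0} (Iio 0) (by simp)).closure_left hN₁o).le_bot
        ⟨·, mem_image_of_mem f ⟨hz, h⟩⟩)
    · exact mem_image_of_mem f ⟨hz, h⟩
    · exact absurd hx (((hdisj {0} (Ioi 0) (by simp)).closure_left hN₂o).le_bot
        ⟨·, mem_image_of_mem f ⟨hz, h⟩⟩)
  -- Were the closure of the image of the cross-cut inside G, it would be compact and pull back to
  -- Q, which is not compact.
  have hDne : (C₀ ∩ frontier G).Nonempty := by
    by_contra hD
    have hC₀G' : C₀ ⊆ G := fun x hx => by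
      by_contra h
      exact hD ⟨x, hx, hC₀G hx, fun h' => h (interior_subset h')⟩
    set k := Function.invFunOn f (ball 0 1) with hk
    have hkf : LeftInvOn k f (ball 0 1) := hfG.injOn.leftInvOn_invFunOn
    have hkc : ContinuousOn k C₀ := fun x hx => by
      obtain ⟨z, hz, rfl⟩ := hfG.surjOn (hC₀G' hx)
      exact (differentiableAt_of_leftInvOn isOpen_ball hf hkf hz).continuousAt.continuousWithinAt
    have : Q = k '' C₀ := by
      have h1 : C₀ = f '' Q := Subset.antisymm (fun x hx => hC₀Q ⟨hx, hC₀G' hx⟩) subset_closure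
      rw [h1, hkf.image_image' inter_subset_left]
    exact hQ (this ▸ hC₀c.image_of_continuousOn hkc)
  obtain ⟨J, hJG, hJc, hJp, hDJ, hJd⟩ := harc (C₀ ∩ frontier G) (hγG ▸ inter_subset_right) hDne
    fun x hx y hy => (hC₀b x hx.1 y hy.1).trans_lt (hε₂'.trans_le (min_le_right _ _))
  obtain ⟨a, haC, haG⟩ := hDne
  refine ⟨t ⁻¹' Ioi 0, (isOpen_Ioi.preimage ht).mem_nhds htζ, a,
    (?_ : N₂ ⊆ closedBall a ε₁).trans (closedBall_subset_closedBall
      (hε₁'.le.trans (min_le_left _ _)))⟩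
  refine subset_closedBall_of_crosscut hGc hGo hGb hN₁o hN₂o
    (hdisj _ _ (Set.disjoint_left.2 fun x h h' => lt_asymm (mem_Iio.1 h) (mem_Ioi.1 h'))) (hsub _) (hsub _) ?_ hC₀c hJc hJp
    (hγG ▸ hJG) hDJ ?_ (mem_image_of_mem f ⟨h0, ht0⟩) ?_
  · intro x hx
    obtain ⟨z, hz, rfl⟩ := hfG.surjOn hx
    rcases lt_trichotomy (t z) 0 with h | h | h
    · exact Or.inl (Or.inl (mem_image_of_mem f ⟨hz, h⟩))
    · exact Or.inr (subset_closure (mem_image_of_mem f ⟨hz, h⟩))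
    · exact Or.inl (Or.inr (mem_image_of_mem f ⟨hz, h⟩))
  · rintro x (hx | hx)
    · exact (hC₀b x hx a haC).trans (hε₂'.le.trans (min_le_left _ _))
    · exact hJd x hx a (hDJ ⟨haC, haG⟩)
  · rw [mem_closedBall, not_le]
    exact (hε₁'.trans_le (min_le_right _ _)).trans_le (infDist_le_dist_of_mem haG)

/-- The continuous extension of a Riemann map onto a Jordan domain. -/
lemma exists_continuousOn_closedBall {G : Set ℂ} (hGo : IsOpen G) (hGb : Bornology.IsBounded G)
    {γ : Circle → ℂ} (hγ : Continuous γ) (hγi : Function.Injective γ) (hγG : range γ = frontier G)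
    {f : ℂ → ℂ} (hf : DifferentiableOn ℂ f (ball 0 1)) (hfG : BijOn f (ball 0 1) G) :
    ∃ F, ContinuousOn F (closedBall 0 1) ∧ EqOn F f (ball 0 1) ∧
      MapsTo F (sphere 0 1) (frontier G) ∧ F '' closedBall 0 1 = closure G := by
  have hcl : closure (ball (0 : ℂ) 1) = closedBall 0 1 := closure_ball _ one_ne_zero
  have hfr : Disjoint G (frontier G) := (disjoint_frontier_iff_isOpen.2 hGo).symm
  have hin : ∀ z ∈ ball (0 : ℂ) 1, Tendsto f (𝓝[ball 0 1] z) (𝓝 (f z)) := fun z hz =>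
    hf.continuousOn z hz
  have hlim : ∀ ζ ∈ closedBall (0 : ℂ) 1, ∃ a, Tendsto f (𝓝[ball 0 1] ζ) (𝓝 a) := by
    intro ζ hζ
    rcases (mem_closedBall_zero_iff.1 hζ).lt_or_eq with h | h
    · exact ⟨f ζ, hin ζ (mem_ball_zero_iff.2 h)⟩
    have : (𝓝[ball 0 1] ζ).NeBot := mem_closure_iff_nhdsWithin_neBot.1 (hcl ▸ hζ)
    refine cauchy_map_iff_exists_tendsto.1 (Metric.cauchy_iff.2 ⟨inferInstance, fun ε hε => ?_⟩)
    obtain ⟨N, hN, a, ha⟩ := exists_image_subset_closedBall hGo hGb hγ hγi hγG hf hfG h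
      (show (0 : ℝ) < ε / 3 by positivity)
    refine ⟨f '' (ball 0 1 ∩ N), image_mem_map (inter_mem self_mem_nhdsWithin
      (mem_nhdsWithin_of_mem_nhds hN)), fun x hx y hy => ?_⟩
    have := dist_triangle_right x y a
    linarith [mem_closedBall.1 (ha hx), mem_closedBall.1 (ha hy)]
  set F := extendFrom (ball 0 1) f with hF
  have hFc : ContinuousOn F (closedBall 0 1) := continuousOn_extendFrom hcl.ge hlim
  have hFf : EqOn F f (ball 0 1) := fun z hz => extendFrom_eq (hcl ▸ ball_subset_closedBall hz)
    (hin z hz)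
  have himg : F '' closedBall 0 1 = closure G := by
    refine Subset.antisymm ?_ (closure_minimal ?_
      ((isCompact_closedBall 0 1).image_of_continuousOn hFc).isClosed)
    · have h1 := (hcl ▸ hFc).image_closure
      rwa [hcl, hFf.image_eq, hfG.image_eq] at h1
    · rw [← hfG.image_eq, ← hFf.image_eq]
      exact image_mono ball_subset_closedBall
  refine ⟨F, hFc, hFf, fun ζ hζ => ?_, himg⟩
  have hζ' := sphere_subset_closedBall hζ
  have h1 : F ζ ∈ closure G := himg ▸ mem_image_of_mem F hζ'
  rw [hGo.frontier_eq]
  refine ⟨h1, fun h2 => ?_⟩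
  obtain ⟨z, hz, hzζ⟩ := hfG.surjOn h2
  -- If F ζ were in G, continuity of the inverse at F ζ would make points tending to ζ tend to a
  -- point of the open disk.
  set k := Function.invFunOn f (ball 0 1) with hk
  have hkf : LeftInvOn k f (ball 0 1) := hfG.injOn.leftInvOn_invFunOn
  have hkc : ContinuousAt k (F ζ) :=
    hzζ ▸ (differentiableAt_of_leftInvOn isOpen_ball hf hkf hz).continuousAt
  have : (𝓝[ball 0 1] ζ).NeBot := mem_closure_iff_nhdsWithin_neBot.1 (hcl ▸ hζ')
  have h3 : Tendsto f (𝓝[ball 0 1] ζ) (𝓝 (F ζ)) :=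
    ((hFc ζ hζ').mono_left (nhdsWithin_mono _ ball_subset_closedBall)).congr'
      (eventually_nhdsWithin_of_forall hFf)
  have h4 : Tendsto (fun x => x) (𝓝[ball 0 1] ζ) (𝓝 (k (F ζ))) :=
    (hkc.tendsto.comp h3).congr' (eventually_nhdsWithin_of_forall hkf)
  have h5 := tendsto_nhds_unique h4 (tendsto_id.mono_left nhdsWithin_le_nhds)
  rw [← hzζ, hkf hz] at h5
  rw [h5] at hz
  exact (mem_ball_zero_iff.1 hz).ne (mem_sphere_zero_iff_norm.1 hζ)

/-! ### Boundary injectivity in Carathéodory's theorem -/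

/-- A holomorphic function on the disk, continuous up to the boundary, that is constant on a
boundary arc takes the same value at the centre. -/
lemma apply_zero_eq_of_eqOn_arc {F : ℂ → ℂ} (hFc : ContinuousOn F (closedBall 0 1))
    (hF : DifferentiableOn ℂ F (ball 0 1)) {V : Set ℂ} (hV : IsOpen V) {ξ a : ℂ} (hξ : ‖ξ‖ = 1)
    (hξV : ξ ∈ V) (hFV : ∀ z ∈ sphere 0 1, z ∈ V → F z = a) : F 0 = a := by
  obtain ⟨η, hη⟩ : ∃ η : Circle, (η : ℂ) = ξ := ⟨⟨ξ, mem_sphere_zero_iff_norm.2 hξ⟩, rfl⟩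
  -- Finitely many rotations of the arc cover the circle. The product of the rotated functions F - a
  -- vanishes on the circle, hence at 0 by the maximum principle, and every factor takes the value F
  -- 0 - a there.
  obtain ⟨T, hT⟩ := isCompact_univ.elim_finite_subcover
    (fun ω : Circle => {z : Circle | (ω * z : ℂ) ∈ V})
    (fun ω => hV.preimage (by fun_prop)) (fun z _ => by
      refine mem_iUnion.2 ⟨η * z⁻¹, ?_⟩
      change ((η * z⁻¹ : Circle) * z : ℂ) ∈ V
      rwa [← Circle.coe_mul, inv_mul_cancel_right, hη])
  have hrot : ∀ ω : Circle, MapsTo (fun z : ℂ => ω * z) (closedBall 0 1) (closedBall 0 1) := by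
    intro ω z hz
    simpa [Circle.norm_coe] using hz
  have hrot' : ∀ ω : Circle, MapsTo (fun z : ℂ => ω * z) (ball 0 1) (ball 0 1) := by
    intro ω z hz
    simpa [Circle.norm_coe] using hz
  set P : ℂ → ℂ := fun z => ∏ ω ∈ T, (F (ω * z) - a) with hP
  have hPd : DiffContOnCl ℂ P (ball 0 1) := by
    constructor
    · refine DifferentiableOn.fun_finsetProd fun ω _ => ?_
      exact (hF.comp (by fun_prop) (hrot' ω)).sub_const a
    · rw [closure_ball _ one_ne_zero]
      exact continuousOn_finsetProd _ fun ω _ =>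
        (hFc.comp (by fun_prop) (hrot ω)).sub continuousOn_const
  have hP0 : ‖P 0‖ ≤ 0 := by
    refine Complex.norm_le_of_forall_mem_frontier_norm_le isBounded_ball hPd (fun z hz => ?_)
      (subset_closure (by simp))
    rw [frontier_ball _ one_ne_zero] at hz
    obtain ⟨ω, hω, hωz⟩ := mem_iUnion₂.1 (hT (mem_univ (⟨z, hz⟩ : Circle)))
    rw [hP, norm_le_zero_iff]
    refine Finset.prod_eq_zero hω ?_
    rw [sub_eq_zero]
    exact hFV _ (by simpa [Circle.norm_coe] using hz) hωz
  obtain ⟨ω, -, hω⟩ := Finset.prod_eq_zero_iff.1 (norm_le_zero_iff.1 hP0)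
  simpa [sub_eq_zero] using hω

/-- The image of the part of the disk on one side of a line is connected. It clings to Γ \ {a},
because F cannot be constantly a on the boundary arc of that side. Replacing d by -d gives the other
side. -/
lemma isPreconnected_image_union_of_arc {F : ℂ → ℂ} (hFc : ContinuousOn F (closedBall 0 1))
    (hF : DifferentiableOn ℂ F (ball 0 1)) {Γ : Set ℂ} {a : ℂ} (hFΓ : MapsTo F (sphere 0 1) Γ)
    (hΓ : IsPreconnected (Γ \ {a})) (h0 : F 0 ≠ a) {c d : ℂ} (hc : ‖c‖ < 1) (hd : d ≠ 0) :
    IsPreconnected (F '' (ball 0 1 ∩ {z | 0 < ((z - c) / d).im}) ∪ Γ \ {a}) := by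
  set V := {z : ℂ | 0 < ((z - c) / d).im} with hV
  have hVo : IsOpen V := isOpen_lt continuous_const (by fun_prop)
  have hVc : Convex ℝ V := by
    have h1 : IsLinearMap ℝ fun z : ℂ => (z / d).im :=
      ⟨fun x y => by simp [add_div], fun r x => by
        rw [real_smul, mul_div_assoc, im_ofReal_mul, smul_eq_mul]⟩
    have h2 : V = {z : ℂ | (c / d).im < (z / d).im} := by
      ext z
      simp [hV, sub_div]
    exact h2 ▸ convex_halfSpace_gt h1 _
  obtain ⟨ξ, hξ, hξV, hξa⟩ : ∃ ξ ∈ sphere (0 : ℂ) 1, ξ ∈ V ∧ F ξ ≠ a := by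
    by_contra! h
    have hd' : 0 < ‖d‖ := norm_pos_iff.2 hd
    -- The point i d/|d| of the circle lies deepest on the chosen side; it belongs to V because |c|
    -- < 1.
    refine h0 (apply_zero_eq_of_eqOn_arc hFc hF hVo (ξ := I * d / ‖d‖) ?_ ?_ h)
    · simp [hd]
    · have h1 : (I * d / ‖d‖ - c) / d = I * ((1 / ‖d‖ : ℝ) : ℂ) - c / d := by
        push_cast
        field_simp
      have h2 : (c / d).im < 1 / ‖d‖ := by
        refine (im_le_norm _).trans_lt ?_
        rw [norm_div]
        gcongr
      simp only [hV, mem_ofPred_eq, h1, sub_im, mul_im, I_re, I_im, ofReal_im, ofReal_re]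
      linarith
  have hξ' := sphere_subset_closedBall hξ
  have hsub : ball (0 : ℂ) 1 ∩ V ⊆ closedBall 0 1 := inter_subset_left.trans ball_subset_closedBall
  have h1 : IsPreconnected (F '' (ball 0 1 ∩ V)) :=
    ((convex_ball 0 1).inter hVc).isPreconnected.image _ (hFc.mono hsub)
  have h2 : ξ ∈ closure (ball (0 : ℂ) 1 ∩ V) := by
    rw [inter_comm]
    exact hVo.inter_closure ⟨hξV, by rwa [closure_ball _ one_ne_zero]⟩
  have h3 : F ξ ∈ closure (F '' (ball 0 1 ∩ V)) :=
    ((hFc ξ hξ').mono hsub).mem_closure_image h2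
  have h4 : IsPreconnected (insert (F ξ) (F '' (ball 0 1 ∩ V))) :=
    h1.subset_closure (subset_insert _ _) (insert_subset h3 subset_closure)
  have h5 : F ξ ∈ Γ \ {a} := ⟨hFΓ hξ, hξa⟩
  have h6 := h4.union (F ξ) (mem_insert _ _) h5 hΓ
  rwa [insert_union, insert_eq_of_mem (mem_union_right _ h5)] at h6

/-- Parameters ±1 give the endpoints of the chord, and the sign of x² - 1 tells the inside of the
disk from the outside. -/
lemma normSq_chord {ζ₁ ζ₂ : ℂ} (h₁ : normSq ζ₁ = 1) (h₂ : normSq ζ₂ = 1) (x : ℝ) :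
    normSq ((ζ₁ + ζ₂) / 2 + x * ((ζ₁ - ζ₂) / 2)) =
      1 + (x ^ 2 - 1) * normSq ((ζ₁ - ζ₂) / 2) := by
  simp only [normSq_apply] at *
  simp
  linear_combination (1 + x) / 2 * h₁ + (1 - x) / 2 * h₂

/-- If F identified ζ₁ and ζ₂, the image of their chord would be a union of two continua meeting
exactly in a and F c, hence would separate the plane. Its complement is nevertheless connected: it
consists of the images of the two half-disks, the exterior of G and the connected set ∂G \ {a}, to
which all the others are attached. -/
lemma injOn_sphere {G : Set ℂ} (hGo : IsOpen G) {γ : Circle → ℂ} (hγ : Continuous γ)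
    (hγi : Function.Injective γ) (hγG : range γ = frontier G)
    (hE : IsPreconnected (closure G)ᶜ) (hGE : frontier G ⊆ closure (closure G)ᶜ) {F : ℂ → ℂ}
    (hFc : ContinuousOn F (closedBall 0 1)) (hF : DifferentiableOn ℂ F (ball 0 1))
    (hFG : BijOn F (ball 0 1) G) (hFΓ : MapsTo F (sphere 0 1) (frontier G))
    (hFcl : F '' closedBall 0 1 = closure G) : InjOn F (sphere 0 1) := by
  intro ζ₁ h₁ ζ₂ h₂ he
  by_contra hne
  have hfr : Disjoint G (frontier G) := (disjoint_frontier_iff_isOpen.2 hGo).symm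
  set a := F ζ₁ with ha
  set c := (ζ₁ + ζ₂) / 2 with hc
  set d := (ζ₁ - ζ₂) / 2 with hd
  have hd0 : d ≠ 0 := div_ne_zero (sub_ne_zero.2 hne) two_ne_zero
  have hdp : 0 < normSq d := normSq_pos.2 hd0
  have haΓ : a ∈ frontier G := hFΓ h₁
  set ℓ : ℝ → ℂ := fun x => c + x * d with hℓ
  have hℓc : Continuous ℓ := by fun_prop
  have hn : ∀ x, ‖ℓ x‖ ^ 2 = 1 + (x ^ 2 - 1) * normSq d := fun x => by
    rw [← normSq_eq_norm_sq]
    exact normSq_chord (by rw [normSq_eq_norm_sq, mem_sphere_zero_iff_norm.1 h₁, one_pow])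
      (by rw [normSq_eq_norm_sq, mem_sphere_zero_iff_norm.1 h₂, one_pow]) x
  have hℓ1 : ℓ 1 = ζ₁ := by simp [hℓ, hc, hd]; ring
  have hℓ2 : ℓ (-1) = ζ₂ := by simp [hℓ, hc, hd]; ring
  have hℓs : ∀ x, ((ℓ x - c) / d).im = 0 := fun x => by simp [hℓ, hd0]
  have hℓb : ∀ x, -1 < x → x < 1 → ℓ x ∈ ball (0 : ℂ) 1 := fun x h h' => by
    rw [mem_ball_zero_iff, ← sq_lt_one_iff₀ (norm_nonneg _), hn]
    nlinarith [mul_pos (mul_pos (neg_lt_iff_pos_add.1 h) (sub_pos.2 h')) hdp]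
  have hℓcb : ∀ x ∈ Icc (-1 : ℝ) 1, ℓ x ∈ closedBall (0 : ℂ) 1 := fun x h => by
    rw [mem_closedBall_zero_iff, ← sq_le_one_iff₀ (norm_nonneg _), hn]
    nlinarith [mul_nonneg (mul_nonneg (neg_le_iff_add_nonneg.1 h.1) (sub_nonneg.2 h.2)) hdp.le]
  have hcb : c ∈ ball (0 : ℂ) 1 := by simpa [hℓ] using hℓb 0 (by norm_num) one_pos
  -- a point of the chord is mapped to the boundary only if it is an endpoint
  have hend : ∀ x ∈ Icc (-1 : ℝ) 1, F (ℓ x) ∈ frontier G → F (ℓ x) = a := by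
    intro x hx h
    rcases hx.1.eq_or_lt with h' | h'
    · rw [← h', hℓ2, he]
    rcases hx.2.eq_or_lt with h'' | h''
    · rw [h'', hℓ1]
    exact absurd h (Set.disjoint_left.1 hfr (hFG.mapsTo (hℓb x h' h'')))
  have hint : ∀ x ∈ Icc (-1 : ℝ) 1, ∀ z ∈ ball (0 : ℂ) 1, F (ℓ x) = F z → ℓ x = z := by
    intro x hx z hz h
    rcases (mem_closedBall_zero_iff.1 (hℓcb x hx)).lt_or_eq with h' | h'
    · exact hFG.injOn (mem_ball_zero_iff.2 h') hz h
    · exact absurd (h ▸ hFΓ (mem_sphere_zero_iff_norm.2 h'))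
        (Set.disjoint_left.1 hfr (hFG.mapsTo hz))
  have hI₁ : Icc (0 : ℝ) 1 ⊆ Icc (-1) 1 := Icc_subset_Icc_left (by norm_num)
  have hI₂ : Icc (-1 : ℝ) 0 ⊆ Icc (-1) 1 := Icc_subset_Icc_right (by norm_num)
  have hFℓ : ContinuousOn (F ∘ ℓ) (Icc (-1) 1) := hFc.comp hℓc.continuousOn hℓcb
  set A := (F ∘ ℓ) '' Icc 0 1 with hA
  set B := (F ∘ ℓ) '' Icc (-1) 0 with hB
  have hAB : A ∩ B = {a, F c} := by
    ext w
    constructor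
    · rintro ⟨⟨x, hx, rfl⟩, ⟨y, hy, hxy⟩⟩
      rcases hx.2.eq_or_lt with h | h
      · left
        simp [h, hℓ1, ha]
      · right
        have hxb := hℓb x (by linarith [hx.1]) h
        have h1 := hint y (hI₂ hy) _ hxb hxy
        have h2 : y = x := by simpa [hℓ, hd0] using h1
        have h3 : x = 0 := le_antisymm (h2 ▸ hy.2) hx.1
        simp [h3, hℓ]
    · rintro (rfl | rfl)
      · exact ⟨⟨1, by simp, by simp [hℓ1, ha]⟩, ⟨-1, by simp, by simp [hℓ2, he]⟩⟩
      · exact ⟨⟨0, by simp, by simp [hℓ]⟩, ⟨0, by simp, by simp [hℓ]⟩⟩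
  have hac : a ≠ F c := fun h => Set.disjoint_left.1 hfr (hFG.mapsTo hcb) (h ▸ haΓ)
  refine not_isPreconnected_compl_union (isCompact_Icc.image_of_continuousOn (hFℓ.mono hI₁))
    (isCompact_Icc.image_of_continuousOn (hFℓ.mono hI₂))
    (isPreconnected_Icc.image _ (hFℓ.mono hI₁)) (isPreconnected_Icc.image _ (hFℓ.mono hI₂))
    hac hAB ?_
  have hABeq : A ∪ B = (F ∘ ℓ) '' Icc (-1) 1 := by
    rw [hA, hB, ← image_union, union_comm, Icc_union_Icc_eq_Icc (by norm_num) (by norm_num)]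
  have haA : a ∈ A := (hAB.ge (mem_insert _ _)).1
  have hT : IsPreconnected (frontier G \ {a}) := by
    obtain ⟨t, ht⟩ := hγG.ge haΓ
    have : frontier G \ {a} = γ '' {t}ᶜ := by
      rw [← hγG, ← ht, ← image_singleton, ← image_univ, ← image_sdiff hγi, compl_eq_univ_sdiff]
    rw [this]
    exact (Circle.isPathConnected_compl_singleton t).isConnected.isPreconnected.image _
      hγ.continuousOn
  have h0 : F 0 ≠ a := fun h => Set.disjoint_left.1 hfr (hFG.mapsTo (by simp)) (h ▸ haΓ)
  have hcn := mem_ball_zero_iff.1 hcb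
  have hP := isPreconnected_image_union_of_arc hFc hF hFΓ hT h0 hcn hd0
  have hN := isPreconnected_image_union_of_arc hFc hF hFΓ hT h0 hcn (neg_ne_zero.2 hd0)
  have hEP : IsPreconnected ((closure G)ᶜ ∪ frontier G \ {a}) :=
    hE.subset_closure subset_union_left (union_subset subset_closure (sdiff_subset.trans hGE))
  obtain ⟨b, hb⟩ : (frontier G \ {a}).Nonempty := by
    obtain ⟨t, ht⟩ := hγG.ge haΓ
    obtain ⟨u, hu⟩ := (Circle.isPathConnected_compl_singleton t).nonempty
    exact ⟨γ u, hγG ▸ mem_range_self u, fun h => hu (hγi (h.trans ht.symm))⟩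
  -- All three pieces contain ∂G \ {a}, so any point b of it serves as the common point.
  have key := (hP.union b (Or.inr hb) (Or.inr hb) hN).union b (Or.inl (Or.inr hb)) (Or.inr hb) hEP
  convert key using 1
  rw [hABeq]
  ext w
  constructor
  · intro hw
    by_cases hwG : w ∈ closure G
    · obtain ⟨z, hz, rfl⟩ := hFcl.ge hwG
      rcases (mem_closedBall_zero_iff.1 hz).lt_or_eq with hz' | hz'
      · have hz'' := mem_ball_zero_iff.2 hz'
        rcases lt_trichotomy ((z - c) / d).im 0 with h | h | h
        · refine Or.inl (Or.inr (Or.inl ⟨z, ⟨hz'', ?_⟩, rfl⟩))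
          simpa [div_neg] using h
        · exfalso
          apply hw
          set x := ((z - c) / d).re
          have hx : ℓ x = z := by
            have : ((x : ℝ) : ℂ) = (z - c) / d := Complex.ext (by simp [x]) (by simp [h])
            simp only [hℓ, this]
            field_simp
            ring
          refine ⟨x, ?_, by simp [hx]⟩
          have := hn x
          rw [hx] at this
          rw [mem_Icc, ← abs_le, ← sq_le_one_iff_abs_le_one]
          by_contra! h'
          nlinarith [norm_nonneg z]
        · exact Or.inl (Or.inl (Or.inl ⟨z, ⟨hz'', h⟩, rfl⟩))
      · refine Or.inr (Or.inr ⟨hFΓ (mem_sphere_zero_iff_norm.2 hz'), fun h => hw ?_⟩)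
        exact ⟨1, by simp, by simpa [hℓ1] using h.symm⟩
    · exact Or.inr (Or.inl hwG)
  · rintro h ⟨x, hx, rfl⟩
    have hnT : F (ℓ x) ∉ frontier G \ {a} := fun h => h.2 (hend x hx h.1)
    rcases h with (((⟨z, ⟨hz, hzs⟩, h⟩ | h) | (⟨z, ⟨hz, hzs⟩, h⟩ | h)) | (h | h))
    · rw [← hint x hx z hz h.symm, mem_ofPred_eq, hℓs] at hzs
      exact lt_irrefl _ hzs
    · exact hnT h
    · rw [← hint x hx z hz h.symm, mem_ofPred_eq, div_neg, neg_im, hℓs, neg_zero] at hzs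
      exact lt_irrefl _ hzs
    · exact hnT h
    · exact h (hFcl ▸ mem_image_of_mem F (hℓcb x hx))
    · exact hnT h

/-- Carathéodory's theorem: a Riemann map onto a bounded Jordan domain extends to a homeomorphism
of the closures. -/
theorem exists_bijOn_closedBall {G : Set ℂ} (hGo : IsOpen G) (hGc : IsConnected G)
    (hGb : Bornology.IsBounded G) {γ : Circle → ℂ} (hγ : Continuous γ)
    (hγi : Function.Injective γ) (hγG : range γ = frontier G)
    (hE : IsPreconnected (closure G)ᶜ) (hGE : frontier G ⊆ closure (closure G)ᶜ) :
    ∃ F : ℂ → ℂ, ContinuousOn F (closedBall 0 1) ∧ DifferentiableOn ℂ F (ball 0 1) ∧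
      BijOn F (ball 0 1) G ∧ BijOn F (closedBall 0 1) (closure G) := by
  have hGE' : Gᶜ = (closure G)ᶜ ∪ frontier G := by
    rw [hGo.frontier_eq, sdiff_eq, union_inter_distrib_left, compl_union_self, univ_inter,
      union_eq_right.2 (compl_subset_compl.2 subset_closure)]
  obtain ⟨f, hf, hfG⟩ := exists_bijOn_ball hGo hGc hGb (by
    rw [hGE']
    exact hE.subset_closure subset_union_left (union_subset subset_closure hGE))
  obtain ⟨F, hFc, hFf, hFΓ, hFcl⟩ := exists_continuousOn_closedBall hGo hGb hγ hγi hγG hf hfG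
  have hF : DifferentiableOn ℂ F (ball 0 1) := hf.congr hFf
  have hFG : BijOn F (ball 0 1) G := hfG.congr hFf.symm
  have hfr : Disjoint G (frontier G) := (disjoint_frontier_iff_isOpen.2 hGo).symm
  refine ⟨F, hFc, hF, hFG, hFcl ▸ InjOn.bijOn_image ?_⟩
  rw [← ball_union_sphere, injOn_union sphere_disjoint_ball.symm]
  refine ⟨hFG.injOn, injOn_sphere hGo hγ hγi hγG hE hGE hFc hF hFG hFΓ hFcl, ?_⟩
  intro z hz w hw h
  exact Set.disjoint_left.1 hfr (hFG.mapsTo hz) (h ▸ hFΓ hw)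

/-! ### Holomorphic maps of the sphere -/

/-- The affine coordinate, with the junk value `0` at infinity. -/
def toC (x : Sphere) : ℂ := x.elim 0 id

@[simp] lemma toC_coe (z : ℂ) : toC (z : Sphere) = z := rfl

@[simp] lemma toC_infty : toC ∞ = 0 := rfl

lemma coe_toC {x : Sphere} (hx : x ≠ ∞) : ((toC x : ℂ) : Sphere) = x := by
  induction x using OnePoint.rec with
  | infty => exact absurd rfl hx
  | coe z => rfl

lemma eventually_coe_toC {x : Sphere} (hx : x ≠ ∞) : ∀ᶠ y in 𝓝 x, ((toC y : ℂ) : Sphere) = y :=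
  mem_of_superset (OnePoint.isClosed_infty.isOpen_compl.mem_nhds hx) fun _ => coe_toC

lemma continuousAt_toC {x : Sphere} (hx : x ≠ ∞) : ContinuousAt toC x := by
  rw [← coe_toC hx, OnePoint.continuousAt_coe]
  exact continuousAt_id

open Classical in
/-- The inversion `z ↦ 1 / z` of the sphere. -/
def inversion (x : Sphere) : Sphere := x.elim ((0 : ℂ) : Sphere) fun z => if z = 0 then ∞ else ((z⁻¹ : ℂ) : Sphere)

@[simp] lemma inversion_infty : inversion ∞ = ((0 : ℂ) : Sphere) := rfl

@[simp] lemma inversion_zero : inversion ((0 : ℂ) : Sphere) = ∞ := if_pos rfl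

lemma inversion_coe {z : ℂ} (hz : z ≠ 0) : inversion (z : Sphere) = ((z⁻¹ : ℂ) : Sphere) :=
  if_neg hz

@[simp] lemma inversion_inversion (x : Sphere) : inversion (inversion x) = x := by
  induction x using OnePoint.rec with
  | infty => simp
  | coe z =>
    rcases eq_or_ne z 0 with rfl | h
    · simp
    · rw [inversion_coe h, inversion_coe (inv_ne_zero h), inv_inv]

lemma continuous_inversion : Continuous inversion := by
  rw [continuous_iff_continuousAt]
  intro x
  induction x using OnePoint.rec with
  | infty =>
    rw [OnePoint.continuousAt_infty', coclosedCompact_eq_cocompact, ← Metric.cobounded_eq_cocompact]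
    refine ((OnePoint.continuous_coe.tendsto (0 : ℂ)).comp
      (tendsto_inv₀_cobounded (α := ℂ))).congr' ?_
    filter_upwards [Bornology.eventually_ne_cobounded (0 : ℂ)] with z hz
    exact (inversion_coe hz).symm
  | coe z =>
    rw [OnePoint.continuousAt_coe]
    rcases eq_or_ne z 0 with rfl | h
    · rw [continuousAt_iff_punctured_nhds]
      simp only [Function.comp, inversion_zero]
      have h1 := tendsto_inv₀_nhdsNE_zero (α := ℂ)
      rw [Metric.cobounded_eq_cocompact, ← coclosedCompact_eq_cocompact] at h1
      refine (OnePoint.tendsto_coe_infty.comp h1).congr' ?_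
      filter_upwards [self_mem_nhdsWithin] with z hz
      exact (inversion_coe hz).symm
    · refine ContinuousAt.congr (f := fun w : ℂ => ((w⁻¹ : ℂ) : Sphere))
        (OnePoint.continuous_coe.continuousAt.comp (continuousAt_inv₀ h)) ?_
      filter_upwards [isOpen_ne.mem_nhds h] with w hw
      exact (inversion_coe hw).symm

/-- The inversion as a homeomorphism. -/
def inversionHomeo : Sphere ≃ₜ Sphere where
  toFun := inversion
  invFun := inversion
  left_inv := inversion_inversion
  right_inv := inversion_inversion
  continuous_toFun := continuous_inversion
  continuous_invFun := continuous_inversion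

/-- The identity if `p` is finite, and the inversion if `p = ∞`. -/
def toFinite (p x : Sphere) : Sphere :=
  open Classical in if p = ∞ then inversion x else x

lemma toFinite_of_ne {p : Sphere} (hp : p ≠ ∞) : toFinite p = id := by
  ext1 x; simp [toFinite, hp]

lemma toFinite_infty : toFinite ∞ = inversion := by
  ext1 x; simp [toFinite]

lemma continuous_toFinite (p : Sphere) : Continuous (toFinite p) := by
  rcases eq_or_ne p ∞ with rfl | h
  · rw [toFinite_infty]; exact continuous_inversion
  · rw [toFinite_of_ne h]; exact continuous_id

@[simp] lemma toFinite_toFinite (p x : Sphere) : toFinite p (toFinite p x) = x := by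
  rcases eq_or_ne p ∞ with rfl | h
  · simp [toFinite_infty]
  · simp [toFinite_of_ne h]

lemma toFinite_self_ne (p : Sphere) : toFinite p p ≠ ∞ := by
  rcases eq_or_ne p ∞ with rfl | h
  · simp [toFinite_infty]
  · simpa [toFinite_of_ne h]

lemma param_eq (p : Sphere) (w : ℂ) : param p w = toFinite p w := by
  by_cases h : p = ∞ <;> simp [param, toFinite, h, inversion]

lemma coord_eq (p x : Sphere) : coord p x = toC (toFinite p x) := by
  by_cases h : p = ∞
  · subst h
    rw [toFinite_infty]
    induction x using OnePoint.rec with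
    | infty => simp [coord]
    | coe z =>
      rcases eq_or_ne z 0 with rfl | h
      · simp [coord]
      · simp [coord, inversion_coe h]
  · simp [coord, toFinite, h, toC]; rfl

/-- Both charts are the affine coordinate after `toFinite`, an involution of the sphere; in this
form the charts cancel when maps are composed. -/
lemma holomorphicAt_iff {F : Sphere → Sphere} {p : Sphere} :
    HolomorphicAt F p ↔ ContinuousAt F p ∧
      DifferentiableAt ℂ (fun w : ℂ => toC (toFinite (F p) (F (toFinite p w))))
        (toC (toFinite p p)) := by
  simp only [HolomorphicAt, coord_eq, param_eq]

lemma holomorphicAt_coe {F : Sphere → Sphere} {z : ℂ} (h : F z ≠ ∞) :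
    HolomorphicAt F z ↔ ContinuousAt F z ∧ DifferentiableAt ℂ (fun w : ℂ => toC (F w)) z := by
  simp [holomorphicAt_iff, toFinite_of_ne h, toFinite_of_ne (OnePoint.coe_ne_infty z)]

lemma holomorphicAt_coe_of_eventuallyEq {F : Sphere → Sphere} {f : ℂ → ℂ} {z : ℂ}
    (h : ∀ᶠ w : ℂ in 𝓝 z, F w = (f w : Sphere)) (hf : DifferentiableAt ℂ f z) :
    HolomorphicAt F z := by
  have hz : F z = f z := h.self_of_nhds
  rw [holomorphicAt_coe (hz ▸ OnePoint.coe_ne_infty _), OnePoint.continuousAt_coe]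
  exact ⟨(OnePoint.continuous_coe.continuousAt.comp hf.continuousAt).congr
    (h.mono fun w hw => hw.symm), hf.congr_of_eventuallyEq (h.mono fun w hw => by simp [hw])⟩

lemma tendsto_toFinite_coe (p : Sphere) :
    Tendsto (fun w : ℂ => toFinite p w) (𝓝 (toC (toFinite p p))) (𝓝 p) := by
  have := ((continuous_toFinite p).comp OnePoint.continuous_coe).tendsto (toC (toFinite p p))
  simpa [coe_toC (toFinite_self_ne p), Function.comp_def] using this

lemma HolomorphicAt.congr {F G : Sphere → Sphere} {p : Sphere} (hF : HolomorphicAt F p)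
    (h : F =ᶠ[𝓝 p] G) : HolomorphicAt G p := by
  rw [holomorphicAt_iff] at *
  refine ⟨hF.1.congr h, hF.2.congr_of_eventuallyEq ?_⟩
  filter_upwards [(tendsto_toFinite_coe p).eventually h] with w hw
  rw [hw, h.self_of_nhds]

lemma HolomorphicAt.comp {F G : Sphere → Sphere} {p : Sphere} (hG : HolomorphicAt G (F p))
    (hF : HolomorphicAt F p) : HolomorphicAt (G ∘ F) p := by
  rw [holomorphicAt_iff] at *
  refine ⟨hG.1.comp hF.1, ?_⟩
  have e : toC (toFinite (F p) (F (toFinite p (toC (toFinite p p) : ℂ)))) =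
      toC (toFinite (F p) (F p)) := by
    rw [coe_toC (toFinite_self_ne p), toFinite_toFinite]
  have h1 := DifferentiableAt.comp (toC (toFinite p p)) (e.symm ▸ hG.2) hF.2
  refine h1.congr_of_eventuallyEq ?_
  have h2 : Tendsto (fun w : ℂ => toFinite (F p) (F (toFinite p w))) (𝓝 (toC (toFinite p p)))
      (𝓝 (toFinite (F p) (F p))) :=
    ((continuous_toFinite _).tendsto _).comp (hF.1.tendsto.comp (tendsto_toFinite_coe p))
  filter_upwards [h2.eventually (eventually_coe_toC (toFinite_self_ne _))] with w hw
  simp only [Function.comp]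
  rw [hw, toFinite_toFinite]

lemma holomorphicAt_inversion (p : Sphere) : HolomorphicAt inversion p := by
  induction p using OnePoint.rec with
  | infty => simp [holomorphicAt_iff, toFinite_infty, continuous_inversion.continuousAt,
      toFinite_of_ne (OnePoint.coe_ne_infty (0 : ℂ)), differentiableAt_fun_id]
  | coe z =>
    rcases eq_or_ne z 0 with rfl | h
    · simp [holomorphicAt_iff, toFinite_infty, continuous_inversion.continuousAt,
        toFinite_of_ne (OnePoint.coe_ne_infty (0 : ℂ)), differentiableAt_fun_id]
    · refine holomorphicAt_coe_of_eventuallyEq ?_ (differentiableAt_inv h)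
      filter_upwards [eventually_ne_nhds h] with w hw
      exact inversion_coe hw

lemma holomorphicAt_toFinite (p x : Sphere) : HolomorphicAt (toFinite p) x := by
  rcases eq_or_ne p ∞ with rfl | h
  · rw [toFinite_infty]; exact holomorphicAt_inversion x
  · rw [toFinite_of_ne h, holomorphicAt_iff]
    refine ⟨continuousAt_id, ?_⟩
    simp only [id, toFinite_toFinite, toC_coe]
    exact differentiableAt_id

/-- The inversion as a Möbius transformation. -/
def inversionMatrix : GL (Fin 2) ℂ := Matrix.GeneralLinearGroup.mkOfDetNeZero !![0, 1; 1, 0] (by simp)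

lemma inversionMatrix_smul (x : Sphere) : inversionMatrix • x = inversion x := by
  induction x using OnePoint.rec with
  | infty => simp [inversionMatrix, OnePoint.smul_infty_eq_ite, Matrix.GeneralLinearGroup.mkOfDetNeZero]
  | coe z =>
    by_cases h : z = 0
    · subst h
      simp [inversionMatrix, OnePoint.smul_some_eq_ite, Matrix.GeneralLinearGroup.mkOfDetNeZero]
    · simp [inversionMatrix, OnePoint.smul_some_eq_ite, Matrix.GeneralLinearGroup.mkOfDetNeZero,
        inversion_coe h, h]

lemma holomorphicAt_smul (T : GL (Fin 2) ℂ) (p : Sphere) : HolomorphicAt (fun x => T • x) p := by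
  have key : ∀ (S : GL (Fin 2) ℂ) (z : ℂ), S • (z : Sphere) ≠ ∞ →
      HolomorphicAt (fun x => S • x) z := by
    intro S z h
    have hz : S 1 0 * z + S 1 1 ≠ 0 := fun h' => h (by rw [OnePoint.smul_some_eq_ite, if_pos h'])
    refine holomorphicAt_coe_of_eventuallyEq
      (f := fun w => (S 0 0 * w + S 0 1) / (S 1 0 * w + S 1 1)) ?_
      (by fun_prop (disch := exact hz))
    have hc : ContinuousAt (fun w : ℂ => S 1 0 * w + S 1 1) z := by fun_prop
    filter_upwards [hc.eventually_ne hz] with w hw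
    rw [OnePoint.smul_some_eq_ite, if_neg hw]
  -- Where the value is ∞, composing with the inversion gives a Möbius map with finite value; the
  -- point ∞ is then reached by precomposing with the inversion.
  have key' : ∀ (S : GL (Fin 2) ℂ) (z : ℂ), HolomorphicAt (fun x => S • x) z := by
    intro S z
    by_cases h : S • (z : Sphere) = ∞
    · have h1 : HolomorphicAt (fun x => (inversionMatrix * S) • x) z := key _ z (by
        rw [mul_smul, h, inversionMatrix_smul, inversion_infty]
        exact OnePoint.coe_ne_infty _)
      refine ((holomorphicAt_inversion _).comp h1).congr (Eventually.of_forall fun x => ?_)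
      simp [mul_smul, inversionMatrix_smul]
    · exact key S z h
  induction p using OnePoint.rec with
  | coe z => exact key' T z
  | infty =>
    have h1 := key' (T * inversionMatrix) 0
    rw [← inversion_infty] at h1
    refine (h1.comp (holomorphicAt_inversion ∞)).congr (Eventually.of_forall fun x => ?_)
    simp [mul_smul, inversionMatrix_smul]

/-- A Möbius transformation as a homeomorphism. -/
def smulHomeo (T : GL (Fin 2) ℂ) : Sphere ≃ₜ Sphere where
  toFun x := T • x
  invFun x := T⁻¹ • x
  left_inv := inv_smul_smul T
  right_inv := smul_inv_smul T
  continuous_toFun := continuous_iff_continuousAt.2 fun p => (holomorphicAt_smul T p).1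
  continuous_invFun := continuous_iff_continuousAt.2 fun p => (holomorphicAt_smul T⁻¹ p).1

lemma exists_smul_eq_infty (p : Sphere) : ∃ T : GL (Fin 2) ℂ, T • p = ∞ := by
  induction p using OnePoint.rec with
  | infty => exact ⟨1, one_smul _ _⟩
  | coe z =>
    refine ⟨Matrix.GeneralLinearGroup.mkOfDetNeZero !![0, 1; 1, -z] (by simp), ?_⟩
    simp [OnePoint.smul_some_eq_ite, Matrix.GeneralLinearGroup.mkOfDetNeZero]

/-- A map that is holomorphic on an open set `U` and injective there is locally a homeomorphism
with holomorphic inverse. -/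
lemma image_mem_nhds_and_holomorphicAt {F k : Sphere → Sphere} {U : Set Sphere} (hU : IsOpen U)
    (hF : ∀ p ∈ U, HolomorphicAt F p) (hk : LeftInvOn k F U) {p : Sphere} (hp : p ∈ U) :
    (∀ V ∈ 𝓝 p, F '' V ∈ 𝓝 (F p)) ∧ HolomorphicAt k (F p) := by
  set q := F p with hq
  -- Read in charts around p and q, F is a planar injective holomorphic map near z, to which the
  -- planar inverse theorem applies.
  set φ : Sphere → Sphere := toFinite q ∘ F ∘ toFinite p with hφ
  set z := toC (toFinite p p) with hz
  have hzp : toFinite p z = p := by rw [hz, coe_toC (toFinite_self_ne p), toFinite_toFinite]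
  have hφh : ∀ x, toFinite p x ∈ U → HolomorphicAt φ x := fun x hx =>
    (holomorphicAt_toFinite q _).comp ((hF _ hx).comp (holomorphicAt_toFinite p x))
  have hcp : Continuous fun w : ℂ => toFinite p w :=
    (continuous_toFinite p).comp OnePoint.continuous_coe
  have hφz : φ z ≠ ∞ := by
    simp only [hφ, Function.comp, hzp, ← hq]
    exact toFinite_self_ne q
  set U' : Set ℂ := {w : ℂ | toFinite p w ∈ U} with hU'
  have hU'o : IsOpen U' := hU.preimage hcp
  have hφc : ContinuousOn (fun w : ℂ => φ w) U' := fun w hw =>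
    ((hφh w hw).1.comp OnePoint.continuous_coe.continuousAt).continuousWithinAt
  set N : Set ℂ := U' ∩ (fun w : ℂ => φ w) ⁻¹' {∞}ᶜ with hN
  have hNo : IsOpen N := hφc.isOpen_inter_preimage hU'o OnePoint.isClosed_infty.isOpen_compl
  have hzN : z ∈ N := ⟨by simpa [hU', hzp] using hp, hφz⟩
  set f : ℂ → ℂ := fun w => toC (φ w) with hf
  have hfd : DifferentiableOn ℂ f N := fun w hw =>
    ((holomorphicAt_coe hw.2).1 (hφh w hw.1)).2.differentiableWithinAt
  set k' : ℂ → ℂ := fun w => toC (toFinite p (k (toFinite q w))) with hk'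
  have hkf : LeftInvOn k' f N := by
    intro w hw
    simp only [hk', hf]
    rw [coe_toC hw.2]
    simp only [hφ, Function.comp, toFinite_toFinite]
    rw [hk hw.1, toFinite_toFinite, toC_coe]
  have hfz : f z = toC (toFinite q q) := by simp only [hf, hφ, Function.comp, hzp, hq]
  have himg : ∀ V ∈ 𝓝 p, F '' V ∈ 𝓝 q := by
    intro V hV
    have h1 : (fun w : ℂ => toFinite p w) ⁻¹' V ∩ N ∈ 𝓝 z :=
      inter_mem (hcp.continuousAt (by simpa [hzp] using hV)) (hNo.mem_nhds hzN)
    have h2 := isOpen_image_of_injOn hNo hfd hkf.injOn hzN h1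
    have h3 : Tendsto (fun x => toC (toFinite q x)) (𝓝 q) (𝓝 (f z)) :=
      hfz ▸ (continuousAt_toC (toFinite_self_ne q)).tendsto.comp
        ((continuous_toFinite q).tendsto q)
    filter_upwards [h3 h2, ((continuous_toFinite q).tendsto q).eventually
      (eventually_coe_toC (toFinite_self_ne q))] with x ⟨w, hw, hwx⟩ hx
    refine ⟨toFinite p w, hw.1, ?_⟩
    have h4 : φ w = toFinite q x := by rw [← hx, ← show f w = toC (toFinite q x) from hwx, hf, coe_toC hw.2.2]
    have h5 := congrArg (toFinite q) h4
    simpa [hφ] using h5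
  refine ⟨himg, holomorphicAt_iff.2 ⟨fun V hV => ?_, ?_⟩⟩
  · rw [hk hp] at hV
    refine mem_map.2 (mem_of_superset (himg _ (inter_mem hV (hU.mem_nhds hp))) ?_)
    rintro _ ⟨x, hx, rfl⟩
    rw [mem_preimage, hk hx.2]
    exact hx.1
  · rw [hk hp, ← hfz]
    exact differentiableAt_of_leftInvOn hNo hfd hkf hzN

/-! ### Reflection in the unit circle -/

/-- Complex conjugation on the sphere. -/
def sphereConj : Sphere → Sphere := OnePoint.map (starRingEnd ℂ)

@[simp] lemma sphereConj_coe (z : ℂ) : sphereConj z = ((starRingEnd ℂ z : ℂ) : Sphere) := rfl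

@[simp] lemma sphereConj_infty : sphereConj ∞ = ∞ := rfl

@[simp] lemma sphereConj_sphereConj (x : Sphere) : sphereConj (sphereConj x) = x := by
  induction x using OnePoint.rec <;> simp

lemma continuous_sphereConj : Continuous sphereConj :=
  OnePoint.continuous_map Complex.continuous_conj
    (by
      rw [coclosedCompact_eq_cocompact]
      exact conjLIE.toHomeomorph.isClosedEmbedding.tendsto_cocompact)

lemma sphereConj_eq_infty {x : Sphere} : sphereConj x = ∞ ↔ x = ∞ := by
  induction x using OnePoint.rec <;> simp

lemma sphereConj_inversion (x : Sphere) : sphereConj (inversion x) = inversion (sphereConj x) := by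
  induction x using OnePoint.rec with
  | infty => simp
  | coe z =>
    rcases eq_or_ne z 0 with rfl | h
    · simp
    · rw [inversion_coe h, sphereConj_coe, sphereConj_coe, inversion_coe (by simpa using h), map_inv₀]

lemma toC_sphereConj (x : Sphere) : toC (sphereConj x) = starRingEnd ℂ (toC x) := by
  induction x using OnePoint.rec <;> simp

lemma sphereConj_toFinite (p x : Sphere) :
    sphereConj (toFinite p x) = toFinite (sphereConj p) (sphereConj x) := by
  by_cases h : p = ∞
  · simp [h, toFinite_infty, sphereConj_inversion]
  · rw [toFinite_of_ne h, toFinite_of_ne (mt sphereConj_eq_infty.1 h)]; rfl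

lemma HolomorphicAt.sphereConj_comp {F : Sphere → Sphere} {p : Sphere}
    (hF : HolomorphicAt F (sphereConj p)) : HolomorphicAt (sphereConj ∘ F ∘ sphereConj) p := by
  rw [holomorphicAt_iff] at *
  refine ⟨continuous_sphereConj.continuousAt.comp
    (hF.1.comp continuous_sphereConj.continuousAt), ?_⟩
  have h1 := hF.2
  rw [← sphereConj_toFinite, toC_sphereConj] at h1
  have h2 := h1.conj_conj
  rw [conj_conj] at h2
  refine h2.congr_of_eventuallyEq (Eventually.of_forall fun w => ?_)
  simp only [Function.comp, ← toC_sphereConj]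
  rw [sphereConj_toFinite]
  congr 4
  rw [sphereConj_toFinite, sphereConj_coe]

/-! ### Conformal maps with homeomorphic extension -/

variable {U V W : Set Sphere} {F G : Sphere → Sphere}

lemma IsConformalOntoWithExtension.comp (hG : IsConformalOntoWithExtension G V W)
    (hF : IsConformalOntoWithExtension F U V) : IsConformalOntoWithExtension (G ∘ F) U W :=
  ⟨⟨fun p hp => (hG.1.1 _ (hF.1.2.mapsTo hp)).comp (hF.1.1 p hp), hG.1.2.comp hF.1.2⟩,
    hG.2.1.comp hF.2.1 hF.2.2.mapsTo, hG.2.2.comp hF.2.2⟩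

lemma holomorphicAt_id (p : Sphere) : HolomorphicAt id p :=
  (holomorphicAt_smul 1 p).congr (Eventually.of_forall fun x => one_smul _ x)

lemma isConformalOntoWithExtension_id (U : Set Sphere) : IsConformalOntoWithExtension id U U :=
  ⟨⟨fun p _ => holomorphicAt_id p, bijOn_id U⟩, continuousOn_id, bijOn_id _⟩

/-- The inverse of a conformal map with homeomorphic extension. -/
lemma IsConformalOntoWithExtension.exists_inverse (hU : IsOpen U)
    (hF : IsConformalOntoWithExtension F U V) : ∃ G, IsConformalOntoWithExtension G V U ∧
      LeftInvOn G F (closure U) ∧ RightInvOn G F (closure V) := by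
  set G := Function.invFunOn F (closure U) with hG
  have hi : InvOn G F (closure U) (closure V) := hF.2.2.invOn_invFunOn
  have hb : BijOn G (closure V) (closure U) :=
    hi.symm.bijOn hF.2.2.surjOn.mapsTo_invFunOn hF.2.2.mapsTo
  have hi' : LeftInvOn G F U := hi.1.mono subset_closure
  refine ⟨G, ⟨⟨fun q hq => ?_, ?_⟩, ?_, hb⟩, hi.1, hi.2⟩
  · obtain ⟨p, hp, rfl⟩ := hF.1.2.surjOn hq
    exact (image_mem_nhds_and_holomorphicAt hU hF.1.1 hi' hp).2
  · refine ⟨?_, hb.injOn.mono subset_closure, fun p hp => ⟨F p, hF.1.2.mapsTo hp, hi' hp⟩⟩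
    intro q hq
    obtain ⟨p, hp, rfl⟩ := hF.1.2.surjOn hq
    rwa [hi' hp]
  · rw [continuousOn_iff_isClosed]
    -- The preimage of a closed set under the inverse is a forward image under F, closed by
    -- compactness.
    intro t ht
    refine ⟨F '' (closure U ∩ t), ((isClosed_closure.inter ht).isCompact.image_of_continuousOn
      (hF.2.1.mono inter_subset_left)).isClosed, ?_⟩
    ext q
    constructor
    · rintro ⟨hq, hqV⟩
      exact ⟨⟨G q, ⟨hb.mapsTo hqV, hq⟩, hi.2 hqV⟩, hqV⟩
    · rintro ⟨⟨p, hp, rfl⟩, hqV⟩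
      exact ⟨by rw [mem_preimage, hi.1 hp.1]; exact hp.2, hqV⟩

lemma bijOn_frontier_of_bijOn (hU : IsOpen U) (hV : IsOpen V) (h : BijOn F U V)
    (h' : BijOn F (closure U) (closure V)) : BijOn F (frontier U) (frontier V) := by
  rw [hU.frontier_eq, hV.frontier_eq]
  refine ⟨fun p hp => ⟨h'.mapsTo hp.1, fun hq => ?_⟩, h'.injOn.mono sdiff_subset, fun q hq => ?_⟩
  · obtain ⟨p', hp', he⟩ := h.surjOn hq
    exact hp.2 (h'.injOn (subset_closure hp') hp.1 he ▸ hp')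
  · obtain ⟨p, hp, rfl⟩ := h'.surjOn hq.1
    exact ⟨p, ⟨hp, fun hpU => hq.2 (h.mapsTo hpU)⟩, rfl⟩

lemma IsConformalOntoWithExtension.bijOn_frontier (hU : IsOpen U) (hV : IsOpen V)
    (hF : IsConformalOntoWithExtension F U V) : BijOn F (frontier U) (frontier V) :=
  bijOn_frontier_of_bijOn hU hV hF.1.2 hF.2.2

lemma isConformalOntoWithExtension_homeomorph (F : Sphere ≃ₜ Sphere)
    (hF : ∀ p ∈ U, HolomorphicAt F p) : IsConformalOntoWithExtension F U (F '' U) := by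
  refine ⟨⟨hF, F.injective.injOn.bijOn_image⟩, F.continuous.continuousOn, ?_⟩
  rw [← F.image_closure]
  exact F.injective.injOn.bijOn_image

lemma isConformalOntoWithExtension_smul (T : GL (Fin 2) ℂ) (U : Set Sphere) :
    IsConformalOntoWithExtension (fun x => T • x) U ((fun x => T • x) '' U) :=
  isConformalOntoWithExtension_homeomorph (smulHomeo T) fun p _ => holomorphicAt_smul T p

lemma image_exterior (F : Sphere ≃ₜ Sphere) (U : Set Sphere) :
    F '' exterior U = exterior (F '' U) := by
  rw [exterior, exterior, image_compl_eq F.bijective, F.image_closure]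

lemma isOpen_exterior (U : Set Sphere) : IsOpen (exterior U) := isClosed_closure.isOpen_compl

lemma frontier_exterior_subset (U : Set Sphere) : frontier (exterior U) ⊆ frontier U := by
  rw [exterior, frontier_compl]
  exact frontier_closure_subset

/-! ### The disk and its exterior -/

lemma isOpen_disk : IsOpen disk := OnePoint.isOpen_image_coe.2 isOpen_ball

lemma closure_image_coe {S : Set ℂ} (hS : Bornology.IsBounded S) :
    closure ((fun z : ℂ => (z : Sphere)) '' S) = (fun z : ℂ => (z : Sphere)) '' closure S := by
  refine Subset.antisymm (closure_minimal (image_mono subset_closure) ?_)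
    (image_closure_subset_closure_image OnePoint.continuous_coe)
  exact (hS.isCompact_closure.image OnePoint.continuous_coe).isClosed

lemma closure_disk : closure disk = (fun z : ℂ => (z : Sphere)) '' closedBall 0 1 := by
  rw [disk, closure_image_coe isBounded_ball, closure_ball _ one_ne_zero]

lemma frontier_disk : frontier disk = range circleIncl := by
  rw [isOpen_disk.frontier_eq, closure_disk, disk, ← image_sdiff OnePoint.coe_injective,
    closedBall_sdiff_ball]
  ext x
  constructor
  · rintro ⟨z, hz, rfl⟩
    exact ⟨⟨z, hz⟩, rfl⟩
  · rintro ⟨z, rfl⟩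
    exact ⟨z, z.2, rfl⟩

lemma inversion_circleIncl (z : Circle) : inversion (circleIncl z) = circleIncl z⁻¹ := by
  rw [circleIncl, circleIncl, inversion_coe z.coe_ne_zero, Circle.coe_inv]

lemma image_inversion_disk : inversionHomeo '' disk = exterior disk := by
  rw [exterior, closure_disk]
  ext x
  constructor
  · rintro ⟨_, ⟨z, hz, rfl⟩, rfl⟩
    change inversion z ∈ _
    rintro ⟨w, hw, hwz⟩
    have h1 : (z : Sphere) = inversion w := by
      rw [← inversion_inversion (z : Sphere), ← hwz]
    rcases eq_or_ne w 0 with rfl | h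
    · exact OnePoint.coe_ne_infty _ (h1.trans inversion_zero)
    · rw [inversion_coe h, OnePoint.coe_eq_coe] at h1
      rw [mem_ball_zero_iff, h1, norm_inv] at hz
      exact hz.not_ge ((one_le_inv₀ (norm_pos_iff.2 h)).2 (mem_closedBall_zero_iff.1 hw))
  · intro hx
    refine ⟨inversion x, ?_, inversion_inversion x⟩
    induction x using OnePoint.rec with
    | infty => exact ⟨0, by simp, rfl⟩
    | coe z =>
      have hz : 1 < ‖z‖ := by
        by_contra! h
        exact hx ⟨z, mem_closedBall_zero_iff.2 h, rfl⟩
      have h0 : z ≠ 0 := norm_pos_iff.1 (one_pos.trans hz)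
      rw [inversion_coe h0]
      exact ⟨z⁻¹, by rw [mem_ball_zero_iff, norm_inv]; exact inv_lt_one_of_one_lt₀ hz, rfl⟩

lemma image_inversion_exterior_disk : inversionHomeo '' exterior disk = disk := by
  rw [← image_inversion_disk, image_image]
  simp [inversionHomeo]

lemma isConformalOntoWithExtension_inversion :
    IsConformalOntoWithExtension inversion (exterior disk) disk := by
  have := isConformalOntoWithExtension_homeomorph (U := exterior disk) inversionHomeo
    fun p _ => holomorphicAt_inversion p
  rwa [image_inversion_exterior_disk] at this

lemma frontier_exterior_disk : frontier (exterior disk) = range circleIncl := by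
  rw [← image_inversion_disk, ← inversionHomeo.image_frontier, frontier_disk]
  ext x
  constructor
  · rintro ⟨_, ⟨z, rfl⟩, rfl⟩
    exact ⟨z⁻¹, (inversion_circleIncl z).symm⟩
  · rintro ⟨z, rfl⟩
    exact ⟨_, ⟨z⁻¹, rfl⟩, (inversion_circleIncl z⁻¹).trans (by rw [inv_inv])⟩

/-- The reflection in the unit circle. -/
def reflection : Sphere ≃ₜ Sphere where
  toFun x := sphereConj (inversion x)
  invFun x := inversion (sphereConj x)
  left_inv x := by simp
  right_inv x := by simp
  continuous_toFun := continuous_sphereConj.comp continuous_inversion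
  continuous_invFun := continuous_inversion.comp continuous_sphereConj

lemma reflection_reflection (x : Sphere) : reflection (reflection x) = x := by
  simp [reflection, sphereConj_inversion]

lemma image_reflection_image (S : Set Sphere) : reflection '' (reflection '' S) = S := by
  rw [image_image]
  simp [reflection_reflection]

lemma reflection_circleIncl (z : Circle) : reflection (circleIncl z) = circleIncl z := by
  change sphereConj (inversion (circleIncl z)) = _
  rw [inversion_circleIncl, circleIncl, circleIncl, sphereConj_coe, ← Circle.coe_inv_eq_conj,
    inv_inv]

lemma image_reflection_disk : reflection '' disk = exterior disk := by
  have h : sphereConj '' disk = disk := by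
    ext x
    constructor
    · rintro ⟨_, ⟨z, hz, rfl⟩, rfl⟩
      exact ⟨starRingEnd ℂ z, by simpa using hz, rfl⟩
    · rintro ⟨z, hz, rfl⟩
      exact ⟨_, ⟨starRingEnd ℂ z, by simpa using hz, rfl⟩, by simp⟩
  rw [← image_inversion_disk]
  nth_rewrite 2 [← h]
  rw [image_image]
  exact image_congr fun x _ => sphereConj_inversion x

lemma image_reflection_exterior_disk : reflection '' exterior disk = disk := by
  rw [← image_reflection_disk, image_reflection_image]

/-- Conjugation of a conformal map by the reflection in the unit circle. -/
lemma IsConformalOntoWithExtension.reflection_comp (hF : IsConformalOntoWithExtension F U V) :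
    IsConformalOntoWithExtension (reflection ∘ F ∘ reflection) (reflection '' U)
      (reflection '' V) := by
  have hb : ∀ {A B : Set Sphere}, BijOn F A B →
      BijOn (reflection ∘ F ∘ reflection) (reflection '' A) (reflection '' B) := by
    intro A B h
    refine (reflection.injective.injOn.bijOn_image).comp (h.comp ?_)
    have := reflection.injective.injOn.bijOn_image (s := reflection '' A)
    rwa [image_reflection_image] at this
  refine ⟨⟨?_, hb hF.1.2⟩, ?_, ?_⟩
  · rintro _ ⟨p, hp, rfl⟩
    -- The reflection is antiholomorphic, so it is split into the holomorphic inversion and complex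
    -- conjugation; conjugating by the latter preserves holomorphy.
    have h1 : HolomorphicAt (inversion ∘ F ∘ inversion)
        (sphereConj (reflection p)) := by
      have e : sphereConj (reflection p) = inversion p := sphereConj_sphereConj _
      rw [e]
      refine (holomorphicAt_inversion _).comp (HolomorphicAt.comp ?_ (holomorphicAt_inversion _))
      rw [inversion_inversion]
      exact hF.1.1 p hp
    refine h1.sphereConj_comp.congr (Eventually.of_forall fun x => ?_)
    change sphereConj (inversion (F (inversion (sphereConj x)))) =
      sphereConj (inversion (F (sphereConj (inversion x))))
    rw [sphereConj_inversion x]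
  · rw [← reflection.image_closure]
    refine reflection.continuous.comp_continuousOn
      (hF.2.1.comp reflection.continuous.continuousOn ?_)
    rintro _ ⟨x, hx, rfl⟩
    rwa [reflection_reflection]
  · rw [← reflection.image_closure, ← reflection.image_closure]
    exact hb hF.2.2

/-! ### Homeomorphisms of the circle -/

lemma isEmbedding_circleIncl : IsEmbedding circleIncl :=
  OnePoint.isOpenEmbedding_coe.isEmbedding.comp IsEmbedding.subtypeVal

lemma exists_homeomorph_circle (hF : ContinuousOn F (range circleIncl))
    (hF' : BijOn F (range circleIncl) (range circleIncl)) :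
    ∃ φ : Circle ≃ₜ Circle, ∀ z, F (circleIncl z) = circleIncl (φ z) := by
  choose φ hφ using fun z : Circle => hF'.mapsTo (mem_range_self z)
  have hφc : Continuous φ := by
    rw [isEmbedding_circleIncl.continuous_iff]
    have : circleIncl ∘ φ = F ∘ circleIncl := funext hφ
    rw [this]
    exact hF.comp_continuous isEmbedding_circleIncl.continuous mem_range_self
  have hb : Function.Bijective φ := by
    constructor
    · intro z w h
      exact isEmbedding_circleIncl.injective (hF'.injOn (mem_range_self z) (mem_range_self w)
        (by rw [← hφ, ← hφ, h]))
    · intro w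
      obtain ⟨_, ⟨z, rfl⟩, hz⟩ := hF'.surjOn (mem_range_self w)
      exact ⟨z, isEmbedding_circleIncl.injective (by rw [hφ, hz])⟩
  refine ⟨Continuous.homeoOfEquivCompactToT2 (f := Equiv.ofBijective φ hb) hφc, fun z => ?_⟩
  exact (hφ z).symm

lemma IsConformalOntoWithExtension.exists_mem_diskAut
    (hF : IsConformalOntoWithExtension F disk disk) :
    ∃ φ ∈ diskAut, ∀ z, F (circleIncl z) = circleIncl (φ z) := by
  have hb := hF.bijOn_frontier isOpen_disk isOpen_disk
  rw [frontier_disk] at hb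
  obtain ⟨φ, hφ⟩ := exists_homeomorph_circle
    (hF.2.1.mono (frontier_disk ▸ frontier_subset_closure)) hb
  exact ⟨φ, ⟨F, hF, hφ⟩, hφ⟩

/-- Reflection carries the exterior disk to the disk and fixes the circle pointwise, so the
conjugated map has the same boundary values. -/
lemma IsConformalOntoWithExtension.exists_mem_diskAut_of_exterior
    (hF : IsConformalOntoWithExtension F (exterior disk) (exterior disk)) :
    ∃ φ ∈ diskAut, ∀ z, F (circleIncl z) = circleIncl (φ z) := by
  have h1 := hF.reflection_comp
  rw [image_reflection_exterior_disk] at h1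
  obtain ⟨φ, hφ, hφ'⟩ := h1.exists_mem_diskAut
  refine ⟨φ, hφ, fun z => ?_⟩
  have h2 := congrArg reflection (hφ' z)
  simpa [reflection_reflection, reflection_circleIncl] using h2

lemma exists_exterior_of_mem_diskAut {φ : Circle ≃ₜ Circle} (hφ : φ ∈ diskAut) :
    ∃ Φ, IsConformalOntoWithExtension Φ (exterior disk) (exterior disk) ∧
      ∀ z, Φ (circleIncl z) = circleIncl (φ z) := by
  obtain ⟨Φ, hΦ, h⟩ := hφ
  have h1 := hΦ.reflection_comp
  rw [image_reflection_disk] at h1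
  refine ⟨_, h1, fun z => ?_⟩
  simp [reflection_circleIncl, h]

lemma refl_mem_diskAut : Homeomorph.refl Circle ∈ diskAut :=
  ⟨id, isConformalOntoWithExtension_id disk, fun _ => rfl⟩

lemma trans_mem_diskAut {φ ψ : Circle ≃ₜ Circle} (hφ : φ ∈ diskAut) (hψ : ψ ∈ diskAut) :
    φ.trans ψ ∈ diskAut := by
  obtain ⟨Φ, hΦ, h⟩ := hφ
  obtain ⟨Ψ, hΨ, h'⟩ := hψ
  exact ⟨Ψ ∘ Φ, hΨ.comp hΦ, fun z => by simp [h, h']⟩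

lemma circleIncl_mem_closure_disk (z : Circle) : circleIncl z ∈ closure disk :=
  frontier_subset_closure (frontier_disk ▸ mem_range_self z)

lemma circleIncl_mem_closure_exterior_disk (z : Circle) :
    circleIncl z ∈ closure (exterior disk) :=
  frontier_subset_closure (frontier_exterior_disk ▸ mem_range_self z)

lemma symm_mem_diskAut {φ : Circle ≃ₜ Circle} (hφ : φ ∈ diskAut) : φ.symm ∈ diskAut := by
  obtain ⟨Φ, hΦ, h⟩ := hφ
  obtain ⟨Ψ, hΨ, hl, -⟩ := hΦ.exists_inverse isOpen_disk
  refine ⟨Ψ, hΨ, fun z => ?_⟩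
  have h1 := h (φ.symm z)
  rw [φ.apply_symm_apply] at h1
  rw [← h1, hl (circleIncl_mem_closure_disk _)]

lemma homeoClass_subset_of_mem {h k : Circle ≃ₜ Circle} (hk : k ∈ homeoClass h) :
    homeoClass k ⊆ homeoClass h := by
  obtain ⟨φ, hφ, ψ, hψ, rfl⟩ := hk
  rintro _ ⟨φ', hφ', ψ', hψ', rfl⟩
  exact ⟨φ.trans φ', trans_mem_diskAut hφ hφ', ψ'.trans ψ, trans_mem_diskAut hψ' hψ, rfl⟩

lemma self_mem_homeoClass (h : Circle ≃ₜ Circle) : h ∈ homeoClass h :=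
  ⟨_, refl_mem_diskAut, _, refl_mem_diskAut, rfl⟩

/-! ### Jordan domains in the sphere -/

/-- The finite part of a set. -/
def finitePart (S : Set Sphere) : Set ℂ := (fun z : ℂ => (z : Sphere)) ⁻¹' S

lemma isOpen_finitePart {S : Set Sphere} (hS : IsOpen S) : IsOpen (finitePart S) :=
  hS.preimage OnePoint.continuous_coe

lemma closure_finitePart (S : Set Sphere) : closure (finitePart S) = finitePart (closure S) :=
  (OnePoint.isOpenMap_coe.preimage_closure_eq_closure_preimage OnePoint.continuous_coe S).symm

lemma frontier_finitePart (S : Set Sphere) : frontier (finitePart S) = finitePart (frontier S) :=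
  (OnePoint.isOpenMap_coe.preimage_frontier_eq_frontier_preimage OnePoint.continuous_coe S).symm

lemma image_finitePart {S : Set Sphere} (hS : ∞ ∉ S) :
    (fun z : ℂ => (z : Sphere)) '' finitePart S = S := by
  refine image_preimage_eq_of_subset fun x hx => ?_
  exact OnePoint.ne_infty_iff_exists.1 fun h => hS (h ▸ hx)

lemma isBounded_finitePart_compl {S : Set Sphere} (hS : IsOpen S) (h : ∞ ∈ S) :
    Bornology.IsBounded (finitePart Sᶜ) :=
  ((OnePoint.isOpen_iff_of_mem' h).1 hS).1.isBounded

lemma isBounded_finitePart_of_disjoint {S T : Set Sphere} (hS : IsOpen S) (h : ∞ ∈ S)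
    (hd : Disjoint S T) : Bornology.IsBounded (finitePart T) :=
  (isBounded_finitePart_compl hS h).subset (preimage_mono hd.symm.subset_compl_right)

/-- Removing the point at infinity from a domain does not disconnect it. -/
lemma isPreconnected_finitePart {S : Set Sphere} (hS : IsOpen S) (hc : IsPreconnected S)
    (h : ∞ ∈ S) : IsPreconnected (finitePart S) := by
  obtain ⟨R, hR⟩ := (isBounded_finitePart_compl hS h).subset_closedBall 0
  have hRS : (closedBall (0 : ℂ) R)ᶜ ⊆ finitePart S := fun z hz => by
    by_contra h'
    exact hz (hR h')
  obtain ⟨q, hq⟩ : (closedBall (0 : ℂ) R)ᶜ.Nonempty := by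
    by_contra! h'
    exact NormedSpace.unbounded_univ ℝ ℂ
      (compl_empty_iff.1 h' ▸ isBounded_closedBall (x := (0 : ℂ)) (r := R))
  -- C is the component containing everything outside a large ball, so Cᶜ is compact and C ∪ {∞} is
  -- open in the sphere. The rest of S is open as well, hence empty by connectedness of S.
  set C := connectedComponentIn (finitePart S) q with hC
  have hSo := isOpen_finitePart hS
  have hCo : IsOpen C := hSo.connectedComponentIn
  have hRC : (closedBall (0 : ℂ) R)ᶜ ⊆ C :=
    (isPreconnected_compl_closedBall 0 R).subset_connectedComponentIn hq hRS
  have hDo : IsOpen (finitePart S \ C) := by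
    rw [isOpen_iff_mem_nhds]
    intro x hx
    refine mem_of_superset (hSo.connectedComponentIn.mem_nhds (mem_connectedComponentIn hx.1))
      fun y hy => ⟨connectedComponentIn_subset _ _ hy, fun hyC => hx.2 ?_⟩
    rw [hC, connectedComponentIn_eq hyC, ← connectedComponentIn_eq hy]
    exact mem_connectedComponentIn hx.1
  have hCc : IsOpen ((fun z : ℂ => (z : Sphere)) '' Cᶜ)ᶜ :=
    (((isCompact_closedBall (0 : ℂ) R).of_isClosed_subset hCo.isClosed_compl
      (compl_subset_comm.1 hRC)).image OnePoint.continuous_coe).isClosed.isOpen_compl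
  have hsub := hc.subset_left_of_subset_union hCc (OnePoint.isOpen_image_coe.2 hDo) ?_ ?_
    ⟨∞, h, OnePoint.infty_notMem_image_coe⟩
  · have : finitePart S = C := by
      refine Subset.antisymm (fun z hz => ?_) (connectedComponentIn_subset _ _)
      by_contra hzC
      exact hsub (show (z : Sphere) ∈ S from hz) ⟨z, hzC, rfl⟩
    rw [this]
    exact isPreconnected_connectedComponentIn
  · exact disjoint_compl_left.mono_right (image_mono fun z hz => hz.2)
  · intro x hx
    by_cases hx' : x ∈ (fun z : ℂ => (z : Sphere)) '' Cᶜ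
    · obtain ⟨z, hz, rfl⟩ := hx'
      exact Or.inr ⟨z, ⟨hx, hz⟩, rfl⟩
    · exact Or.inl hx'

/-- Two points of the circle split it into arcs with only these points in common, and their images
are continua meeting in exactly two points. -/
lemma not_isPreconnected_compl_range {γ : Circle → ℂ} (hγ : Continuous γ)
    (hi : Function.Injective γ) : ¬ IsPreconnected (range γ)ᶜ := by
  obtain ⟨b, hb⟩ := (Circle.isPathConnected_compl_singleton 1).nonempty
  have h : (1 : Circle) ≠ b := fun h => hb h.symm
  have hc : ∀ x y : Circle, IsCompact (γ '' range (Circle.path x y)) := fun x y =>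
    (isCompact_range (Circle.path x y).continuous).image hγ
  have hp : ∀ x y : Circle, IsPreconnected (γ '' range (Circle.path x y)) := fun x y =>
    (isPreconnected_range (Circle.path x y).continuous).image _ hγ.continuousOn
  have := not_isPreconnected_compl_union (hc 1 b) (hc b 1) (hp 1 b) (hp b 1) (hi.ne h)
    (by rw [← image_inter hi, Circle.range_path_inter_range_path h, image_pair])
  rwa [← image_union, Circle.range_path_union_range_path h, image_univ] at this

lemma exists_lift_of_infty_notMem {γ : Circle → Sphere} (hγ : Continuous γ)
    (hi : Function.Injective γ) (h : ∞ ∉ range γ) :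
    ∃ γ₀ : Circle → ℂ, Continuous γ₀ ∧ Function.Injective γ₀ ∧ range γ₀ = finitePart (range γ) := by
  have h' : ∀ z, γ z ≠ ∞ := fun z hz => h ⟨z, hz⟩
  refine ⟨fun z => toC (γ z), ?_, ?_, ?_⟩
  · rw [continuous_iff_continuousAt]
    exact fun z => ContinuousAt.comp (continuousAt_toC (h' z)) hγ.continuousAt
  · intro z w hzw
    apply hi
    rw [← coe_toC (h' z), ← coe_toC (h' w)]
    exact congrArg _ hzw
  · ext x
    constructor
    · rintro ⟨z, rfl⟩
      exact ⟨z, (coe_toC (h' z)).symm⟩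
    · rintro ⟨z, hz⟩
      exact ⟨z, by simp [hz]⟩

lemma IsJordanDomain.image_smul {Ω : Set Sphere} (hΩ : IsJordanDomain Ω) (T : GL (Fin 2) ℂ) :
    IsJordanDomain (smulHomeo T '' Ω) := by
  obtain ⟨ho, hc, γ, hγ, hi, hr⟩ := hΩ
  refine ⟨(smulHomeo T).isOpen_image.2 ho, hc.image _ (smulHomeo T).continuous.continuousOn,
    smulHomeo T ∘ γ, (smulHomeo T).continuous.comp hγ, (smulHomeo T).injective.comp hi, ?_⟩
  rw [range_comp, hr, (smulHomeo T).image_frontier]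

lemma disjoint_exterior (S : Set Sphere) : Disjoint S (exterior S) :=
  disjoint_compl_right.mono_left subset_closure

/-- With ∞ in Ω the exterior is a bounded plane set whose frontier lies on the curve. It is
nonempty, since otherwise the complement of the curve would be the finite part of Ω, which is
connected. Its frontier is the whole curve, because a proper closed part bounds nothing. It is
connected, because the curve cannot bound two disjoint bounded open sets. -/
lemma IsJordanDomain.isJordanDomain_exterior_of_infty_mem {Ω : Set Sphere} (hΩ : IsJordanDomain Ω)
    (h : ∞ ∈ Ω) : IsConnected (exterior Ω) ∧ frontier (exterior Ω) = frontier Ω := by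
  obtain ⟨ho, hc, γ, hγ, hi, hr⟩ := hΩ
  have hfr : Disjoint Ω (frontier Ω) := (disjoint_frontier_iff_isOpen.2 ho).symm
  obtain ⟨γ₀, hγ₀, hi₀, hr₀⟩ := exists_lift_of_infty_notMem hγ hi
    (hr ▸ fun h' => Set.disjoint_left.1 hfr h h')
  rw [hr] at hr₀
  have hext : ∞ ∉ exterior Ω := fun h' => h' (subset_closure h)
  have hfrb : ∞ ∉ frontier Ω := fun h' => Set.disjoint_left.1 hfr h h'
  set E := finitePart (exterior Ω) with hE
  have hEo : IsOpen E := isOpen_finitePart (isOpen_exterior Ω)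
  have hEb : Bornology.IsBounded E := isBounded_finitePart_of_disjoint ho h (disjoint_exterior Ω)
  have hEfr : frontier E ⊆ range γ₀ := by
    rw [hE, frontier_finitePart, hr₀]
    exact preimage_mono (frontier_exterior_subset Ω)
  have hEd : Disjoint E (range γ₀) := by
    rw [hr₀]
    exact (disjoint_compl_left.mono_right frontier_subset_closure).preimage _
  have hEne : E.Nonempty := by
    by_contra! hE0
    refine not_isPreconnected_compl_range hγ₀ hi₀ ?_
    convert isPreconnected_finitePart ho hc.isPreconnected h using 1
    rw [hr₀]
    ext z
    have hz : z ∉ E := hE0 ▸ notMem_empty z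
    have hz' : (z : Sphere) ∈ closure Ω := by
      by_contra h'
      exact hz h'
    change ¬ ((z : Sphere) ∈ frontier Ω) ↔ (z : Sphere) ∈ Ω
    rw [ho.frontier_eq]
    simp [hz']
  have hEfr' : frontier E = range γ₀ := by
    refine hEfr.antisymm ?_
    by_contra hne
    refine not_frontier_subset_image hγ₀ hi₀ (isClosed_frontier.preimage hγ₀ :
      IsClosed (γ₀ ⁻¹' frontier E)) (fun hu => hne ?_) hEo hEb hEne hEd ?_
    · rintro _ ⟨z, rfl⟩
      exact hu.ge (mem_univ z)
    · intro x hx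
      obtain ⟨z, rfl⟩ := hEfr hx
      exact ⟨z, hx, rfl⟩
  have hEc : IsPreconnected E := by
    intro u v hu hv huv hEu hEv
    by_contra hcon
    -- Frontier points of a piece of a separation of E are not in E, since the other piece is a
    -- neighbourhood of any such point.
    have hsub : ∀ u v : Set ℂ, IsOpen u → IsOpen v → E ⊆ u ∪ v → ¬ (E ∩ (u ∩ v)).Nonempty →
        frontier (E ∩ u) ⊆ range γ₀ := by
      intro u v hu hv huv hcon x hx
      rw [(hEo.inter hu).frontier_eq] at hx
      by_cases hxE : x ∈ E
      · rcases huv hxE with h' | h'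
        · exact absurd ⟨hxE, h'⟩ hx.2
        · obtain ⟨y, hyv, hyE, hyu⟩ := mem_closure_iff.1 hx.1 v hv h'
          exact absurd ⟨y, hyE, hyu, hyv⟩ hcon
      · exact hEfr ((hEo.frontier_eq).ge ⟨closure_mono inter_subset_left hx.1, hxE⟩)
    refine not_disjoint_of_frontier_subset_range hγ₀ hi₀ (hEo.inter hu) (hEo.inter hv)
      (hEb.subset inter_subset_left) (hEb.subset inter_subset_left) hEu hEv
      (hEd.mono_left inter_subset_left) (hEd.mono_left inter_subset_left)
      (hsub u v hu hv huv hcon)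
      (hsub v u hv hu (by rwa [union_comm]) (by rwa [inter_comm v u])) ?_
    rw [Set.disjoint_left]
    exact fun x hx hx' => hcon ⟨x, hx.1, hx.2, hx'.2⟩
  constructor
  · rw [← image_finitePart hext]
    exact (IsConnected.image ⟨hEne, hEc⟩ _ OnePoint.continuous_coe.continuousOn)
  · have hext' : ∞ ∉ frontier (exterior Ω) := fun h' => hfrb (frontier_exterior_subset Ω h')
    rw [← image_finitePart hext', ← image_finitePart hfrb, ← frontier_finitePart, ← hE, hEfr', hr₀]

/-- A Möbius transformation sends some point of Ω to ∞, and the claim is invariant under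
homeomorphisms. -/
lemma IsJordanDomain.exterior_aux {Ω : Set Sphere} (hΩ : IsJordanDomain Ω) :
    IsConnected (exterior Ω) ∧ frontier (exterior Ω) = frontier Ω := by
  obtain ⟨p, hp⟩ := hΩ.2.1.nonempty
  obtain ⟨T, hT⟩ := exists_smul_eq_infty p
  obtain ⟨h1, h2⟩ := (hΩ.image_smul T).isJordanDomain_exterior_of_infty_mem ⟨p, hp, hT⟩
  rw [← image_exterior, ← (smulHomeo T).image_frontier, ← (smulHomeo T).image_frontier] at h2
  rw [← image_exterior, (smulHomeo T).isConnected_image] at h1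
  exact ⟨h1, (smulHomeo T).injective.image_injective h2⟩

lemma IsJordanDomain.frontier_exterior {Ω : Set Sphere} (hΩ : IsJordanDomain Ω) :
    frontier (exterior Ω) = frontier Ω := hΩ.exterior_aux.2

lemma IsJordanDomain.isJordanDomain_exterior {Ω : Set Sphere} (hΩ : IsJordanDomain Ω) :
    IsJordanDomain (exterior Ω) := by
  refine ⟨isOpen_exterior Ω, hΩ.exterior_aux.1, ?_⟩
  rw [hΩ.frontier_exterior]
  exact hΩ.2.2

lemma IsJordanDomain.exists_extension_of_infty_mem {Ω : Set Sphere} (hΩ : IsJordanDomain Ω)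
    (h : ∞ ∈ exterior Ω) : ∃ F, IsConformalOntoWithExtension F disk Ω := by
  have hΩ' := hΩ
  obtain ⟨ho, hc, γ, hγ, hi, hr⟩ := hΩ
  have hcl : ∞ ∉ closure Ω := h
  obtain ⟨γ₀, hγ₀, hi₀, hr₀⟩ := exists_lift_of_infty_notMem hγ hi
    (hr ▸ fun h' => hcl (frontier_subset_closure h'))
  have hne : ∞ ∉ Ω := fun h' => hcl (subset_closure h')
  have hΩe : finitePart (exterior Ω) = (closure (finitePart Ω))ᶜ := by
    rw [closure_finitePart]; rfl
  have hconn : IsConnected (finitePart Ω) := by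
    obtain ⟨p, hp⟩ := hc.nonempty
    refine ⟨⟨toC p, ?_⟩, ?_⟩
    · change ((toC p : ℂ) : Sphere) ∈ Ω
      rwa [coe_toC fun h' => hne (h' ▸ hp)]
    · refine hc.isPreconnected.preimage_of_isOpenMap OnePoint.coe_injective OnePoint.isOpenMap_coe ?_
      rw [← image_finitePart hne]
      exact image_subset_range _ _
  obtain ⟨F, hFc, hF, hFb, hFb'⟩ := exists_bijOn_closedBall (isOpen_finitePart ho) hconn
    (isBounded_finitePart_of_disjoint (isOpen_exterior Ω) h (disjoint_exterior Ω).symm) hγ₀ hi₀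
    (by rw [hr₀, hr, frontier_finitePart])
    (hΩe ▸ isPreconnected_finitePart (isOpen_exterior Ω) hΩ'.exterior_aux.1.isPreconnected h)
    (by
      rw [← hΩe, closure_finitePart, frontier_finitePart, ← hΩ'.frontier_exterior]
      exact preimage_mono frontier_subset_closure)
  set f : Sphere → Sphere := fun x => ((F (toC x) : ℂ) : Sphere) with hf
  have hfb : ∀ {A B : Set ℂ}, BijOn F A B → BijOn f ((fun z : ℂ => (z : Sphere)) '' A)
      ((fun z : ℂ => (z : Sphere)) '' B) := by
    intro A B hAB
    refine ⟨?_, ?_, ?_⟩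
    · rintro _ ⟨z, hz, rfl⟩
      exact ⟨F z, hAB.mapsTo hz, rfl⟩
    · rintro _ ⟨z, hz, rfl⟩ _ ⟨w, hw, rfl⟩ he
      rw [hAB.injOn hz hw (OnePoint.coe_injective he)]
    · rintro _ ⟨w, hw, rfl⟩
      obtain ⟨z, hz, rfl⟩ := hAB.surjOn hw
      exact ⟨_, ⟨z, hz, rfl⟩, rfl⟩
  refine ⟨f, ⟨?_, ?_⟩, ?_, ?_⟩
  · rintro _ ⟨z, hz, rfl⟩
    exact holomorphicAt_coe_of_eventuallyEq (Eventually.of_forall fun w => rfl)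
      (hF.differentiableAt (isOpen_ball.mem_nhds hz))
  · have := hfb hFb
    rwa [image_finitePart hne] at this
  · rw [closure_disk]
    rintro _ ⟨z, hz, rfl⟩
    rw [ContinuousWithinAt, OnePoint.nhdsWithin_coe_image, tendsto_map'_iff]
    exact (OnePoint.continuous_coe.tendsto _).comp (hFc z hz)
  · have := hfb hFb'
    rwa [closure_finitePart, image_finitePart hcl, ← closure_disk] at this

/-- The Riemann mapping theorem, with Carathéodory's extension, for Jordan domains in the
sphere. -/
theorem IsJordanDomain.exists_extension {Ω : Set Sphere} (hΩ : IsJordanDomain Ω) :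
    ∃ F, IsConformalOntoWithExtension F disk Ω := by
  obtain ⟨p, hp⟩ := hΩ.exterior_aux.1.nonempty
  obtain ⟨T, hT⟩ := exists_smul_eq_infty p
  obtain ⟨F, hF⟩ := (hΩ.image_smul T).exists_extension_of_infty_mem
    (image_exterior (smulHomeo T) Ω ▸ ⟨p, hp, hT⟩)
  have h1 := isConformalOntoWithExtension_smul T⁻¹ (smulHomeo T '' Ω)
  have h2 : (fun x : Sphere => T⁻¹ • x) '' (smulHomeo T '' Ω) = Ω :=
    (smulHomeo T).toEquiv.symm_image_image Ω
  rw [h2] at h1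
  exact ⟨_, h1.comp hF⟩

/-! ### Conformal weldings -/

variable {Ω Ω' : Set Sphere} {h h' : Circle ≃ₜ Circle}

/-- The extended Riemann map of Ω* becomes a map from 𝔻* after precomposition with the inversion;
f⁻¹ ∘ g then maps the circle to itself because boundaries correspond. -/
lemma IsJordanDomain.exists_isConformalWelding (hΩ : IsJordanDomain Ω) :
    ∃ h, IsConformalWelding Ω h := by
  obtain ⟨f, hf⟩ := hΩ.exists_extension
  obtain ⟨g₀, hg₀⟩ := hΩ.isJordanDomain_exterior.exists_extension
  have hg := hg₀.comp isConformalOntoWithExtension_inversion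
  set g := g₀ ∘ inversion
  obtain ⟨k, hk, -, hkr⟩ := hf.exists_inverse isOpen_disk
  have h1 := hg.bijOn_frontier (isOpen_exterior disk) (isOpen_exterior Ω)
  rw [frontier_exterior_disk, hΩ.frontier_exterior] at h1
  have h2 := hk.bijOn_frontier hΩ.1 isOpen_disk
  rw [frontier_disk] at h2
  obtain ⟨h, hh⟩ := exists_homeomorph_circle ((hk.2.1.mono frontier_subset_closure).comp
    (hg.2.1.mono (frontier_exterior_disk ▸ frontier_subset_closure)) h1.mapsTo) (h2.comp h1)
  refine ⟨h, f, g, hf, hg, fun z => ?_⟩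
  rw [← hh z]
  exact hkr (frontier_subset_closure (h1.mapsTo (mem_range_self z)))

/-- Two weldings of the same domain are equivalent. -/
lemma IsConformalWelding.mem_homeoClass (hh : IsConformalWelding Ω h)
    (hh' : IsConformalWelding Ω h') : h' ∈ homeoClass h := by
  obtain ⟨f, g, hf, hg, hfg⟩ := hh
  obtain ⟨f', g', hf', hg', hfg'⟩ := hh'
  obtain ⟨k', hk', hkl', hkr'⟩ := hf'.exists_inverse isOpen_disk
  obtain ⟨l, hl, -, hlr⟩ := hg.exists_inverse (isOpen_exterior disk)
  -- The factorisation is f'⁻¹ g' = (f'⁻¹ f)(f⁻¹ g)(g⁻¹ g'), with outer factors coming from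
  -- automorphisms of 𝔻 and of 𝔻*.
  obtain ⟨φ, hφ, hφ'⟩ := (hk'.comp hf).exists_mem_diskAut
  obtain ⟨ψ, hψ, hψ'⟩ := (hl.comp hg').exists_mem_diskAut_of_exterior
  refine ⟨φ, hφ, ψ, hψ, ?_⟩
  ext1 z
  apply isEmbedding_circleIncl.injective
  change _ = circleIncl (φ (h (ψ z)))
  rw [← hφ', Function.comp_apply, hfg, ← hψ', Function.comp_apply,
    hlr (hg'.2.2.mapsTo (circleIncl_mem_closure_exterior_disk z)), ← hfg',
    hkl' (circleIncl_mem_closure_disk _)]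

/-- A homeomorphism of the sphere that is conformal off the boundary preserves weldings. -/
lemma IsConformalWelding.image (hh : IsConformalWelding Ω h) (hΩ : IsOpen Ω) {F : Sphere ≃ₜ Sphere}
    (hF : F ∈ CH (frontier Ω)ᶜ) : IsConformalWelding (F '' Ω) h := by
  obtain ⟨f, g, hf, hg, hfg⟩ := hh
  have h1 := isConformalOntoWithExtension_homeomorph (U := Ω) F fun p hp =>
    hF p fun h' => Set.disjoint_left.1 (disjoint_frontier_iff_isOpen.2 hΩ) h' hp
  have h2 := isConformalOntoWithExtension_homeomorph (U := exterior Ω) F fun p hp =>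
    hF p fun h' => hp (frontier_subset_closure h')
  rw [image_exterior] at h2
  exact ⟨F ∘ f, F ∘ g, h1.comp hf, h2.comp hg, fun z => congrArg F (hfg z)⟩

/-- Möbius maps preserve weldings, so a welding of any T(Ω) is one of Ω and lies in the class of h;
all classes in the union are therefore contained in that of h. -/
lemma IsConformalWelding.weldingMap_eq (hΩ : IsJordanDomain Ω) (hh : IsConformalWelding Ω h) :
    weldingMap (domainClass Ω) = homeoClass h := by
  ext k
  constructor
  · rintro ⟨_, ⟨T', ⟨T, hT⟩, rfl⟩, h', hh', hk⟩
    refine homeoClass_subset_of_mem (hh.mem_homeoClass ?_) hk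
    have e : (smulHomeo T⁻¹) '' (T' '' Ω) = Ω := by
      rw [image_image]
      have : ∀ x, smulHomeo T⁻¹ (T' x) = x := fun x => by
        rw [hT]
        exact inv_smul_smul T x
      simp [this]
    have ho : IsOpen (T' '' Ω) := by
      have : T' = smulHomeo T := funext hT
      rw [this, (smulHomeo T).isOpen_image]
      exact hΩ.1
    rw [← e]
    exact hh'.image ho fun p _ => holomorphicAt_smul T⁻¹ p
  · intro hk
    exact ⟨Ω, ⟨id, ⟨1, fun x => (one_smul _ x).symm⟩, (image_id Ω).symm⟩, h, hh, hk⟩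

/-- Jordan domains with a common welding differ by a homeomorphism that is conformal off the
boundary. -/
lemma IsConformalWelding.exists_mem_CH (hΩ : IsJordanDomain Ω)
    (hh : IsConformalWelding Ω h) (hh' : IsConformalWelding Ω' h) :
    ∃ F ∈ CH (frontier Ω)ᶜ, F '' Ω = Ω' := by
  classical
  obtain ⟨f, g, hf, hg, hfg⟩ := hh
  obtain ⟨f', g', hf', hg', hfg'⟩ := hh'
  obtain ⟨k, hk, hkl, -⟩ := hf.exists_inverse isOpen_disk
  obtain ⟨l, hl, hll, -⟩ := hg.exists_inverse (isOpen_exterior disk)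
  have h₁ := hf'.comp hk
  have h₂ := hg'.comp hl
  set F₁ := f' ∘ k with hF₁
  set F₂ := g' ∘ l with hF₂
  -- A boundary point is g(z) = f(h z) for some z on the circle, so the two maps send it to g'(z)
  -- and f'(h z), which agree because h also welds Ω'.
  have heq : ∀ x ∈ frontier Ω, F₁ x = F₂ x := by
    intro x hx
    have hb := hg.bijOn_frontier (isOpen_exterior disk) (isOpen_exterior Ω)
    rw [frontier_exterior_disk, hΩ.frontier_exterior] at hb
    obtain ⟨_, ⟨z, rfl⟩, rfl⟩ := hb.surjOn hx
    rw [hF₁, hF₂, Function.comp_apply, Function.comp_apply,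
      hll (circleIncl_mem_closure_exterior_disk z), ← hfg, hkl (circleIncl_mem_closure_disk _), hfg']
  set F : Sphere → Sphere := (closure Ω).piecewise F₁ F₂ with hF
  have hFΩ : EqOn F F₁ (closure Ω) := piecewise_eqOn _ _ _
  have hFe : EqOn F F₂ (exterior Ω) := piecewise_eqOn_compl _ _ _
  have hFe' : EqOn F F₂ (closure (exterior Ω)) := by
    intro x hx
    by_cases hxe : x ∈ exterior Ω
    · exact hFe hxe
    · have : x ∈ frontier Ω := by
        rw [← hΩ.frontier_exterior, (isOpen_exterior Ω).frontier_eq]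
        exact ⟨hx, hxe⟩
      rw [hFΩ (frontier_subset_closure this), heq x this]
  have hFc : Continuous F := by
    rw [← continuousOn_univ, show (univ : Set Sphere) = closure Ω ∪ closure (exterior Ω) from
      (eq_univ_of_subset (union_subset_union_right _ subset_closure) (union_compl_self _)).symm]
    exact (h₁.2.1.congr hFΩ).union_of_isClosed (h₂.2.1.congr hFe') isClosed_closure isClosed_closure
  have hFb : Function.Bijective F := by
    rw [← bijOn_univ]
    have hb := (h₁.2.2.congr hFΩ.symm).union (h₂.1.2.congr hFe.symm) ?_
    · rwa [exterior, exterior, union_compl_self, union_compl_self] at hb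
    · rw [exterior, union_compl_self]
      intro x _ y _ hxy
      by_cases hx : x ∈ closure Ω <;> by_cases hy : y ∈ closure Ω
      · rw [hFΩ hx, hFΩ hy] at hxy
        exact h₁.2.2.injOn hx hy hxy
      · rw [hFΩ hx, hFe hy] at hxy
        exact absurd (hxy ▸ h₁.2.2.mapsTo hx) (h₂.1.2.mapsTo hy)
      · rw [hFe hx, hFΩ hy] at hxy
        exact absurd (hxy ▸ h₁.2.2.mapsTo hy) (h₂.1.2.mapsTo hx)
      · rw [hFe hx, hFe hy] at hxy
        exact h₂.1.2.injOn hx hy hxy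
  refine ⟨Continuous.homeoOfEquivCompactToT2 (f := Equiv.ofBijective F hFb) hFc, fun p hp => ?_, ?_⟩
  · change HolomorphicAt F p
    by_cases hpΩ : p ∈ Ω
    · exact (h₁.1.1 p hpΩ).congr ((hFΩ.mono subset_closure).symm.eventuallyEq_of_mem
        (hΩ.1.mem_nhds hpΩ))
    · have hpe : p ∈ exterior Ω := fun h' => hp (by
        rw [hΩ.1.frontier_eq]
        exact ⟨h', hpΩ⟩)
      exact (h₂.1.1 p hpe).congr (hFe.symm.eventuallyEq_of_mem ((isOpen_exterior Ω).mem_nhds hpe))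
  · change F '' Ω = Ω'
    rw [(hFΩ.mono subset_closure).image_eq, h₁.1.2.image_eq]

/-- If h' = φ ∘ h ∘ ψ, then φ is absorbed into f and ψ⁻¹, extended to 𝔻*, into g. -/
lemma IsConformalWelding.of_mem_homeoClass (hh : IsConformalWelding Ω h')
    (hm : h' ∈ homeoClass h) : IsConformalWelding Ω h := by
  obtain ⟨f, g, hf, hg, hfg⟩ := hh
  obtain ⟨φ, ⟨Φ, hΦ, hΦφ⟩, ψ, hψ, rfl⟩ := hm
  obtain ⟨Ψ, hΨ, hΨψ⟩ := exists_exterior_of_mem_diskAut (symm_mem_diskAut hψ)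
  refine ⟨f ∘ Φ, g ∘ Ψ, hf.comp hΦ, hg.comp hΨ, fun z => ?_⟩
  have h1 := hfg (ψ.symm z)
  simp only [Homeomorph.trans_apply, Homeomorph.apply_symm_apply] at h1
  rw [Function.comp_apply, Function.comp_apply, hΦφ, hΨψ, h1]

lemma weldingMap_eq_iff (hΩ : IsJordanDomain Ω) (hΩ' : IsJordanDomain Ω') :
    weldingMap (domainClass Ω) = weldingMap (domainClass Ω') ↔
      ∃ F ∈ CH (frontier Ω)ᶜ, F '' Ω = Ω' := by
  obtain ⟨h, hh⟩ := hΩ.exists_isConformalWelding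
  rw [hh.weldingMap_eq hΩ]
  constructor
  · intro he
    obtain ⟨h', hh'⟩ := hΩ'.exists_isConformalWelding
    rw [hh'.weldingMap_eq hΩ'] at he
    -- Equality of the classes means that h, a welding of Ω, also welds Ω', so the gluing applies.
    exact hh.exists_mem_CH hΩ (hh'.of_mem_homeoClass (he ▸ self_mem_homeoClass h'))
  · rintro ⟨F, hF, rfl⟩
    exact ((hh.image hΩ.1 hF).weldingMap_eq hΩ').symm

lemma domainClass_smul (T : GL (Fin 2) ℂ) (Ω : Set Sphere) :
    domainClass ((fun x : Sphere => T • x) '' Ω) = domainClass Ω := by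
  ext S
  constructor
  · rintro ⟨R', ⟨R, hR⟩, rfl⟩
    refine ⟨fun x => (R * T) • x, ⟨_, fun _ => rfl⟩, ?_⟩
    rw [image_image]
    exact image_congr fun x _ => by rw [hR, mul_smul]
  · rintro ⟨R', ⟨R, hR⟩, rfl⟩
    refine ⟨fun x => (R * T⁻¹) • x, ⟨_, fun _ => rfl⟩, ?_⟩
    rw [image_image]
    exact image_congr fun x _ => by rw [hR, mul_smul, inv_smul_smul]

lemma domainClass_eq_of_isCHRemovable (hr : IsCHRemovable (frontier Ω)) {F : Sphere ≃ₜ Sphere}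
    (hF : F ∈ CH (frontier Ω)ᶜ) : domainClass Ω = domainClass (F '' Ω) := by
  obtain ⟨T, hT⟩ := hr.2 F hF
  rw [show (F : Sphere → Sphere) = fun x => T • x from funext hT, domainClass_smul]

end ConformalWelding

end

theorem mainTheorem12 :
    -- the map `𝒲 : [Ω] ↦ [h]` is well defined
    (∀ Ω : Set ConformalWelding.Sphere, ConformalWelding.IsJordanDomain Ω →
      (∃ h, ConformalWelding.IsConformalWelding Ω h) ∧
      ∀ h, ConformalWelding.IsConformalWelding Ω h →
        ConformalWelding.weldingMap (ConformalWelding.domainClass Ω) =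
          ConformalWelding.homeoClass h) ∧
    -- `𝒲([Ω]) = 𝒲([Ω'])` iff some `F ∈ CH(ℂ_∞ ∖ ∂Ω)` maps `Ω` onto `Ω'`
    (∀ Ω Ω' : Set ConformalWelding.Sphere,
      ConformalWelding.IsJordanDomain Ω → ConformalWelding.IsJordanDomain Ω' →
      (ConformalWelding.weldingMap (ConformalWelding.domainClass Ω) =
          ConformalWelding.weldingMap (ConformalWelding.domainClass Ω') ↔
        ∃ F ∈ ConformalWelding.CH (frontier Ω)ᶜ, F '' Ω = Ω')) ∧
    -- if `∂Ω` is `CH`-removable, then `𝒲([Ω]) = 𝒲([Ω'])` iff `[Ω] = [Ω']`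
    (∀ Ω : Set ConformalWelding.Sphere, ConformalWelding.IsJordanDomain Ω →
      ConformalWelding.IsCHRemovable (frontier Ω) →
      ∀ Ω' : Set ConformalWelding.Sphere, ConformalWelding.IsJordanDomain Ω' →
      (ConformalWelding.weldingMap (ConformalWelding.domainClass Ω) =
          ConformalWelding.weldingMap (ConformalWelding.domainClass Ω') ↔
        ConformalWelding.domainClass Ω = ConformalWelding.domainClass Ω')) := by
  refine ⟨fun Ω hΩ => ⟨hΩ.exists_isConformalWelding, fun h hh => hh.weldingMap_eq hΩ⟩,
    fun Ω Ω' hΩ hΩ' => ConformalWelding.weldingMap_eq_iff hΩ hΩ', fun Ω hΩ hr Ω' hΩ' => ?_⟩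
  refine ⟨fun h => ?_, fun h => by rw [h]⟩
  obtain ⟨F, hF, rfl⟩ := (ConformalWelding.weldingMap_eq_iff hΩ hΩ').1 h
  exact ConformalWelding.domainClass_eq_of_isCHRemovable hr hF
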